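/- **Setting.** Let $M$ be a smooth manifold (finite-dimensional, Hausdorff, second countable) with an almost quaternionic structure, i.e. smooth almost complex structures $(I,J,K)$ with $IJ=K$, and a Riemannian metric $g$ for which $I,J,K$ are orthogonal. Let $\eta$ be a closed smooth complex two-form which is $KI$-taming: $\eta(Jv,w)=\eta(v,Jw)=i\,\eta(v,w)$, $\mathrm{Re}(\eta)$ tames $K$ and $\mathrm{Im}(\eta)$ tames $I$, where a real two-form $\omega$ tames an almost complex structure $A$ if there is $c>0$, independent of the point of $M$, with $\omega(v,Av)\ge c|v|^2$ for all tangent vectors $v$ (for compact $M$: $\omega(v,Av)>0$ for $v\neq0$). Let $L_0,L_1\subset M$ be embedded submanifolds with $\mathrm{Re}(\eta)|_{L_0}=0$ and $\mathrm{Re}(\eta)|_{L_1}=0$. A *$J$-antiholomorphic strip* from $p_-$ to $p_+$ is a $C^1$ map $u(t,\tau)$ from $\mathbb R\times[0,1]$ to $M$ with $\partial_tu-J(u)\partial_\tau u=0$, $u(t,0)\in L_0$, $u(t,1)\in L_1$, and $u(t,\tau)\to p_\pm$ as $t\to\pm\infty$, uniformly in $\tau$. A *Fueter strip* asymptotic to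 $J$-antiholomorphic strips $u_\pm$ (both from $p_-$ to $p_+$) and to points $p_\pm\in L_0\cap L_1$ is a $C^2$ map $U(\tau,s,t)$ from $[0,1]\times\mathbb R^2$ to $M$ with $$I(U)\partial_\tau U+J(U)\partial_sU+K(U)\partial_tU=0,\qquad U(0,s,t)\in L_0,\quad U(1,s,t)\in L_1,$$ such that $U(\tau,s,t)\to u_\pm(t,\tau)$ in $C^1(\mathbb R\times[0,1])$ as $s\to\pm\infty$, $U(\tau,s,t)\to p_\pm$ in $C^1_{\mathrm{loc}}([0,1]\times\mathbb R)$ as $t\to\pm\infty$, $\partial_sU(\tau,\cdot,\cdot)\in L^1(\mathbb R^2)\cap L^2(\mathbb R^2)$ for every $\tau\in[0,1]$, and $\partial_s U\in L^1([0,1]\times\mathbb R^2)$. Its energy is $$E(U)=\frac12\int_{[0,1]\times\mathbb R^2}|\partial_sU|^2+|\partial_tU-J(U)\partial_\tau U|^2 .$$ Write $U_\tau(s,t)=U(\tau,s,t)$. Let $H^2(M,u_+\cup u_-)$ be the space of closed smooth real two-forms $\sigma$ with $u_\pm^*\sigma=0$ modulo the forms $d\alpha$, where $\alpha$ is a smooth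 one-form with $u_\pm^*\alpha=0$; a real relative homology class is regarded as a linear functional on this space via the pairing. Two maps $f_0,f_1\colon\mathbb R^2\to M$ are *homotopic relative to $u_+\cup u_-$* if they are the restrictions to $\tau=0$ and $\tau=1$ of a $C^1$ map $F(\tau,s,t)$ from $[0,1]\times\mathbb R^2$ to $M$ such that $\int_{\mathbb R^2}F_\tau^*\sigma$ converges absolutely for all $\tau$ and all smooth two-forms $\sigma$, $\partial_sF\in L^1([0,1]\times\mathbb R^2)$, and $F$ converges, in $C^1(\mathbb R\times[0,1])$ as $s\to\pm\infty$ and in $C^1_{\mathrm{loc}}([0,1]\times\mathbb R)$ as $t\to\pm\infty$, to maps each of which is a $C^1$ map to $\mathbb R\times[0,1]$ followed by $u_+$ or $u_-$, or is constant equal to $p_+$ or $p_-$. **Theorem (Energy bound).** There is a constant $C>0$ such that every Fueter strip $U$ as above, with any $u_\pm$, $p_\pm$, has finite energy, and for every $\tau\in[0,1]$ the following integral converges absolutely and $$E(U)\le -C\int_{\{\tau\}\times\mathbb R^2}U^*\mathrm{Im}(\eta).$$ The right-hand side depends only on relative classes: $u_\pm^*\mathrm{Im}(\eta)=0$, so $\mathrm{Im}(\eta)$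 defines a class in $H^2(M,u_+\cup u_-)$; and there is a relative homology class $[U_\tau]$, independent of $\tau\in[0,1]$, such that $\int_{\mathbb R^2}U_\tau^*\sigma$ converges absolutely and equals $\langle[\sigma],[U_\tau]\rangle$ for every closed smooth real two-form $\sigma$ with $u_\pm^*\sigma=0$, and such that $\int_{\mathbb R^2}f^*\sigma=\langle[\sigma],[U_\tau]\rangle$ for every $f$ homotopic to $U_\tau$ relative to $u_+\cup u_-$. In particular $E(U)\le -C\langle[\mathrm{Im}(\eta)],[U_\tau]\rangle$. Moreover, if $\mathrm{Im}(\eta)=d\lambda$ for a smooth one-form $\lambda$ on $M$, then for every $\tau\in[0,1]$ $$E(U)\le C\int_{\mathbb R\times\{\tau\}}u_-^*\lambda-u_+^*\lambda=-C\int_{\{\tau\}\times\mathbb R^2}U^*\mathrm{Im}(\eta),$$ where the first integral is the limit of the integrals over $[a,b]\times\{\tau\}$ as $a\to-\infty$ and $b\to+\infty$, which exists. -/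

import Mathlib

open Set Filter Topology MeasureTheory
open scoped Manifold ContDiff

noncomputable section

namespace Fueter

variable {E : Type*} [NormedAddCommGroup E] [NormedSpace ℝ E]
variable {M : Type*} [TopologicalSpace M] [ChartedSpace E M]

/-! ### Differential forms on a manifold -/

variable (E M) in
/-- A (not necessarily smooth) differential `k`-form on `M` with values in `F`. -/
abbrev DForm (F : Type*) [NormedAddCommGroup F] [NormedSpace ℝ F] (k : ℕ) :=
  ∀ x : M, TangentSpace 𝓘(ℝ, E) x [⋀^Fin k]→L[ℝ] F

section Forms

variable {F : Type*} [NormedAddCommGroup F] [NormedSpace ℝ F] {k : ℕ}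

/-- The expression of a form in the preferred chart at `x₀`: its pull-back under the inverse of
the chart. It is meaningful on the target of the chart. -/
def DForm.inChart (β : DForm E M F k) (x₀ : M) (y : E) : E [⋀^Fin k]→L[ℝ] F :=
  (β ((chartAt E x₀).symm y)).compContinuousLinearMap
    (mfderiv 𝓘(ℝ, E) 𝓘(ℝ, E) (chartAt E x₀).symm y)

/-- A form is smooth if all its chart expressions are. -/
def DForm.IsSmooth (β : DForm E M F k) : Prop :=
  ∀ x₀ : M, ContDiffOn ℝ ∞ (β.inChart x₀) (chartAt E x₀).target

/-- `dα = β`, computed in charts. -/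
def DForm.HasExtDeriv (α : DForm E M F k) (β : DForm E M F (k + 1)) : Prop :=
  ∀ x₀ : M, ∀ y ∈ (chartAt E x₀).target, extDeriv (α.inChart x₀) y = β.inChart x₀ y

/-- `dβ = 0`. -/
def DForm.IsClosed (β : DForm E M F k) : Prop :=
  β.HasExtDeriv 0

end Forms

/-- The real part of a complex form. -/
def DForm.re {k : ℕ} (η : DForm E M ℂ k) : DForm E M ℝ k :=
  fun x => Complex.reCLM.compContinuousAlternatingMap (η x)

/-- The imaginary part of a complex form. -/
def DForm.im {k : ℕ} (η : DForm E M ℂ k) : DForm E M ℝ k :=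
  fun x => Complex.imCLM.compContinuousAlternatingMap (η x)

section FormLemmas

variable {F : Type*} [NormedAddCommGroup F] [NormedSpace ℝ F] {k : ℕ}

theorem DForm.inChart_zero (x₀ : M) : (0 : DForm E M F k).inChart x₀ = 0 := rfl

theorem DForm.inChart_add (β β' : DForm E M F k) (x₀ : M) :
    (β + β').inChart x₀ = β.inChart x₀ + β'.inChart x₀ := rfl

theorem DForm.inChart_smul (c : ℝ) (β : DForm E M F k) (x₀ : M) :
    (c • β).inChart x₀ = c • β.inChart x₀ := rfl

theorem DForm.IsSmooth.differentiableAt {β : DForm E M F k} (h : β.IsSmooth) {x₀ : M} {y : E}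
    (hy : y ∈ (chartAt E x₀).target) : DifferentiableAt ℝ (β.inChart x₀) y :=
  ((h x₀).contDiffAt ((chartAt E x₀).open_target.mem_nhds hy)).differentiableAt (by simp)

theorem DForm.isSmooth_zero : (0 : DForm E M F k).IsSmooth := fun x₀ => by
  rw [DForm.inChart_zero]; exact contDiffOn_const

theorem DForm.IsSmooth.add {β β' : DForm E M F k} (h : β.IsSmooth) (h' : β'.IsSmooth) :
    (β + β').IsSmooth := fun x₀ => by
  rw [DForm.inChart_add]; exact (h x₀).add (h' x₀)

theorem DForm.IsSmooth.smul {β : DForm E M F k} (c : ℝ) (h : β.IsSmooth) :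
    (c • β).IsSmooth := fun x₀ => by
  rw [DForm.inChart_smul]; exact (h x₀).const_smul c

theorem DForm.hasExtDeriv_zero : (0 : DForm E M F k).HasExtDeriv 0 := fun x₀ y _ => by
  have := extDeriv_smul (x := y) (0 : ℝ) (0 : E → E [⋀^Fin k]→L[ℝ] F)
  rw [DForm.inChart_zero, DForm.inChart_zero]
  simpa using this

theorem DForm.HasExtDeriv.add {α α' : DForm E M F k} {β β' : DForm E M F (k + 1)}
    (h : α.HasExtDeriv β) (h' : α'.HasExtDeriv β') (hα : α.IsSmooth) (hα' : α'.IsSmooth) :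
    (α + α').HasExtDeriv (β + β') := fun x₀ y hy => by
  rw [DForm.inChart_add, extDeriv_add (hα.differentiableAt hy) (hα'.differentiableAt hy),
    h x₀ y hy, h' x₀ y hy]
  rfl

theorem DForm.HasExtDeriv.smul {α : DForm E M F k} {β : DForm E M F (k + 1)} (c : ℝ)
    (h : α.HasExtDeriv β) : (c • α).HasExtDeriv (c • β) := fun x₀ y hy => by
  rw [DForm.inChart_smul, extDeriv_smul, h x₀ y hy]
  rfl

end FormLemmas

/-! ### Almost quaternionic structures and taming -/

variable (E M) in
/-- A quaternionic triple `(I, J, K)` of smooth almost complex structures on `M`. -/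
structure AlmostQuaternionic [IsManifold 𝓘(ℝ, E) ∞ M] where
  /-- the first almost complex structure -/
  I : ∀ x : M, TangentSpace 𝓘(ℝ, E) x →L[ℝ] TangentSpace 𝓘(ℝ, E) x
  /-- the second almost complex structure -/
  J : ∀ x : M, TangentSpace 𝓘(ℝ, E) x →L[ℝ] TangentSpace 𝓘(ℝ, E) x
  /-- the third almost complex structure -/
  K : ∀ x : M, TangentSpace 𝓘(ℝ, E) x →L[ℝ] TangentSpace 𝓘(ℝ, E) x
  I_sq : ∀ x v, I x (I x v) = -v
  J_sq : ∀ x v, J x (J x v) = -v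
  K_sq : ∀ x v, K x (K x v) = -v
  I_J : ∀ x v, I x (J x v) = K x v
  smooth_I : ContMDiff 𝓘(ℝ, E) (𝓘(ℝ, E).prod 𝓘(ℝ, E →L[ℝ] E)) ∞
    (fun x : M => Bundle.TotalSpace.mk' (E →L[ℝ] E)
      (E := fun x : M => TangentSpace 𝓘(ℝ, E) x →L[ℝ] TangentSpace 𝓘(ℝ, E) x) x (I x))
  smooth_J : ContMDiff 𝓘(ℝ, E) (𝓘(ℝ, E).prod 𝓘(ℝ, E →L[ℝ] E)) ∞
    (fun x : M => Bundle.TotalSpace.mk' (E →L[ℝ] E)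
      (E := fun x : M => TangentSpace 𝓘(ℝ, E) x →L[ℝ] TangentSpace 𝓘(ℝ, E) x) x (J x))
  smooth_K : ContMDiff 𝓘(ℝ, E) (𝓘(ℝ, E).prod 𝓘(ℝ, E →L[ℝ] E)) ∞
    (fun x : M => Bundle.TotalSpace.mk' (E →L[ℝ] E)
      (E := fun x : M => TangentSpace 𝓘(ℝ, E) x →L[ℝ] TangentSpace 𝓘(ℝ, E) x) x (K x))

variable (E M) in
/-- Smooth Riemannian metrics on `M`. -/
abbrev Metric [IsManifold 𝓘(ℝ, E) ∞ M] :=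
  Bundle.ContMDiffRiemannianMetric 𝓘(ℝ, E) ∞ E (fun x : M => TangentSpace 𝓘(ℝ, E) x)

section Taming

variable [IsManifold 𝓘(ℝ, E) ∞ M]

/-- The length of a tangent vector. -/
def Metric.len (g : Metric E M) (x : M) (v : TangentSpace 𝓘(ℝ, E) x) : ℝ :=
  √(g.inner x v v)

/-- `I`, `J`, `K` are orthogonal with respect to `g`. -/
def AlmostQuaternionic.IsOrthogonal (Q : AlmostQuaternionic E M) (g : Metric E M) : Prop :=
  ∀ x v w, g.inner x (Q.I x v) (Q.I x w) = g.inner x v w ∧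
    g.inner x (Q.J x v) (Q.J x w) = g.inner x v w ∧
    g.inner x (Q.K x v) (Q.K x w) = g.inner x v w

/-- The two-form `β` tames the almost complex structure `A`, uniformly on `M` with respect to
the metric `g`. On a compact manifold this is the same as `β(v, Av) > 0` for all `v ≠ 0`. -/
def Tames (g : Metric E M) (β : DForm E M ℝ 2)
    (A : ∀ x : M, TangentSpace 𝓘(ℝ, E) x →L[ℝ] TangentSpace 𝓘(ℝ, E) x) : Prop :=
  ∃ c : ℝ, 0 < c ∧ ∀ (x : M) (v : TangentSpace 𝓘(ℝ, E) x),
    c * g.len x v ^ 2 ≤ β x ![v, A x v]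

/-- `η` is a `KI`-taming complex two-form: it is of type `(2,0)` with respect to `J`, its real
part tames `K`, and its imaginary part tames `I`. -/
structure IsKITaming (Q : AlmostQuaternionic E M) (g : Metric E M) (η : DForm E M ℂ 2) :
    Prop where
  linear_left : ∀ (x : M) (v w : TangentSpace 𝓘(ℝ, E) x),
    η x ![Q.J x v, w] = Complex.I * η x ![v, w]
  linear_right : ∀ (x : M) (v w : TangentSpace 𝓘(ℝ, E) x),
    η x ![v, Q.J x w] = Complex.I * η x ![v, w]
  tames_K : Tames g η.re Q.K
  tames_I : Tames g η.im Q.I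

/-! ### Submanifolds -/

/-- `φ` is a smooth chart of `M` around `x` that maps `L` onto the linear subspace `W`. -/
def IsSliceChart (L : Set M) (x : M) (φ : OpenPartialHomeomorph M E) (W : Submodule ℝ E) :
    Prop :=
  φ ∈ IsManifold.maximalAtlas 𝓘(ℝ, E) ∞ M ∧ x ∈ φ.source ∧ ∀ y ∈ φ.source, y ∈ L ↔ φ y ∈ W

variable (E) in
/-- `L` is an embedded smooth submanifold of `M` (without boundary). -/
def IsSubmanifold (L : Set M) : Prop :=
  ∀ x ∈ L, ∃ (φ : OpenPartialHomeomorph M E) (W : Submodule ℝ E), IsSliceChart L x φ W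

/-- The tangent vectors to the submanifold `L` at `x`. -/
def tangentTo (L : Set M) (x : M) : Set (TangentSpace 𝓘(ℝ, E) x) :=
  {v | ∃ (φ : OpenPartialHomeomorph M E) (W : Submodule ℝ E), IsSliceChart L x φ W ∧
    (mfderiv 𝓘(ℝ, E) 𝓘(ℝ, E) φ x v : E) ∈ W}

/-- The restriction of the two-form `β` to the submanifold `L` is zero. -/
def VanishesOn (β : DForm E M ℝ 2) (L : Set M) : Prop :=
  ∀ x ∈ L, ∀ v ∈ tangentTo (E := E) L x, ∀ w ∈ tangentTo (E := E) L x, β x ![v, w] = 0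

end Taming

/-! ### Convergence in `C¹` -/

/-- The maps `V i` from the planar domain `D` to `M` converge to `v` in `C¹`, uniformly on
`K ⊆ D`: after composition with any smooth function on `M`, both the values and the first
derivatives converge uniformly on `K`. For limits `v` with relatively compact image
and bounded derivative this is `C¹` convergence in any embedding of `M` in a Euclidean space. -/
def TendstoC1 (E : Type*) [NormedAddCommGroup E] [NormedSpace ℝ E]
    {M : Type*} [TopologicalSpace M] [ChartedSpace E M] {ι : Type*} (l : Filter ι)
    (V : ι → ℝ × ℝ → M) (v : ℝ × ℝ → M) (D K : Set (ℝ × ℝ)) : Prop :=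
  ∀ f : M → ℝ, ContMDiff 𝓘(ℝ, E) 𝓘(ℝ, ℝ) ∞ f →
    TendstoUniformlyOn (fun i z => f (V i z)) (fun z => f (v z)) l K ∧
    TendstoUniformlyOn (fun i z => fderivWithin ℝ (fun z' => f (V i z')) D z)
      (fun z => fderivWithin ℝ (fun z' => f (v z')) D z) l K

/-- The strip `ℝ × [0,1]` with coordinates `(t, τ)`. -/
def strip : Set (ℝ × ℝ) := univ ×ˢ Icc 0 1

/-- The strip `[0,1] × ℝ` with coordinates `(τ, s)`. -/
def strip' : Set (ℝ × ℝ) := Icc 0 1 ×ˢ univ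

/-- The slab `[0,1] × ℝ²` with coordinates `(τ, s, t)`. -/
def slab : Set (ℝ × ℝ × ℝ) := Icc 0 1 ×ˢ univ

variable (E) in
/-- Asymptotics of a map `U(τ, s, t)` on the slab: `U` tends to `A₋(t, τ)`, `A₊(t, τ)` as
`s → -∞, +∞` in `C¹(ℝ × [0,1])`, and to `B₋(τ, s)`, `B₊(τ, s)` as `t → -∞, +∞` in
`C¹_loc([0,1] × ℝ)`. -/
structure HasAsymptotics (U : ℝ × ℝ × ℝ → M) (Am Ap Bm Bp : ℝ × ℝ → M) : Prop where
  s_bot : TendstoC1 E atBot (fun (s : ℝ) z => U (z.2, s, z.1)) Am strip strip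
  s_top : TendstoC1 E atTop (fun (s : ℝ) z => U (z.2, s, z.1)) Ap strip strip
  t_bot : ∀ K : Set (ℝ × ℝ), IsCompact K → K ⊆ strip' →
    TendstoC1 E atBot (fun (t : ℝ) z => U (z.1, z.2, t)) Bm strip' K
  t_top : ∀ K : Set (ℝ × ℝ), IsCompact K → K ⊆ strip' →
    TendstoC1 E atTop (fun (t : ℝ) z => U (z.1, z.2, t)) Bp strip' K

/-! ### Strips in `M` -/

variable (E) in
/-- `∂_τ U` on the slab. -/
def dτ (U : ℝ × ℝ × ℝ → M) (p : ℝ × ℝ × ℝ) : TangentSpace 𝓘(ℝ, E) (U p) :=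
  mfderivWithin 𝓘(ℝ, ℝ × ℝ × ℝ) 𝓘(ℝ, E) U slab p ((1, 0, 0) : ℝ × ℝ × ℝ)

variable (E) in
/-- `∂_s U` on the slab. -/
def ds (U : ℝ × ℝ × ℝ → M) (p : ℝ × ℝ × ℝ) : TangentSpace 𝓘(ℝ, E) (U p) :=
  mfderivWithin 𝓘(ℝ, ℝ × ℝ × ℝ) 𝓘(ℝ, E) U slab p ((0, 1, 0) : ℝ × ℝ × ℝ)

variable (E) in
/-- `∂_t U` on the slab. -/
def dt (U : ℝ × ℝ × ℝ → M) (p : ℝ × ℝ × ℝ) : TangentSpace 𝓘(ℝ, E) (U p) :=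
  mfderivWithin 𝓘(ℝ, ℝ × ℝ × ℝ) 𝓘(ℝ, E) U slab p ((0, 0, 1) : ℝ × ℝ × ℝ)

variable (E) in
/-- `∂_t u` for a map `u(t, τ)` on the strip. -/
def stripDt (u : ℝ × ℝ → M) (z : ℝ × ℝ) : TangentSpace 𝓘(ℝ, E) (u z) :=
  mfderivWithin 𝓘(ℝ, ℝ × ℝ) 𝓘(ℝ, E) u strip z ((1, 0) : ℝ × ℝ)

variable (E) in
/-- `∂_τ u` for a map `u(t, τ)` on the strip. -/
def stripDτ (u : ℝ × ℝ → M) (z : ℝ × ℝ) : TangentSpace 𝓘(ℝ, E) (u z) :=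
  mfderivWithin 𝓘(ℝ, ℝ × ℝ) 𝓘(ℝ, E) u strip z ((0, 1) : ℝ × ℝ)

section Strips

variable [IsManifold 𝓘(ℝ, E) ∞ M]

/-- `u(t, τ)` is a `J`-antiholomorphic strip with boundary on `L₀`, `L₁`, converging to
`p₋`, `p₊` as `t → -∞, +∞`. -/
structure IsAntiholomorphicStrip (Q : AlmostQuaternionic E M) (L₀ L₁ : Set M)
    (u : ℝ × ℝ → M) (pm pp : M) : Prop where
  contMDiffOn : ContMDiffOn 𝓘(ℝ, ℝ × ℝ) 𝓘(ℝ, E) 1 u strip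
  equation : ∀ z ∈ strip, stripDt E u z - Q.J (u z) (stripDτ E u z) = 0
  boundary₀ : ∀ t : ℝ, u (t, 0) ∈ L₀
  boundary₁ : ∀ t : ℝ, u (t, 1) ∈ L₁
  tendsto_bot : Tendsto u (atBot ×ˢ 𝓟 (Icc 0 1)) (𝓝 pm)
  tendsto_top : Tendsto u (atTop ×ˢ 𝓟 (Icc 0 1)) (𝓝 pp)

/-- `U(τ, s, t)` is a Fueter strip between `L₀` and `L₁`, asymptotic to the `J`-antiholomorphic
strips `u₋`, `u₊` as `s → -∞, +∞`, and to the intersection points `p₋`, `p₊` as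
`t → -∞, +∞`. -/
structure IsFueterStrip (Q : AlmostQuaternionic E M) (g : Metric E M) (L₀ L₁ : Set M)
    (U : ℝ × ℝ × ℝ → M) (um up : ℝ × ℝ → M) (pm pp : M) : Prop where
  contMDiffOn : ContMDiffOn 𝓘(ℝ, ℝ × ℝ × ℝ) 𝓘(ℝ, E) 2 U slab
  equation : ∀ p ∈ slab,
    Q.I (U p) (dτ E U p) + Q.J (U p) (ds E U p) + Q.K (U p) (dt E U p) = 0
  boundary₀ : ∀ s t : ℝ, U (0, s, t) ∈ L₀
  boundary₁ : ∀ s t : ℝ, U (1, s, t) ∈ L₁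
  mem_pm : pm ∈ L₀ ∩ L₁
  mem_pp : pp ∈ L₀ ∩ L₁
  strip_um : IsAntiholomorphicStrip Q L₀ L₁ um pm pp
  strip_up : IsAntiholomorphicStrip Q L₀ L₁ up pm pp
  asymptotics : HasAsymptotics E U um up (fun _ => pm) (fun _ => pp)
  /-- `∂_s U(τ, ·, ·)` is in `L¹(ℝ²)` for every `τ`. -/
  slice_L1 : ∀ τ ∈ Icc (0 : ℝ) 1,
    Integrable (fun z : ℝ × ℝ => g.len (U (τ, z)) (ds E U (τ, z)))
  /-- `∂_s U(τ, ·, ·)` is in `L²(ℝ²)` for every `τ`. -/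
  slice_L2 : ∀ τ ∈ Icc (0 : ℝ) 1,
    Integrable (fun z : ℝ × ℝ => g.len (U (τ, z)) (ds E U (τ, z)) ^ 2)
  /-- The `L¹` norms of the slices are integrable in `τ`. -/
  L1 : IntegrableOn (fun p => g.len (U p) (ds E U p)) slab

/-- The density `½ (|∂_s U|² + |∂_t U - J ∂_τ U|²)` of the cylindrical energy. -/
def energyDensity (Q : AlmostQuaternionic E M) (g : Metric E M) (U : ℝ × ℝ × ℝ → M)
    (p : ℝ × ℝ × ℝ) : ℝ :=
  1 / 2 * (g.len (U p) (ds E U p) ^ 2 +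
    g.len (U p) (dt E U p - Q.J (U p) (dτ E U p)) ^ 2)

/-- The cylindrical energy `E(U)`. -/
def energy (Q : AlmostQuaternionic E M) (g : Metric E M) (U : ℝ × ℝ × ℝ → M) : ℝ :=
  ∫ p in slab, energyDensity Q g U p

end Strips

/-! ### Integrals over planes and relative classes -/

/-- The slice `U|_{{τ} × ℝ²}`. -/
def slice (U : ℝ × ℝ × ℝ → M) (τ : ℝ) : ℝ × ℝ → M := fun z => U (τ, z)

/-- The function `h` with `f^*σ = h ds ∧ dt`, for a map `f(s, t)` from the plane. -/
def pullback (f : ℝ × ℝ → M) (σ : DForm E M ℝ 2) (z : ℝ × ℝ) : ℝ :=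
  σ (f z) ![mfderiv 𝓘(ℝ, ℝ × ℝ) 𝓘(ℝ, E) f z ((1, 0) : ℝ × ℝ),
    mfderiv 𝓘(ℝ, ℝ × ℝ) 𝓘(ℝ, E) f z ((0, 1) : ℝ × ℝ)]

/-- `u^*β = 0` on the strip. -/
def VanishesAlong {k : ℕ} (β : DForm E M ℝ k) (u : ℝ × ℝ → M) : Prop :=
  ∀ z ∈ strip, (β (u z)).compContinuousLinearMap
    (mfderivWithin 𝓘(ℝ, ℝ × ℝ) 𝓘(ℝ, E) u strip z) = 0

theorem vanishesAlong_zero {k : ℕ} (u : ℝ × ℝ → M) :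
    VanishesAlong (0 : DForm E M ℝ k) u := fun _ _ => rfl

theorem VanishesAlong.add {k : ℕ} {β β' : DForm E M ℝ k} {u : ℝ × ℝ → M}
    (h : VanishesAlong β u) (h' : VanishesAlong β' u) : VanishesAlong (β + β') u :=
  fun z hz => by
    have := congrArg₂ (· + ·) (h z hz) (h' z hz)
    simp only [add_zero] at this
    exact this

theorem VanishesAlong.smul {k : ℕ} {β : DForm E M ℝ k} {u : ℝ × ℝ → M} (c : ℝ)
    (h : VanishesAlong β u) : VanishesAlong (c • β) u :=
  fun z hz => by
    have := congrArg (c • ·) (h z hz)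
    simp only [smul_zero] at this
    exact this

/-- Closed smooth two-forms on `M` that vanish along `u₋` and `u₊`. -/
def relClosed (E : Type*) [NormedAddCommGroup E] [NormedSpace ℝ E]
    {M : Type*} [TopologicalSpace M] [ChartedSpace E M] (um up : ℝ × ℝ → M) :
    Submodule ℝ (DForm E M ℝ 2) where
  carrier := {σ | σ.IsSmooth ∧ σ.IsClosed ∧ VanishesAlong σ um ∧ VanishesAlong σ up}
  zero_mem' := ⟨DForm.isSmooth_zero, DForm.hasExtDeriv_zero, vanishesAlong_zero um,
    vanishesAlong_zero up⟩
  add_mem' := fun {a b} ha hb => ⟨ha.1.add hb.1,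
    by simpa [DForm.IsClosed] using DForm.HasExtDeriv.add ha.2.1 hb.2.1 ha.1 hb.1,
    ha.2.2.1.add hb.2.2.1, ha.2.2.2.add hb.2.2.2⟩
  smul_mem' := fun c a ha => ⟨ha.1.smul c,
    by simpa [DForm.IsClosed] using DForm.HasExtDeriv.smul c ha.2.1,
    ha.2.2.1.smul c, ha.2.2.2.smul c⟩

/-- Two-forms `dα`, where `α` is a smooth one-form that vanishes along `u₋` and `u₊`. -/
def relExact (E : Type*) [NormedAddCommGroup E] [NormedSpace ℝ E]
    {M : Type*} [TopologicalSpace M] [ChartedSpace E M] (um up : ℝ × ℝ → M) :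
    Submodule ℝ (DForm E M ℝ 2) where
  carrier := {σ | ∃ α : DForm E M ℝ 1, α.IsSmooth ∧ α.HasExtDeriv σ ∧
    VanishesAlong α um ∧ VanishesAlong α up}
  zero_mem' := ⟨0, DForm.isSmooth_zero, DForm.hasExtDeriv_zero, vanishesAlong_zero um,
    vanishesAlong_zero up⟩
  add_mem' := by
    rintro a b ⟨α, h1, h2, h3, h4⟩ ⟨γ, k1, k2, k3, k4⟩
    exact ⟨α + γ, h1.add k1, h2.add k2 h1 k1, h3.add k3, h4.add k4⟩
  smul_mem' := by
    rintro c a ⟨α, h1, h2, h3, h4⟩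
    exact ⟨c • α, h1.smul c, h2.smul c, h3.smul c, h4.smul c⟩

/-- The relative de Rham cohomology `H²(M, u₋ ∪ u₊)`. -/
abbrev RelH2 (E : Type*) [NormedAddCommGroup E] [NormedSpace ℝ E]
    {M : Type*} [TopologicalSpace M] [ChartedSpace E M] (um up : ℝ × ℝ → M) :=
  relClosed E um up ⧸ (relExact E um up).submoduleOf (relClosed E um up)

/-- The class in `H²(M, u₋ ∪ u₊)` of a closed two-form vanishing along `u₋` and `u₊`. -/
def relClass {um up : ℝ × ℝ → M} (σ : relClosed E um up) : RelH2 E um up :=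
  Submodule.Quotient.mk σ

/-- Real relative homology classes in `M` relative to `u₋ ∪ u₊`, as the functionals on
`H²(M, u₋ ∪ u₊)` given by the pairing. -/
abbrev RelHomology2 (E : Type*) [NormedAddCommGroup E] [NormedSpace ℝ E]
    {M : Type*} [TopologicalSpace M] [ChartedSpace E M] (um up : ℝ × ℝ → M) :=
  Module.Dual ℝ (RelH2 E um up)

/-- A `C¹` map from the planar domain `D` into the union of the strips `u₋`, `u₊` and their ends
`p₋`, `p₊`: it factors through `u₋` or `u₊` by a `C¹` map, or is constant equal to `p₋` or
`p₊`. -/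
def IsMapInto (um up : ℝ × ℝ → M) (pm pp : M) (D : Set (ℝ × ℝ)) (a : ℝ × ℝ → M) : Prop :=
  (∃ φ : ℝ × ℝ → ℝ × ℝ, ContDiffOn ℝ 1 φ D ∧ MapsTo φ D strip ∧
    (EqOn a (um ∘ φ) D ∨ EqOn a (up ∘ φ) D)) ∨
  EqOn a (fun _ => pm) D ∨ EqOn a (fun _ => pp) D

/-- The maps `f₀`, `f₁` from the plane to `M` are homotopic relative to the union `S` of the
strips `u₋`, `u₊` and their ends `p₋`, `p₊`: there is a `C¹` homotopy `F(τ, s, t)` which is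
asymptotic to maps into `S` as `s → ±∞` and `t → ±∞`, along which `∂_s F` is integrable and the
integrals of all two-forms over the slices converge. -/
def RelHomotopic [IsManifold 𝓘(ℝ, E) ∞ M] (g : Metric E M) (um up : ℝ × ℝ → M) (pm pp : M)
    (f₀ f₁ : ℝ × ℝ → M) : Prop :=
  ∃ F : ℝ × ℝ × ℝ → M, ContMDiffOn 𝓘(ℝ, ℝ × ℝ × ℝ) 𝓘(ℝ, E) 1 F slab ∧
    slice F 0 = f₀ ∧ slice F 1 = f₁ ∧
    (∀ τ ∈ Icc (0 : ℝ) 1, ∀ σ : DForm E M ℝ 2, σ.IsSmooth → Integrable (pullback (slice F τ) σ)) ∧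
    IntegrableOn (fun p => g.len (F p) (ds E F p)) slab ∧
    ∃ Am Ap Bm Bp : ℝ × ℝ → M,
      IsMapInto um up pm pp strip Am ∧ IsMapInto um up pm pp strip Ap ∧
      IsMapInto um up pm pp strip' Bm ∧ IsMapInto um up pm pp strip' Bp ∧
      HasAsymptotics E F Am Ap Bm Bp

end Fueter

end

/-! Multiplying the Fueter equation by `JI` gives `∂_t U = J ∂_τ U - I ∂_s U`. The two terms of the
energy density are therefore equal, and the density is `|∂_s U|²`. If `Im η` tames `I` with constant
`c`, then `Im η(v, Jw) = Re η(v, w)` yields the pointwise inequality `c |∂_s U|² ≤ Im η(∂_s U, I ∂_s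
U) = -Re η(∂_τ U, ∂_s U) - Im η(∂_s U, ∂_t U)` (`fueter_eq`, `energyDensity_eq`,
`energyDensity_le`). The bound with `C = 1/c` follows by integration over the slab from two facts:
the integral of `Im η` over a slice does not depend on `τ`, and `Re η(∂_τ U, ∂_s U)` has integral
zero.

Both facts come from one Stokes formula with a cut-off `c(t)`, for a closed form `σ`
(`HasAsymptotics.stokes`): `∫_{a ≤ τ ≤ b} c'(t) σ(∂_τ, ∂_s) = ∫_{τ=b} c(t) σ(∂_s, ∂_t) - ∫_{τ=a}
c(t) σ(∂_s, ∂_t)`. Nothing is contributed by `s → ±∞`, because `η(Jv, v) = i η(v, v) = 0` makes `η`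
vanish along `J`-antiholomorphic strips. If `c` is a plateau growing to `1`, then `c' → 0` boundedly
and the slice integrals agree (`integral_slice_eq`). If instead `c(t)` approximates `t`, then `c' →
1` boundedly; as `Re η` vanishes on the slices in `L₀` and `L₁`, the integral on the left tends to
zero (`integral_slab_eq_zero`).

Analysis on `M` is reduced to real functions on the slab. A smooth exhaustion function stays bounded
along `U`, so `U` has relatively compact image (`HasAsymptotics.exists_compact`), and near a compact
set a smooth two-form is a finite sum `∑ h df ∧ dk` of globally defined smooth functions
(`exists_expansion_two`). The asymptotics bound the `τ`-derivatives of `f ∘ U`. The limits `t → ±∞`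
say nothing about `∂_t`, which is controlled by the Fueter equation (`abs_deriv_t_le`). Derivatives
in `s` are at most a constant times `|∂_s U|`, which is integrable; hence every component of a form
that involves `∂_s` is integrable.

The class `[U_τ]` is integration over the slice `τ = 0`. It annihilates `dα` with `α` vanishing
along `u_±`, by Stokes' theorem on the plane (`stokes_exact`). Homotopy invariance is the slice
argument applied to the homotopy. For `Im η = dλ` the same planar formula retains the actions of
`u_±` as boundary terms. Removing the cut-off in `t` then uses `λ(∂_t u_±) → 0` at the ends, which
follows by exchanging the limits in `s` and `t` (`tendsto_deriv_t`). -/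

noncomputable section

namespace Fueter

universe u v

section

variable {E : Type u} [NormedAddCommGroup E] [NormedSpace ℝ E]
variable {M : Type v} [TopologicalSpace M] [ChartedSpace E M]

/-! ### Smooth functions and their differentials -/

section Differentials

variable {F : Type*} [NormedAddCommGroup F] [NormedSpace ℝ F]

/-- The differential of a function on `M` with values in a normed space. -/
def diff (f : M → F) (x : M) : E →L[ℝ] F :=
  mfderiv 𝓘(ℝ, E) 𝓘(ℝ, F) f x

theorem diff_congr {f f' : M → F} {x : M} (h : f =ᶠ[𝓝 x] f') : diff (E := E) f x = diff f' x :=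
  h.mfderiv_eq

/-- The differential of the inverse of a chart. -/
def diffSymm (E : Type u) [NormedAddCommGroup E] [NormedSpace ℝ E] {M : Type v}
    [TopologicalSpace M] [ChartedSpace E M] (c : M) (y : E) : E →L[ℝ] E :=
  mfderiv 𝓘(ℝ, E) 𝓘(ℝ, E) (chartAt E c).symm y

theorem diffSymm_diff_chartAt [IsManifold 𝓘(ℝ, E) ∞ M] {c x : M}
    (hx : x ∈ (chartAt E c).source) (v : E) :
    diffSymm E c (chartAt E c x) (diff (chartAt E c) x v) = v :=
  congrArg (fun A : E →L[ℝ] E => A v)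
    ((mdifferentiable_chart (I := 𝓘(ℝ, E)) c).symm_comp_deriv hx)

theorem diff_comp_diffSymm [IsManifold 𝓘(ℝ, E) ∞ M] {c : M} {y : E} {f : M → F}
    (hf : MDifferentiable 𝓘(ℝ, E) 𝓘(ℝ, F) f)
    (hy : y ∈ (chartAt E c).target) :
    fderiv ℝ (f ∘ (chartAt E c).symm) y = (diff f ((chartAt E c).symm y)).comp (diffSymm E c y) := by
  rw [← mfderiv_eq_fderiv]
  exact mfderiv_comp y (hf _) ((mdifferentiable_chart (I := 𝓘(ℝ, E)) c).mdifferentiableAt_symm hy)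

/-- A form in terms of its expression in a chart. -/
theorem DForm.apply_eq_inChart [IsManifold 𝓘(ℝ, E) ∞ M] {k : ℕ} (β : DForm E M F k) {c x : M}
    (hx : x ∈ (chartAt E c).source) (v : Fin k → E) :
    β x v = β.inChart c (chartAt E c x) (fun i => diff (chartAt E c) x (v i)) := by
  -- The type of `β y` depends on `y`, so `symm (chart x) = x` is used through this transport rather
  -- than by rewriting the base point.
  have key : ∀ (y : M) (_ : y = x) (w : Fin k → E), β y w = β x w := by
    rintro y rfl w; rfl
  rw [← key _ ((chartAt E c).left_inv hx)]
  exact congrArg (β ((chartAt E c).symm (chartAt E c x)))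
    (funext fun i => (diffSymm_diff_chartAt hx (v i)).symm)

end Differentials

/-! ### Comparison of Riemannian lengths with norms in charts -/

section Comparison

variable [IsManifold 𝓘(ℝ, E) ∞ M]

theorem Metric.len_nonneg (g : Metric E M) (x : M) (v : E) : 0 ≤ g.len x v := Real.sqrt_nonneg _

open Bundle in
/-- Lengths of tangent vectors are locally comparable with norms in a chart. -/
theorem Metric.eventually_comparable (g : Metric E M) (c : M) :
    ∃ C : ℝ, 0 < C ∧ ∀ᶠ x in 𝓝 c, ∀ v : E,
      ‖diff (chartAt E c) x v‖ ≤ C * g.len x v ∧ g.len x v ≤ C * ‖diff (chartAt E c) x v‖ := by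
  let : RiemannianBundle (fun x : M => TangentSpace 𝓘(ℝ, E) x) := ⟨g.toRiemannianMetric⟩
  have : IsContinuousRiemannianBundle E (fun x : M => TangentSpace 𝓘(ℝ, E) x) :=
    ⟨⟨g.inner, g.contMDiff.continuous, fun _ _ _ => rfl⟩⟩
  obtain ⟨C₁, hC₁, h₁⟩ := eventually_norm_trivializationAt_lt E
    (fun x : M => TangentSpace 𝓘(ℝ, E) x) c
  obtain ⟨C₂, hC₂, h₂⟩ := eventually_norm_symmL_trivializationAt_lt E
    (fun x : M => TangentSpace 𝓘(ℝ, E) x) c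
  refine ⟨max C₁ C₂, lt_max_of_lt_left hC₁, ?_⟩
  filter_upwards [h₁, h₂, (chartAt E c).open_source.mem_nhds (mem_chart_source E c)]
    with x hx₁ hx₂ hx v
  set A := (trivializationAt E (fun x : M => TangentSpace 𝓘(ℝ, E) x) c).continuousLinearMapAt ℝ x
  set B := (trivializationAt E (fun x : M => TangentSpace 𝓘(ℝ, E) x) c).symmL ℝ x
  -- The trivialization of the tangent bundle at `c` is the derivative of the chart, so the local
  -- bounds on the trivialization and its inverse, which come from continuity of the metric, are the
  -- two inequalities.
  have hA : A = diff (E := E) (chartAt E c) x :=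
    TangentBundle.continuousLinearMapAt_trivializationAt (I := 𝓘(ℝ, E)) (x₀ := c) hx
  have hb : x ∈ (trivializationAt E (fun x : M => TangentSpace 𝓘(ℝ, E) x) c).baseSet := by
    simpa using hx
  have hBA : ∀ v : TangentSpace 𝓘(ℝ, E) x, B (A v) = v := fun v =>
    Trivialization.symmL_continuousLinearMapAt _ hb v
  have n0 := g.len_nonneg x v
  have h₃ : ‖A v‖ ≤ ‖A‖ * g.len x v := A.le_opNorm v
  have h₄ : g.len x v ≤ ‖B‖ * ‖A v‖ :=
    (congrArg (g.len x) (hBA v)).symm.trans_le (B.le_opNorm (A v))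
  have h₅ : ‖A v‖ = ‖diff (E := E) (chartAt E c) x v‖ :=
    congrArg norm (congrArg (fun T : E →L[ℝ] E => T v) hA)
  rw [h₅] at h₃ h₄
  exact ⟨h₃.trans (mul_le_mul_of_nonneg_right (hx₁.le.trans (le_max_left _ _)) n0),
    h₄.trans (mul_le_mul_of_nonneg_right (hx₂.le.trans (le_max_right _ _)) (norm_nonneg _))⟩

/-- On a compact set the differential of a smooth function is bounded by the length. -/
theorem Metric.exists_diff_le (g : Metric E M) {K : Set M} (hK : IsCompact K) {f : M → ℝ}
    (hf : ContMDiff 𝓘(ℝ, E) 𝓘(ℝ, ℝ) ∞ f) :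
    ∃ C : ℝ, 0 ≤ C ∧ ∀ x ∈ K, ∀ v : E, |diff f x v| ≤ C * g.len x v := by
  refine hK.induction_on (p := fun K => ∃ C : ℝ, 0 ≤ C ∧ ∀ x ∈ K, ∀ v : E,
    |diff f x v| ≤ C * g.len x v) ⟨0, le_rfl, by simp⟩ ?_ ?_ ?_
  · rintro s t hst ⟨C, h0, hC⟩
    exact ⟨C, h0, fun x hx => hC x (hst hx)⟩
  · rintro s t ⟨C, h0, hC⟩ ⟨C', h0', hC'⟩
    refine ⟨max C C', le_max_of_le_left h0, ?_⟩
    rintro x (hx | hx) v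
    · exact (hC x hx v).trans (mul_le_mul_of_nonneg_right (le_max_left _ _) (g.len_nonneg x v))
    · exact (hC' x hx v).trans (mul_le_mul_of_nonneg_right (le_max_right _ _) (g.len_nonneg x v))
  · intro c _
    obtain ⟨C, hC, h⟩ := g.eventually_comparable c
    set φ := f ∘ (chartAt E c).symm with hφ
    have hsm : ContDiffOn ℝ ∞ φ (chartAt E c).target := by
      rw [← contMDiffOn_iff_contDiffOn]
      exact hf.comp_contMDiffOn contMDiffOn_chart_symm
    have hcont : ContinuousOn (fun x => fderiv ℝ φ (chartAt E c x)) (chartAt E c).source :=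
      (hsm.continuousOn_fderiv_of_isOpen (chartAt E c).open_target (by simp)).comp
        (chartAt E c).continuousOn (chartAt E c).mapsTo
    have hbd : ∀ᶠ x in 𝓝 c, ‖fderiv ℝ φ (chartAt E c x)‖ < ‖fderiv ℝ φ (chartAt E c c)‖ + 1 :=
      ((hcont.continuousAt ((chartAt E c).open_source.mem_nhds (mem_chart_source E c))).norm).eventually
        (gt_mem_nhds (lt_add_one _))
    refine ⟨_, mem_nhdsWithin_of_mem_nhds (h.and (hbd.and
      ((chartAt E c).open_source.mem_nhds (mem_chart_source E c)))),
      (‖fderiv ℝ φ (chartAt E c c)‖ + 1) * C, by positivity, ?_⟩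
    rintro x ⟨hx₁, hx₂, hx⟩ v
    have e : diff f x v = fderiv ℝ φ (chartAt E c x) (diff (chartAt E c) x v) := by
      rw [hφ, diff_comp_diffSymm (hf.mdifferentiable (by simp)) ((chartAt E c).map_source hx),
        ContinuousLinearMap.comp_apply, diffSymm_diff_chartAt hx, (chartAt E c).left_inv hx]
    rw [e, ← Real.norm_eq_abs, mul_assoc]
    exact (ContinuousLinearMap.le_opNorm _ _).trans
      (mul_le_mul hx₂.le (hx₁ v).1 (norm_nonneg _) (by positivity))

end Comparison

end

section

variable {E : Type u} [NormedAddCommGroup E] [NormedSpace ℝ E]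
variable {M : Type v} [TopologicalSpace M] [ChartedSpace E M]

/-! ### Expansions of forms near compact sets -/

theorem oneForm_apply_sum {d : ℕ} (α : E [⋀^Fin 1]→L[ℝ] ℝ) (c : Fin d → ℝ) (b : Fin d → E) :
    α ![∑ a, c a • b a] = ∑ a, c a * α ![b a] := by
  have h : ∀ w, α ![w] = α.curryLeft w ![] := fun w => rfl
  simp only [h, map_sum, map_smul, ContinuousAlternatingMap.sum_apply,
    ContinuousAlternatingMap.smul_apply, smul_eq_mul]

theorem twoForm_apply_sum {d : ℕ} (σ : E [⋀^Fin 2]→L[ℝ] ℝ) (c c' : Fin d → ℝ) (b : Fin d → E) :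
    σ ![∑ a, c a • b a, ∑ a, c' a • b a] = ∑ p : Fin d × Fin d, c p.1 * c' p.2 * σ ![b p.1, b p.2] := by
  have h : ∀ v w, σ ![v, w] = σ.curryLeft v ![w] := fun v w => rfl
  rw [h, map_sum, ContinuousAlternatingMap.sum_apply, Fintype.sum_prod_type]
  refine Finset.sum_congr rfl fun a _ => ?_
  rw [map_smul, ContinuousAlternatingMap.smul_apply, oneForm_apply_sum, smul_eq_mul,
    Finset.mul_sum]
  exact Finset.sum_congr rfl fun a' _ => by rw [h, mul_assoc]

theorem twoForm_swap (σ : E [⋀^Fin 2]→L[ℝ] ℝ) (v w : E) : σ ![w, v] = -σ ![v, w] := by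
  refine Eq.trans (congrArg σ ?_) (σ.toAlternatingMap.map_swap ![v, w] (i := 0) (j := 1) (by decide))
  ext i; fin_cases i <;> rfl

theorem twoForm_self (σ : E [⋀^Fin 2]→L[ℝ] ℝ) (v : E) : σ ![v, v] = 0 := by
  have := twoForm_swap σ v v
  linarith

/-- Finitely many smooth maps to the model space that restrict to charts on the supports of
functions whose sum is one near a compact set. -/
structure CoordSystem [IsManifold 𝓘(ℝ, E) ∞ M] (g : Metric E M) (K : Set M) where
  /-- the indices -/
  ι : Type v
  /-- there are finitely many of them -/
  fintype : Fintype ι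
  /-- the centers of the charts -/
  c : ι → M
  /-- the functions of a partition of unity -/
  ρ : ι → M → ℝ
  /-- global maps extending the charts -/
  e : ι → M → E
  smooth_ρ : ∀ i, ContMDiff 𝓘(ℝ, E) 𝓘(ℝ, ℝ) ∞ (ρ i)
  smooth_e : ∀ i, ContMDiff 𝓘(ℝ, E) 𝓘(ℝ, E) ∞ (e i)
  mem_source : ∀ i, ∀ x ∈ tsupport (ρ i), x ∈ (chartAt E (c i)).source
  eq_chart : ∀ i, ∀ x ∈ tsupport (ρ i), e i =ᶠ[𝓝 x] chartAt E (c i)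
  sum_eq_one : ∀ᶠ x in 𝓝ˢ K, (letI := fintype; ∑ i, ρ i x) = 1
  /-- the constant of comparison -/
  C : ℝ
  C_nonneg : 0 ≤ C
  len_le : ∀ i, ∀ x ∈ tsupport (ρ i), ∀ v : E, g.len x v ≤ C * ‖diff (e i) x v‖

theorem DForm.IsSmooth.contDiffOn_apply {k : ℕ} {β : DForm E M ℝ k} (h : β.IsSmooth) (c : M)
    (v : Fin k → E) : ContDiffOn ℝ ∞ (fun y => β.inChart c y v) (chartAt E c).target :=
  (ContinuousAlternatingMap.apply ℝ E ℝ v).contDiff.comp_contDiffOn (h c)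

namespace CoordSystem

variable [IsManifold 𝓘(ℝ, E) ∞ M] {g : Metric E M} {K : Set M} (S : CoordSystem g K)

instance : Fintype S.ι := S.fintype

/-- A function supported in a chart domain, times a function that is smooth in that chart. -/
theorem smooth_ρ_mul (i : S.ι) {f : E → ℝ} (hf : ContDiffOn ℝ ∞ f (chartAt E (S.c i)).target) :
    ContMDiff 𝓘(ℝ, E) 𝓘(ℝ, ℝ) ∞ (fun x => S.ρ i x * f (chartAt E (S.c i) x)) := by
  refine contMDiff_of_tsupport fun x hx => ?_
  have hx' : x ∈ (chartAt E (S.c i)).source := S.mem_source i x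
    (closure_mono (Function.support_mul_subset_left _ _) hx)
  refine (S.smooth_ρ i).contMDiffAt.mul ?_
  have h : ContMDiffOn 𝓘(ℝ, E) 𝓘(ℝ, ℝ) ∞ (f ∘ chartAt E (S.c i)) (chartAt E (S.c i)).source :=
    (contMDiffOn_iff_contDiffOn.2 hf).comp contMDiffOn_chart (chartAt E (S.c i)).mapsTo
  exact h.contMDiffAt ((chartAt E (S.c i)).open_source.mem_nhds hx')

variable [FiniteDimensional ℝ E]

/-- The coordinate functions of a system. -/
def coord (i : S.ι) (a : Fin (Module.finrank ℝ E)) (x : M) : ℝ :=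
  (Module.finBasis ℝ E).equivFunL (S.e i x) a

theorem smooth_coord (i : S.ι) (a : Fin (Module.finrank ℝ E)) :
    ContMDiff 𝓘(ℝ, E) 𝓘(ℝ, ℝ) ∞ (S.coord i a) :=
  let L : E →L[ℝ] ℝ := (ContinuousLinearMap.proj a).comp
    ((Module.finBasis ℝ E).equivFunL : E →L[ℝ] (Fin (Module.finrank ℝ E) → ℝ))
  L.contMDiff.comp (S.smooth_e i)

theorem diff_coord (i : S.ι) (a : Fin (Module.finrank ℝ E)) (x : M) (v : E) :
    diff (S.coord i a) x v = (Module.finBasis ℝ E).equivFunL (diff (S.e i) x v) a := by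
  let L : E →L[ℝ] ℝ := (ContinuousLinearMap.proj a).comp
    ((Module.finBasis ℝ E).equivFunL : E →L[ℝ] (Fin (Module.finrank ℝ E) → ℝ))
  have h : mfderiv 𝓘(ℝ, E) 𝓘(ℝ, ℝ) (L ∘ S.e i) x =
      (mfderiv 𝓘(ℝ, E) 𝓘(ℝ, ℝ) L (S.e i x)).comp (mfderiv 𝓘(ℝ, E) 𝓘(ℝ, E) (S.e i) x) :=
    mfderiv_comp x (L.mdifferentiableAt) ((S.smooth_e i).mdifferentiable (by simp) x)
  rw [L.mfderiv_eq] at h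
  exact congrArg (fun A : E →L[ℝ] ℝ => A v) h

theorem diff_e_eq_sum (i : S.ι) (x : M) (v : E) :
    diff (S.e i) x v = ∑ a, diff (S.coord i a) x v • Module.finBasis ℝ E a := by
  simp only [diff_coord]
  exact ((Module.finBasis ℝ E).sum_equivFun _).symm

end CoordSystem

variable [FiniteDimensional ℝ E] [T2Space M] [SecondCountableTopology M]
  [IsManifold 𝓘(ℝ, E) ∞ M]

variable (E) in
/-- A smooth function with compact sublevel sets. -/
theorem exists_smooth_exhaustion : ∃ f : M → ℝ, ContMDiff 𝓘(ℝ, E) 𝓘(ℝ, ℝ) ∞ f ∧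
    ∀ C : ℝ, ∃ K : Set M, IsCompact K ∧ ∀ x, f x ≤ C → x ∈ K := by
  have : LocallyCompactSpace M := Manifold.locallyCompact_of_finiteDimensional 𝓘(ℝ, E)
  let X := CompactExhaustion.choice M
  -- A smooth `f` with `f x ≥ X.find x` is glued from local constants: near `x` the index `find`
  -- grows by at most one, and lower bounds are a convex condition.
  obtain ⟨f, hf⟩ := exists_contMDiffMap_forall_mem_convex_of_local_const 𝓘(ℝ, E) (n := (⊤ : ℕ∞))
    (t := fun x : M => Ici ((X.find x : ℕ) : ℝ)) (fun x => convex_Ici _) fun x => by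
      refine ⟨((X.find x + 1 : ℕ) : ℝ), ?_⟩
      have : interior (X (X.find x + 1)) ∈ 𝓝 x :=
        isOpen_interior.mem_nhds (X.subset_interior_succ _ (X.mem_find x))
      filter_upwards [this] with y hy
      exact mem_Ici.2 <| Nat.cast_le.2 (X.mem_iff_find_le.1 (interior_subset hy))
  refine ⟨f, f.contMDiff, fun C => ⟨X ⌈C⌉₊, X.isCompact _, fun x hx => ?_⟩⟩
  rw [X.mem_iff_find_le]
  have h1 : ((X.find x : ℕ) : ℝ) ≤ f x := hf x
  exact_mod_cast h1.trans (hx.trans (Nat.le_ceil C))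

/-- Charts multiplied by bump functions are globally defined and agree with the charts where the
bump is one. The partition of unity is subordinate to such sets, so on its supports nothing is lost.
-/
theorem exists_coordSystem (g : Metric E M) {K : Set M} (hK : IsCompact K) :
    Nonempty (CoordSystem g K) := by
  classical
  have : LocallyCompactSpace M := Manifold.locallyCompact_of_finiteDimensional 𝓘(ℝ, E)
  -- The functions must sum to one on a neighbourhood of `K`, not only on `K`, since expansions of
  -- forms are going to be differentiated there.
  obtain ⟨K', hK', hKK'⟩ := exists_compact_superset hK
  have χ : ∀ x : M, SmoothBumpFunction 𝓘(ℝ, E) x := fun x => Classical.arbitrary _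
  choose C hC0 hC using fun x : M => g.eventually_comparable x
  let V : M → Set M := fun x => interior {y | χ x y = 1 ∧ y ∈ (chartAt E x).source ∧
    ∀ v : E, g.len y v ≤ C x * ‖diff (chartAt E x) y v‖}
  have hV : ∀ x, V x ∈ 𝓝 x := fun x => by
    rw [interior_mem_nhds]
    filter_upwards [(χ x).eventuallyEq_one, hC x,
      (chartAt E x).open_source.mem_nhds (mem_chart_source E x)] with y h1 h2 h3
    exact ⟨h1, h3, fun v => (h2 v).2⟩
  obtain ⟨t, -, ht⟩ := hK'.elim_nhds_subcover V fun x _ => hV x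
  obtain ⟨ρ, hρ⟩ := SmoothPartitionOfUnity.exists_isSubordinate 𝓘(ℝ, E) hK'.isClosed
    (fun i : t => V i) (fun i => isOpen_interior) (by simpa [iUnion_subtype] using ht)
  have hev : ∀ (i : t), ∀ x ∈ tsupport (ρ i),
      (fun x => χ i x • chartAt E (i : M) x) =ᶠ[𝓝 x] chartAt E (i : M) := fun i x hx => by
    filter_upwards [isOpen_interior.mem_nhds (hρ i hx)] with y hy
    rw [(interior_subset hy).1, one_smul]
  exact ⟨{
    ι := t
    fintype := inferInstance
    c := fun i => i
    ρ := fun i => ρ i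
    e := fun i x => χ i x • chartAt E (i : M) x
    smooth_ρ := fun i => (ρ i).contMDiff
    smooth_e := fun i => (χ i).contMDiff_smul contMDiffOn_chart
    mem_source := fun i x hx => (interior_subset (hρ i hx)).2.1
    eq_chart := hev
    sum_eq_one := by
      filter_upwards [isOpen_interior.mem_nhdsSet.2 hKK'] with x hx
      rw [← finsum_eq_sum_of_fintype]
      exact ρ.sum_eq_one (interior_subset hx)
    C := ∑ i : t, C i
    C_nonneg := Finset.sum_nonneg fun i _ => (hC0 i).le
    len_le := fun i x hx v => by
      rw [diff_congr (hev i x hx)]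
      refine ((interior_subset (hρ i hx)).2.2 v).trans
        (mul_le_mul_of_nonneg_right ?_ (norm_nonneg _))
      exact Finset.single_le_sum (f := fun i : t => C i) (fun i _ => (hC0 i).le)
        (Finset.mem_univ i) }⟩

/-- Near a compact set a smooth one-form is a combination of differentials. -/
theorem DForm.IsSmooth.exists_expansion_one (g : Metric E M) {K : Set M} (hK : IsCompact K)
    {α : DForm E M ℝ 1} (hα : α.IsSmooth) :
    ∃ (ι : Type v) (_ : Fintype ι) (h f : ι → M → ℝ),
      (∀ i, ContMDiff 𝓘(ℝ, E) 𝓘(ℝ, ℝ) ∞ (h i)) ∧ (∀ i, ContMDiff 𝓘(ℝ, E) 𝓘(ℝ, ℝ) ∞ (f i)) ∧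
      ∀ᶠ x in 𝓝ˢ K, ∀ w : E, α x ![w] = ∑ i, h i x * diff (f i) x w := by
  obtain ⟨S⟩ := exists_coordSystem g hK
  let b := Module.finBasis ℝ E
  refine ⟨S.ι × Fin (Module.finrank ℝ E), inferInstance,
    fun p x => S.ρ p.1 x * α.inChart (S.c p.1) (chartAt E (S.c p.1) x) ![b p.2],
    fun p => S.coord p.1 p.2,
    fun p => S.smooth_ρ_mul p.1 (hα.contDiffOn_apply _ _), fun p => S.smooth_coord _ _, ?_⟩
  filter_upwards [S.sum_eq_one] with x hx w
  rw [Fintype.sum_prod_type, ← one_mul (α x ![w]), ← hx, Finset.sum_mul]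
  refine Finset.sum_congr rfl fun i _ => ?_
  by_cases h0 : S.ρ i x = 0
  · simp [h0]
  have hi : x ∈ tsupport (S.ρ i) := subset_tsupport _ h0
  have e : α x ![w] = α.inChart (S.c i) (chartAt E (S.c i) x)
      ![∑ a, diff (S.coord i a) x w • b a] := by
    refine (α.apply_eq_inChart (S.mem_source i x hi) ![w]).trans (congrArg _ ?_)
    funext j
    fin_cases j
    change diff (chartAt E (S.c i)) x w = _
    rw [← diff_congr (S.eq_chart i x hi), S.diff_e_eq_sum]
    rfl
  rw [e, oneForm_apply_sum, Finset.mul_sum]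
  exact Finset.sum_congr rfl fun a _ => by ring

/-- Near a compact set a smooth two-form is a combination of products of differentials. -/
theorem DForm.IsSmooth.exists_expansion_two (g : Metric E M) {K : Set M} (hK : IsCompact K)
    {σ : DForm E M ℝ 2} (hσ : σ.IsSmooth) :
    ∃ (ι : Type v) (_ : Fintype ι) (h f f' : ι → M → ℝ),
      (∀ i, ContMDiff 𝓘(ℝ, E) 𝓘(ℝ, ℝ) ∞ (h i)) ∧ (∀ i, ContMDiff 𝓘(ℝ, E) 𝓘(ℝ, ℝ) ∞ (f i)) ∧
      (∀ i, ContMDiff 𝓘(ℝ, E) 𝓘(ℝ, ℝ) ∞ (f' i)) ∧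
      ∀ᶠ x in 𝓝ˢ K, ∀ v w : E, σ x ![v, w] =
        ∑ i, h i x * (diff (f i) x v * diff (f' i) x w - diff (f i) x w * diff (f' i) x v) := by
  obtain ⟨S⟩ := exists_coordSystem g hK
  let b := Module.finBasis ℝ E
  let d := Module.finrank ℝ E
  refine ⟨S.ι × (Fin d × Fin d), inferInstance,
    -- The sum runs over all ordered pairs of coordinates, so each `dx_a ∧ dx_b` occurs twice.
    fun p x => S.ρ p.1 x * (2⁻¹ * σ.inChart (S.c p.1) (chartAt E (S.c p.1) x)
      ![b p.2.1, b p.2.2]),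
    fun p => S.coord p.1 p.2.1, fun p => S.coord p.1 p.2.2,
    fun p => S.smooth_ρ_mul p.1 (contDiffOn_const.mul (hσ.contDiffOn_apply _ _)),
    fun p => S.smooth_coord _ _, fun p => S.smooth_coord _ _, ?_⟩
  filter_upwards [S.sum_eq_one] with x hx v w
  rw [Fintype.sum_prod_type, ← one_mul (σ x ![v, w]), ← hx, Finset.sum_mul]
  refine Finset.sum_congr rfl fun i _ => ?_
  by_cases h0 : S.ρ i x = 0
  · simp [h0]
  have hi : x ∈ tsupport (S.ρ i) := subset_tsupport _ h0
  have e : ∀ v w : E, σ x ![v, w] = σ.inChart (S.c i) (chartAt E (S.c i) x)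
      ![∑ a, diff (S.coord i a) x v • b a, ∑ a, diff (S.coord i a) x w • b a] := by
    intro v w
    refine (σ.apply_eq_inChart (S.mem_source i x hi) ![v, w]).trans (congrArg _ ?_)
    funext j
    fin_cases j
    · change diff (chartAt E (S.c i)) x v = _
      rw [← diff_congr (S.eq_chart i x hi), S.diff_e_eq_sum]
      rfl
    · change diff (chartAt E (S.c i)) x w = _
      rw [← diff_congr (S.eq_chart i x hi), S.diff_e_eq_sum]
      rfl
  have e2 : σ x ![v, w] = 2⁻¹ * (σ x ![v, w] - σ x ![w, v]) := by
    have : σ x ![w, v] = -σ x ![v, w] := twoForm_swap (E := E) (σ x) v w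
    rw [this]; ring
  rw [e2, e v w, e w v, twoForm_apply_sum, twoForm_apply_sum, ← Finset.sum_sub_distrib,
    Finset.mul_sum, Finset.mul_sum]
  exact Finset.sum_congr rfl fun a _ => by ring

/-- On a compact set, lengths are bounded by finitely many differentials. -/
theorem Metric.exists_len_le (g : Metric E M) {K : Set M} (hK : IsCompact K) :
    ∃ (ι : Type v) (_ : Fintype ι) (f : ι → M → ℝ) (C : ℝ), 0 ≤ C ∧
      (∀ i, ContMDiff 𝓘(ℝ, E) 𝓘(ℝ, ℝ) ∞ (f i)) ∧
      ∀ x ∈ K, ∀ v : E, g.len x v ≤ C * ∑ i, |diff (f i) x v| := by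
  obtain ⟨S⟩ := exists_coordSystem g hK
  let b := Module.finBasis ℝ E
  let B : ℝ := ∑ a, ‖b a‖
  have hB : ∀ a, ‖b a‖ ≤ B := fun a => Finset.single_le_sum (f := fun a => ‖b a‖)
    (fun a _ => norm_nonneg _) (Finset.mem_univ a)
  have hB0 : 0 ≤ B := Finset.sum_nonneg fun a _ => norm_nonneg _
  refine ⟨S.ι × Fin (Module.finrank ℝ E), inferInstance, fun p => S.coord p.1 p.2, S.C * B,
    mul_nonneg S.C_nonneg hB0, fun p => S.smooth_coord _ _, fun x hx v => ?_⟩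
  have h1 : ∑ i, S.ρ i x = 1 := S.sum_eq_one.self_of_nhdsSet x hx
  -- One chart whose support contains `x` suffices; its coordinates already control the length.
  obtain ⟨i, hi⟩ : ∃ i, S.ρ i x ≠ 0 := by
    by_contra! h
    simp [h] at h1
  refine (S.len_le i x (subset_tsupport _ hi) v).trans ?_
  rw [mul_assoc]
  refine mul_le_mul_of_nonneg_left ?_ S.C_nonneg
  rw [S.diff_e_eq_sum, Fintype.sum_prod_type]
  calc ‖∑ a, diff (S.coord i a) x v • b a‖ ≤ ∑ a, ‖diff (S.coord i a) x v • b a‖ := norm_sum_le _ _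
    _ ≤ ∑ a, B * |diff (S.coord i a) x v| := Finset.sum_le_sum fun a _ => by
        rw [norm_smul, Real.norm_eq_abs, mul_comm]
        exact mul_le_mul_of_nonneg_right (hB a) (abs_nonneg _)
    _ = B * ∑ a, |diff (S.coord i a) x v| := by rw [Finset.mul_sum]
    _ ≤ _ := by
        refine mul_le_mul_of_nonneg_left ?_ hB0
        exact Finset.single_le_sum (f := fun i => ∑ a, |diff (S.coord i a) x v|)
          (fun i _ => Finset.sum_nonneg fun a _ => abs_nonneg _) (Finset.mem_univ i)

end

section

variable {E : Type u} [NormedAddCommGroup E] [NormedSpace ℝ E]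
variable {M : Type v} [TopologicalSpace M] [ChartedSpace E M]

/-! ### Exterior derivatives of expansions -/

theorem two_le_infty : (2 : ℕ∞ω) ≤ ∞ :=
  WithTop.coe_le_coe.2 (le_top : (2 : ℕ∞) ≤ ⊤)

/-- The determinant of three linear functionals on three vectors. -/
def det3 {V : Type*} [NormedAddCommGroup V] [NormedSpace ℝ V] (a b c : V →L[ℝ] ℝ) (u v w : V) : ℝ :=
  a u * (b v * c w - b w * c v) - a v * (b u * c w - b w * c u) + a w * (b u * c v - b v * c u)

theorem hasFDerivAt_mul_fderiv {h f : E → ℝ} {y : E} (hh : ContDiffAt ℝ ∞ h y)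
    (hf : ContDiffAt ℝ ∞ f y) (w : E) :
    HasFDerivAt (fun y => h y * fderiv ℝ f y w)
      (h y • (fderiv ℝ (fderiv ℝ f) y).flip w + fderiv ℝ f y w • fderiv ℝ h y) y := by
  have h1 : HasFDerivAt (fderiv ℝ f) (fderiv ℝ (fderiv ℝ f) y) y :=
    ((hf.fderiv_right (m := 1) (by norm_cast)).differentiableAt (by simp)).hasFDerivAt
  have h2 : HasFDerivAt (fun y => fderiv ℝ f y w) ((fderiv ℝ (fderiv ℝ f) y).flip w) y := by
    have := h1.clm_apply (hasFDerivAt_const w y)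
    simpa using this
  exact (hh.differentiableAt (by simp)).hasFDerivAt.mul h2

section

variable [IsManifold 𝓘(ℝ, E) ∞ M]

theorem contDiffAt_comp_chartAt_symm {f : M → ℝ} (hf : ContMDiff 𝓘(ℝ, E) 𝓘(ℝ, ℝ) ∞ f) (x : M) :
    ContDiffAt ℝ ∞ (f ∘ (chartAt E x).symm) (chartAt E x x) := by
  have h : ContDiffOn ℝ ∞ (f ∘ (chartAt E x).symm) (chartAt E x).target := by
    rw [← contMDiffOn_iff_contDiffOn]
    exact hf.comp_contMDiffOn contMDiffOn_chart_symm
  exact h.contDiffAt ((chartAt E x).open_target.mem_nhds (mem_chart_target E x))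

theorem diff_eq_fderiv_chartAt {f : M → ℝ} (hf : ContMDiff 𝓘(ℝ, E) 𝓘(ℝ, ℝ) ∞ f) (x : M) (v : E) :
    diff f x v = fderiv ℝ (f ∘ (chartAt E x).symm) (chartAt E x x) (diff (chartAt E x) x v) := by
  rw [diff_comp_diffSymm (hf.mdifferentiable (by simp)) (mem_chart_target E x),
    ContinuousLinearMap.comp_apply, diffSymm_diff_chartAt (mem_chart_source E x),
    (chartAt E x).left_inv (mem_chart_source E x)]

/-- The exterior derivative of an expansion of a one-form. -/
theorem DForm.HasExtDeriv.expansion_one {α : DForm E M ℝ 1} {β : DForm E M ℝ 2}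
    (hαβ : α.HasExtDeriv β) (hα : α.IsSmooth) {ι : Type*} [Fintype ι] {h f : ι → M → ℝ}
    (hh : ∀ i, ContMDiff 𝓘(ℝ, E) 𝓘(ℝ, ℝ) ∞ (h i)) (hf : ∀ i, ContMDiff 𝓘(ℝ, E) 𝓘(ℝ, ℝ) ∞ (f i))
    {x : M} (hx : ∀ᶠ y in 𝓝 x, ∀ w : E, α y ![w] = ∑ i, h i y * diff (f i) y w) (v w : E) :
    β x ![v, w] = ∑ i, (diff (h i) x v * diff (f i) x w - diff (h i) x w * diff (f i) x v) := by
  set y₀ := chartAt E x x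
  let h' : ι → E → ℝ := fun i => h i ∘ (chartAt E x).symm
  let f' : ι → E → ℝ := fun i => f i ∘ (chartAt E x).symm
  have hy₀ : y₀ ∈ (chartAt E x).target := mem_chart_target E x
  have ht : Tendsto (chartAt E x).symm (𝓝 y₀) (𝓝 x) := by
    have := ((chartAt E x).continuousAt_symm hy₀).tendsto
    rwa [(chartAt E x).left_inv (mem_chart_source E x)] at this
  have loc : ∀ w : E, (fun y => α.inChart x y ![w]) =ᶠ[𝓝 y₀]
      fun y => ∑ i, h' i y * fderiv ℝ (f' i) y w := fun w => by
    filter_upwards [ht.eventually hx, (chartAt E x).open_target.mem_nhds hy₀] with y hy hyt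
    have e : α.inChart x y ![w] = α ((chartAt E x).symm y) ![diffSymm E x y w] :=
      congrArg (α ((chartAt E x).symm y)) (by funext j; fin_cases j; rfl)
    rw [e, hy]
    refine Finset.sum_congr rfl fun i _ => ?_
    rw [diff_comp_diffSymm ((hf i).mdifferentiable (by simp)) hyt]
    rfl
  have der : ∀ v w : E, fderiv ℝ (fun y => α.inChart x y ![w]) y₀ v =
      ∑ i, (h' i y₀ * fderiv ℝ (fderiv ℝ (f' i)) y₀ v w + fderiv ℝ (f' i) y₀ w *
        fderiv ℝ (h' i) y₀ v) := fun v w => by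
    rw [(loc w).fderiv_eq, (HasFDerivAt.fun_sum fun i _ => hasFDerivAt_mul_fderiv
      (contDiffAt_comp_chartAt_symm (hh i) x) (contDiffAt_comp_chartAt_symm (hf i) x) w).fderiv]
    simp [h', f', y₀]
  -- Symmetry removes the terms `h d(df)`, leaving `∑ dh ∧ df`.
  have sym : ∀ i (v w : E), fderiv ℝ (fderiv ℝ (f' i)) y₀ v w =
      fderiv ℝ (fderiv ℝ (f' i)) y₀ w v := fun i v w =>
    (contDiffAt_comp_chartAt_symm (hf i) x).isSymmSndFDerivAt
      (by simpa using two_le_infty) v w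
  have key : ∀ v w : E, β.inChart x y₀ ![v, w] =
      ∑ i, (fderiv ℝ (h' i) y₀ v * fderiv ℝ (f' i) y₀ w -
        fderiv ℝ (h' i) y₀ w * fderiv ℝ (f' i) y₀ v) := fun v w => by
    rw [← hαβ x y₀ hy₀, extDeriv_apply (hα.differentiableAt hy₀), Fin.sum_univ_two]
    have e0 : Fin.removeNth (0 : Fin 2) ![v, w] = ![w] := by
      funext j; fin_cases j; rfl
    have e1 : Fin.removeNth (1 : Fin 2) ![v, w] = ![v] := by
      funext j; fin_cases j; rfl
    rw [e0, e1]
    simp only [Matrix.cons_val_zero, Matrix.cons_val_one, der]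
    simp only [Fin.val_zero, pow_zero, one_smul, Fin.val_one, pow_one, neg_smul]
    rw [← sub_eq_add_neg, ← Finset.sum_sub_distrib]
    refine Finset.sum_congr rfl fun i _ => ?_
    rw [sym i w v]; ring
  have e : β x ![v, w] = β.inChart x y₀ ![diff (chartAt E x) x v, diff (chartAt E x) x w] :=
    (β.apply_eq_inChart (mem_chart_source E x) ![v, w]).trans
      (congrArg _ (by funext j; fin_cases j <;> rfl))
  rw [e, key]
  refine Finset.sum_congr rfl fun i _ => ?_
  simp only [diff_eq_fderiv_chartAt (hh i), diff_eq_fderiv_chartAt (hf i)]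
  rfl

/-- The exterior derivative of an expansion of a closed two-form. -/
theorem DForm.IsClosed.expansion_two {σ : DForm E M ℝ 2}
    (hc : σ.IsClosed) (hσ : σ.IsSmooth) {ι : Type*} [Fintype ι] {h f k : ι → M → ℝ}
    (hh : ∀ i, ContMDiff 𝓘(ℝ, E) 𝓘(ℝ, ℝ) ∞ (h i)) (hf : ∀ i, ContMDiff 𝓘(ℝ, E) 𝓘(ℝ, ℝ) ∞ (f i))
    (hk : ∀ i, ContMDiff 𝓘(ℝ, E) 𝓘(ℝ, ℝ) ∞ (k i))
    {x : M} (hx : ∀ᶠ y in 𝓝 x, ∀ v w : E, σ y ![v, w] =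
      ∑ i, h i y * (diff (f i) y v * diff (k i) y w - diff (f i) y w * diff (k i) y v))
    (u v w : E) :
    ∑ i, det3 (diff (h i) x) (diff (f i) x) (diff (k i) x) u v w = 0 := by
  set y₀ := chartAt E x x
  let h' : ι → E → ℝ := fun i => h i ∘ (chartAt E x).symm
  let f' : ι → E → ℝ := fun i => f i ∘ (chartAt E x).symm
  let k' : ι → E → ℝ := fun i => k i ∘ (chartAt E x).symm
  have hy₀ : y₀ ∈ (chartAt E x).target := mem_chart_target E x
  have ht : Tendsto (chartAt E x).symm (𝓝 y₀) (𝓝 x) := by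
    have := ((chartAt E x).continuousAt_symm hy₀).tendsto
    rwa [(chartAt E x).left_inv (mem_chart_source E x)] at this
  have loc : ∀ v w : E, (fun y => σ.inChart x y ![v, w]) =ᶠ[𝓝 y₀]
      fun y => ∑ i, (h' i y * fderiv ℝ (f' i) y v * fderiv ℝ (k' i) y w
        - h' i y * fderiv ℝ (f' i) y w * fderiv ℝ (k' i) y v) := fun v w => by
    filter_upwards [ht.eventually hx, (chartAt E x).open_target.mem_nhds hy₀] with y hy hyt
    have e : σ.inChart x y ![v, w] =
        σ ((chartAt E x).symm y) ![diffSymm E x y v, diffSymm E x y w] :=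
      congrArg (σ ((chartAt E x).symm y)) (by funext j; fin_cases j <;> rfl)
    rw [e, hy]
    refine Finset.sum_congr rfl fun i _ => ?_
    rw [diff_comp_diffSymm ((hf i).mdifferentiable (by simp)) hyt,
      diff_comp_diffSymm ((hk i).mdifferentiable (by simp)) hyt]
    simp only [ContinuousLinearMap.comp_apply, h', Function.comp]
    ring
  have der1 : ∀ i (u v w : E), HasFDerivAt
      (fun y => h' i y * fderiv ℝ (f' i) y v * fderiv ℝ (k' i) y w)
      ((h' i y₀ * fderiv ℝ (f' i) y₀ v) • (fderiv ℝ (fderiv ℝ (k' i)) y₀).flip w +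
        fderiv ℝ (k' i) y₀ w • (h' i y₀ • (fderiv ℝ (fderiv ℝ (f' i)) y₀).flip v +
          fderiv ℝ (f' i) y₀ v • fderiv ℝ (h' i) y₀)) y₀ := fun i u v w => by
    have h1 := hasFDerivAt_mul_fderiv (contDiffAt_comp_chartAt_symm (hh i) x)
      (contDiffAt_comp_chartAt_symm (hf i) x) v
    have h2 := hasFDerivAt_mul_fderiv (h := fun _ => 1) contDiffAt_const
      (contDiffAt_comp_chartAt_symm (hk i) x) w
    simp only [one_mul, one_smul, fderiv_fun_const, Pi.zero_apply, smul_zero, add_zero] at h2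
    exact h1.mul h2
  have der : ∀ u v w : E, fderiv ℝ (fun y => σ.inChart x y ![v, w]) y₀ u =
      ∑ i, ((h' i y₀ * fderiv ℝ (f' i) y₀ v * fderiv ℝ (fderiv ℝ (k' i)) y₀ u w +
        fderiv ℝ (k' i) y₀ w * (h' i y₀ * fderiv ℝ (fderiv ℝ (f' i)) y₀ u v +
          fderiv ℝ (f' i) y₀ v * fderiv ℝ (h' i) y₀ u)) -
        (h' i y₀ * fderiv ℝ (f' i) y₀ w * fderiv ℝ (fderiv ℝ (k' i)) y₀ u v +
        fderiv ℝ (k' i) y₀ v * (h' i y₀ * fderiv ℝ (fderiv ℝ (f' i)) y₀ u w +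
          fderiv ℝ (f' i) y₀ w * fderiv ℝ (h' i) y₀ u))) := fun u v w => by
    rw [(loc v w).fderiv_eq, (HasFDerivAt.fun_sum fun i _ =>
      (der1 i u v w).fun_sub (der1 i u w v)).fderiv]
    simp [mul_add]
  have symf : ∀ i (v w : E), fderiv ℝ (fderiv ℝ (f' i)) y₀ v w =
      fderiv ℝ (fderiv ℝ (f' i)) y₀ w v := fun i v w =>
    (contDiffAt_comp_chartAt_symm (hf i) x).isSymmSndFDerivAt
      (by simpa using two_le_infty) v w
  have symk : ∀ i (v w : E), fderiv ℝ (fderiv ℝ (k' i)) y₀ v w =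
      fderiv ℝ (fderiv ℝ (k' i)) y₀ w v := fun i v w =>
    (contDiffAt_comp_chartAt_symm (hk i) x).isSymmSndFDerivAt
      (by simpa using two_le_infty) v w
  have key : ∀ u v w : E, ∑ i, det3 (fderiv ℝ (h' i) y₀) (fderiv ℝ (f' i) y₀)
      (fderiv ℝ (k' i) y₀) u v w = 0 := fun u v w => by
    have h0 : extDeriv (σ.inChart x) y₀ ![u, v, w] = 0 := by
      rw [hc x y₀ hy₀]; rfl
    rw [extDeriv_apply (hσ.differentiableAt hy₀), Fin.sum_univ_three] at h0
    have e0 : Fin.removeNth (0 : Fin 3) ![u, v, w] = ![v, w] := by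
      funext j; fin_cases j <;> rfl
    have e1 : Fin.removeNth (1 : Fin 3) ![u, v, w] = ![u, w] := by
      funext j; fin_cases j <;> rfl
    have e2 : Fin.removeNth (2 : Fin 3) ![u, v, w] = ![u, v] := by
      funext j; fin_cases j <;> rfl
    rw [e0, e1, e2] at h0
    have c0 : (![u, v, w] : Fin 3 → E) 0 = u := rfl
    have c1 : (![u, v, w] : Fin 3 → E) 1 = v := rfl
    have c2 : (![u, v, w] : Fin 3 → E) 2 = w := rfl
    rw [c0, c1, c2, der, der, der] at h0
    simp only [Fin.val_zero, pow_zero, one_smul, Fin.val_one, pow_one, neg_smul,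
      Fin.val_two, even_two.neg_one_pow] at h0
    rw [← sub_eq_add_neg, ← Finset.sum_sub_distrib, ← Finset.sum_add_distrib] at h0
    rw [← h0]
    refine Finset.sum_congr rfl fun i _ => ?_
    rw [symf i v u, symf i w u, symf i w v, symk i v u, symk i w u, symk i w v, det3]; ring
  rw [← key (diff (chartAt E x) x u) (diff (chartAt E x) x v) (diff (chartAt E x) x w)]
  refine Finset.sum_congr rfl fun i _ => ?_
  simp only [det3, diff_eq_fderiv_chartAt (hh i), diff_eq_fderiv_chartAt (hf i),
    diff_eq_fderiv_chartAt (hk i)]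
  rfl

end

end

section

/-! ### Stokes' theorem for products of functions of class `C¹` -/

/-! ### Minors, determinants and smoothing of functions -/

section Calculus

variable {V : Type*} [NormedAddCommGroup V] [NormedSpace ℝ V]

/-- The minor of two functionals on two vectors. -/
def jac (b c : V →L[ℝ] ℝ) (v w : V) : ℝ := b v * c w - b w * c v

/-- The cyclic cofactor expansion displays `dh ∧ df ∧ dk` as the divergence of the field whose
components are `h` times the minors of `df` and `dk`. -/
theorem det3_eq (a b c : V →L[ℝ] ℝ) (u v w : V) :
    det3 a b c u v w = a u * jac b c v w + a v * jac b c w u + a w * jac b c u v := by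
  simp only [det3, jac]; ring

theorem abs_jac_le (b c : V →L[ℝ] ℝ) {v w : V} (hv : ‖v‖ ≤ 1) (hw : ‖w‖ ≤ 1) :
    |jac b c v w| ≤ 2 * (‖b‖ * ‖c‖) := by
  have h : ∀ (a : V →L[ℝ] ℝ) {v : V}, ‖v‖ ≤ 1 → |a v| ≤ ‖a‖ := fun a v hv => by
    rw [← Real.norm_eq_abs]; exact a.unit_le_opNorm v hv
  calc |jac b c v w| ≤ |b v * c w| + |b w * c v| := abs_sub _ _
    _ ≤ ‖b‖ * ‖c‖ + ‖b‖ * ‖c‖ := by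
        rw [abs_mul, abs_mul]
        exact add_le_add (mul_le_mul (h b hv) (h c hw) (abs_nonneg _) (norm_nonneg _))
          (mul_le_mul (h b hw) (h c hv) (abs_nonneg _) (norm_nonneg _))
    _ = _ := by ring

theorem abs_det3_le (a b c : V →L[ℝ] ℝ) {u v w : V} (hu : ‖u‖ ≤ 1) (hv : ‖v‖ ≤ 1)
    (hw : ‖w‖ ≤ 1) : |det3 a b c u v w| ≤ 6 * (‖a‖ * (‖b‖ * ‖c‖)) := by
  have h : ∀ {v : V}, ‖v‖ ≤ 1 → |a v| ≤ ‖a‖ := fun hv => by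
    rw [← Real.norm_eq_abs]; exact a.unit_le_opNorm _ hv
  have h' : ∀ {u v w : V}, ‖u‖ ≤ 1 → ‖v‖ ≤ 1 → ‖w‖ ≤ 1 →
      |a u * jac b c v w| ≤ ‖a‖ * (2 * (‖b‖ * ‖c‖)) := fun hu hv hw => by
    rw [abs_mul]
    exact mul_le_mul (h hu) (abs_jac_le b c hv hw) (abs_nonneg _) (norm_nonneg _)
  rw [det3_eq]
  refine (abs_add_le _ _).trans ?_
  refine (add_le_add (abs_add_le _ _) le_rfl).trans ?_
  linarith [h' hu hv hw, h' hv hw hu, h' hw hu hv]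

theorem tendsto_jac {ι : Type*} {l : Filter ι} {b c : ι → V →L[ℝ] ℝ} {b₀ c₀ : V →L[ℝ] ℝ}
    (hb : Tendsto b l (𝓝 b₀)) (hc : Tendsto c l (𝓝 c₀)) (v w : V) :
    Tendsto (fun i => jac (b i) (c i) v w) l (𝓝 (jac b₀ c₀ v w)) := by
  have h : ∀ {b : ι → V →L[ℝ] ℝ} {b₀ : V →L[ℝ] ℝ} (v : V), Tendsto b l (𝓝 b₀) →
      Tendsto (fun i => b i v) l (𝓝 (b₀ v)) := fun v hb =>
    ((ContinuousLinearMap.apply ℝ ℝ v).continuous.tendsto _).comp hb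
  exact ((h v hb).mul (h w hc)).sub ((h w hb).mul (h v hc))

theorem _root_.ContinuousOn.jac {X : Type*} [TopologicalSpace X] {s : Set X}
    {b c : X → V →L[ℝ] ℝ}
    (hb : ContinuousOn b s) (hc : ContinuousOn c s) (v w : V) :
    ContinuousOn (fun x => jac (b x) (c x) v w) s := fun x hx => tendsto_jac (hb x hx) (hc x hx) v w

theorem _root_.ContinuousOn.det3 {X : Type*} [TopologicalSpace X] {s : Set X}
    {a b c : X → V →L[ℝ] ℝ} (ha : ContinuousOn a s)
    (hb : ContinuousOn b s) (hc : ContinuousOn c s) (u v w : V) :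
    ContinuousOn (fun x => det3 (a x) (b x) (c x) u v w) s := by
  simp only [det3_eq]
  exact (((ha.clm_apply continuousOn_const).mul (hb.jac hc v w)).add
    ((ha.clm_apply continuousOn_const).mul (hb.jac hc w u))).add
    ((ha.clm_apply continuousOn_const).mul (hb.jac hc u v))

theorem integral_fderiv_eq_zero [MeasurableSpace V] [BorelSpace V] [FiniteDimensional ℝ V]
    (μ : Measure V) [μ.IsAddHaarMeasure] {f : V → ℝ} (hf : ContDiff ℝ 1 f)
    (hs : HasCompactSupport f) (v : V) : ∫ x, fderiv ℝ f x v ∂μ = 0 := by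
  have hc : Continuous fun x => fderiv ℝ f x v :=
    (hf.continuous_fderiv (by simp)).clm_apply continuous_const
  have hcs : HasCompactSupport fun x => fderiv ℝ f x v := hs.fderiv_apply ℝ v
  have h := integral_mul_fderiv_eq_neg_fderiv_mul_of_integrable (μ := μ) (f := fun _ : V => (1 : ℝ))
    (g := f) (v := v) (by simp) (by simpa using hc.integrable_of_hasCompactSupport hcs)
    (by simpa using hf.continuous.integrable_of_hasCompactSupport hs)
    (fun x _ => differentiableAt_const _) (fun x _ => hf.differentiable (by simp) x)
  simpa using h

/-- Functions of class `C¹` can be approximated by smooth ones, together with their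
derivatives, on compact sets. -/
theorem exists_smooth_approx [MeasurableSpace V] [BorelSpace V] [FiniteDimensional ℝ V]
    {f : V → ℝ} (hf : ContDiff ℝ 1 f) {K : Set V} (hK : IsCompact K) {ε : ℝ} (hε : 0 < ε) :
    ∃ f' : V → ℝ, ContDiff ℝ ∞ f' ∧ ∀ x ∈ K, ‖fderiv ℝ f' x - fderiv ℝ f x‖ ≤ ε := by
  obtain ⟨R, hR0, hR⟩ := hK.isBounded.subset_ball_lt 0 0
  -- Cutting off outside a ball containing `K` leaves the derivative on `K` unchanged and makes it
  -- uniformly continuous; convolution with a bump of radius `δ` then moves it by at most `ε`.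
  let χ : ContDiffBump (0 : V) := ⟨R, R + 1, hR0, by linarith⟩
  let k : V → ℝ := fun x => χ x * f x
  have hk : ContDiff ℝ 1 k := χ.contDiff.mul hf
  have hks : HasCompactSupport k := χ.hasCompactSupport.mul_right
  have hkf : ∀ x ∈ K, fderiv ℝ k x = fderiv ℝ f x := fun x hx => by
    refine Filter.EventuallyEq.fderiv_eq ?_
    filter_upwards [χ.eventuallyEq_one_of_mem_ball (hR hx)] with y hy
    simp [k, hy]
  have huc : UniformContinuous (fderiv ℝ k) :=
    (hk.continuous_fderiv (by simp)).uniformContinuous_of_tendsto_cocompact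
      (x := 0) ((hks.fderiv ℝ).is_zero_at_infty)
  obtain ⟨δ, hδ, hδε⟩ := Metric.uniformContinuous_iff.1 huc ε hε
  let b : ContDiffBump (0 : V) := ⟨δ / 2, δ, by linarith, by linarith⟩
  let μ : Measure V := Measure.addHaar
  refine ⟨convolution (b.normed μ) k (ContinuousLinearMap.lsmul ℝ ℝ) μ,
    b.hasCompactSupport_normed.contDiff_convolution_left _ b.contDiff_normed
      hk.continuous.locallyIntegrable, fun x hx => ?_⟩
  have h1 := hks.hasFDerivAt_convolution_right (μ := μ) (ContinuousLinearMap.lsmul ℝ ℝ)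
    (b.continuous_normed (μ := μ)).locallyIntegrable hk x
  have h2 : convolution (b.normed μ) (fderiv ℝ k)
      (ContinuousLinearMap.precompR V (ContinuousLinearMap.lsmul ℝ ℝ)) μ x =
      convolution (b.normed μ) (fderiv ℝ k) (ContinuousLinearMap.lsmul ℝ ℝ) μ x := rfl
  rw [h1.fderiv, h2, ← hkf x hx, ← dist_eq_norm]
  exact b.dist_normed_convolution_le (hk.continuous_fderiv (by simp)).aestronglyMeasurable
    fun y hy => (hδε hy).le

end Calculus

end

section

/-! ### Stokes' theorem on `[a, b] × ℝ²` for functions on the whole space -/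

section Stokes

/-- The basis vector in the direction of `τ`. -/
abbrev eτ : ℝ × ℝ × ℝ := (1, 0, 0)

/-- The basis vector in the direction of `s`. -/
abbrev es : ℝ × ℝ × ℝ := (0, 1, 0)

/-- The basis vector in the direction of `t`. -/
abbrev et : ℝ × ℝ × ℝ := (0, 0, 1)

theorem norm_eτ_le : ‖eτ‖ ≤ 1 := by simp [eτ, Prod.norm_def]
theorem norm_es_le : ‖es‖ ≤ 1 := by simp [es, Prod.norm_def]
theorem norm_et_le : ‖et‖ ≤ 1 := by simp [et, Prod.norm_def]

theorem fderiv_slice {f : ℝ × ℝ × ℝ → ℝ} {p : ℝ × ℝ × ℝ} (hf : DifferentiableAt ℝ f p)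
    (v : ℝ × ℝ) : fderiv ℝ (fun z => f (p.1, z)) p.2 v = fderiv ℝ f p (0, v) := by
  have h : HasFDerivAt (fun z : ℝ × ℝ => (p.1, z)) (ContinuousLinearMap.inr ℝ ℝ (ℝ × ℝ)) p.2 :=
    hasFDerivAt_prodMk_right p.1 p.2
  have := (hf.hasFDerivAt.comp p.2 h).fderiv
  rw [Function.comp_def] at this
  rw [this]; rfl

theorem integrableOn_of_continuous_compact {f : ℝ × ℝ × ℝ → ℝ} (hf : Continuous f)
    (hs : HasCompactSupport f) (S : Set (ℝ × ℝ × ℝ)) : IntegrableOn f S :=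
  (hf.integrable_of_hasCompactSupport hs).integrableOn

theorem isClosedEmbedding_slice (τ : ℝ) :
    IsClosedEmbedding fun z : ℝ × ℝ => ((τ, z) : ℝ × ℝ × ℝ) :=
  (Isometry.of_dist_eq fun x y => by simp [Prod.dist_eq]).isClosedEmbedding

theorem HasCompactSupport.slice {f : ℝ × ℝ × ℝ → ℝ} (hs : HasCompactSupport f) (τ : ℝ) :
    HasCompactSupport (fun z => f (τ, z)) :=
  hs.comp_isClosedEmbedding (isClosedEmbedding_slice τ)

/-- Directions `(0, v)` are tangent to the slices, and on each slice the derivative of a compactly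
supported function integrates to zero. -/
theorem setIntegral_fderiv_snd {f : ℝ × ℝ × ℝ → ℝ} (hf : ContDiff ℝ 1 f)
    (hs : HasCompactSupport f) (a b : ℝ) (v : ℝ × ℝ) :
    ∫ p in Icc a b ×ˢ (univ : Set (ℝ × ℝ)), fderiv ℝ f p (0, v) = 0 := by
  have hc : Continuous fun x => fderiv ℝ f x (0, v) :=
    (hf.continuous_fderiv (by simp)).clm_apply continuous_const
  rw [Measure.volume_eq_prod, setIntegral_prod _
    (integrableOn_of_continuous_compact hc (hs.fderiv_apply ℝ _) _)]
  refine (setIntegral_congr_fun measurableSet_Icc fun τ _ => ?_).trans (integral_zero _ _)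
  simp only [setIntegral_univ]
  refine Eq.trans (integral_congr_ae (Eventually.of_forall fun z => ?_))
    (integral_fderiv_eq_zero volume (hf.comp (contDiff_prodMk_right τ))
      (HasCompactSupport.slice hs τ) v)
  exact (fderiv_slice (p := (τ, z)) (hf.differentiable (by simp) _) v).symm

theorem setIntegral_fderiv_fst {f : ℝ × ℝ × ℝ → ℝ} (hf : ContDiff ℝ 1 f)
    (hs : HasCompactSupport f) {a b : ℝ} (hab : a ≤ b) :
    ∫ p in Icc a b ×ˢ (univ : Set (ℝ × ℝ)), fderiv ℝ f p eτ =
      (∫ z, f (b, z)) - ∫ z, f (a, z) := by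
  have hc : Continuous fun x => fderiv ℝ f x eτ :=
    (hf.continuous_fderiv (by simp)).clm_apply continuous_const
  have hi : ∀ τ, Integrable fun z => f (τ, z) := fun τ =>
    (hf.continuous.comp (by fun_prop)).integrable_of_hasCompactSupport (HasCompactSupport.slice hs τ)
  have h1 : ∫ p in Icc a b ×ˢ (univ : Set (ℝ × ℝ)), fderiv ℝ f p eτ =
      ∫ z, ∫ τ in Icc a b, fderiv ℝ f (τ, z) eτ := by
    rw [Measure.volume_eq_prod, ← Measure.prod_restrict, Measure.restrict_univ]
    refine integral_prod_symm _ ?_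
    have := integrableOn_of_continuous_compact hc (hs.fderiv_apply ℝ _)
      (Icc a b ×ˢ (univ : Set (ℝ × ℝ)))
    rwa [IntegrableOn, Measure.volume_eq_prod, ← Measure.prod_restrict, Measure.restrict_univ]
      at this
  rw [h1, ← integral_sub (hi b) (hi a)]
  refine integral_congr_ae (Eventually.of_forall fun z => ?_)
  simp only
  rw [integral_Icc_eq_integral_Ioc, ← intervalIntegral.integral_of_le hab]
  refine intervalIntegral.integral_eq_sub_of_hasDerivAt (f := fun τ => f (τ, z)) (fun τ _ => ?_)
    ((hc.comp (by fun_prop : Continuous fun τ : ℝ => (τ, z))).intervalIntegrable _ _)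
  have h : HasFDerivAt (fun τ : ℝ => (τ, z)) (ContinuousLinearMap.inl ℝ ℝ (ℝ × ℝ)) τ :=
    hasFDerivAt_prodMk_left τ z
  exact ((hf.differentiable (by simp) (τ, z)).hasFDerivAt.comp τ h).hasDerivAt

theorem hasFDerivAt_mul_jac {h f k : ℝ × ℝ × ℝ → ℝ} (hh : ContDiff ℝ 1 h) (hf : ContDiff ℝ ∞ f)
    (hk : ContDiff ℝ ∞ k) (v w : ℝ × ℝ × ℝ) :
    ContDiff ℝ 1 (fun p => h p * jac (fderiv ℝ f p) (fderiv ℝ k p) v w) ∧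
    ∀ p u, fderiv ℝ (fun p => h p * jac (fderiv ℝ f p) (fderiv ℝ k p) v w) p u =
      fderiv ℝ h p u * jac (fderiv ℝ f p) (fderiv ℝ k p) v w + h p *
        (fderiv ℝ (fderiv ℝ f) p u v * fderiv ℝ k p w + fderiv ℝ f p v * fderiv ℝ (fderiv ℝ k) p u w
        - (fderiv ℝ (fderiv ℝ f) p u w * fderiv ℝ k p v +
          fderiv ℝ f p w * fderiv ℝ (fderiv ℝ k) p u v)) := by
  have c : ∀ {f : ℝ × ℝ × ℝ → ℝ} (v : ℝ × ℝ × ℝ), ContDiff ℝ ∞ f →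
      ContDiff ℝ 1 fun p => fderiv ℝ f p v := fun v hf =>
    (hf.fderiv_right (m := 1) (by norm_cast)).clm_apply contDiff_const
  have d : ∀ {f : ℝ × ℝ × ℝ → ℝ} (v p : ℝ × ℝ × ℝ), ContDiff ℝ ∞ f →
      HasFDerivAt (fun p => fderiv ℝ f p v) ((fderiv ℝ (fderiv ℝ f) p).flip v) p := fun v p hf => by
    simpa using hasFDerivAt_mul_fderiv (h := fun _ => 1) contDiffAt_const hf.contDiffAt v (y := p)
  refine ⟨hh.mul (((c v hf).mul (c w hk)).sub ((c w hf).mul (c v hk))), fun p u => ?_⟩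
  have := ((hh.differentiable (by simp) p).hasFDerivAt.mul
    (((d v p hf).mul (d w p hk)).sub ((d w p hf).mul (d v p hk)))).fderiv
  refine (congrArg (fun A => A u) this).trans ?_
  simp [jac]
  ring

/-- Stokes' theorem for `h df ∧ dk` on `[a, b] × ℝ²`, with `h` compactly supported. -/
theorem stokes_smooth {h f k : ℝ × ℝ × ℝ → ℝ} (hh : ContDiff ℝ 1 h) (hs : HasCompactSupport h)
    (hf : ContDiff ℝ ∞ f) (hk : ContDiff ℝ ∞ k) {a b : ℝ} (hab : a ≤ b) :
    ∫ p in Icc a b ×ˢ (univ : Set (ℝ × ℝ)),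
        det3 (fderiv ℝ h p) (fderiv ℝ f p) (fderiv ℝ k p) eτ es et =
      (∫ z, h (b, z) * jac (fderiv ℝ f (b, z)) (fderiv ℝ k (b, z)) es et) -
        ∫ z, h (a, z) * jac (fderiv ℝ f (a, z)) (fderiv ℝ k (a, z)) es et := by
  obtain ⟨c1, d1⟩ := hasFDerivAt_mul_jac hh hf hk es et
  obtain ⟨c2, d2⟩ := hasFDerivAt_mul_jac hh hf hk et eτ
  obtain ⟨c3, d3⟩ := hasFDerivAt_mul_jac hh hf hk eτ es
  have s1 := hs.mul_right (f' := fun p => jac (fderiv ℝ f p) (fderiv ℝ k p) es et)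
  have s2 := hs.mul_right (f' := fun p => jac (fderiv ℝ f p) (fderiv ℝ k p) et eτ)
  have s3 := hs.mul_right (f' := fun p => jac (fderiv ℝ f p) (fderiv ℝ k p) eτ es)
  have sym : ∀ {f : ℝ × ℝ × ℝ → ℝ} (p v w : ℝ × ℝ × ℝ), ContDiff ℝ ∞ f →
      fderiv ℝ (fderiv ℝ f) p v w = fderiv ℝ (fderiv ℝ f) p w v := fun p v w hf =>
    hf.contDiffAt.isSymmSndFDerivAt (by simpa using two_le_infty) v w
  have i : ∀ {g : ℝ × ℝ × ℝ → ℝ} (v : ℝ × ℝ × ℝ), ContDiff ℝ 1 g → HasCompactSupport g →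
      IntegrableOn (fun p => fderiv ℝ g p v) (Icc a b ×ˢ (univ : Set (ℝ × ℝ))) := fun v c s =>
    integrableOn_of_continuous_compact
      ((c.continuous_fderiv (by simp)).clm_apply continuous_const) (s.fderiv_apply ℝ _) _
  have e1 := setIntegral_fderiv_fst c1 s1 hab
  have e2 := setIntegral_fderiv_snd c2 s2 a b (1, 0)
  have e3 := setIntegral_fderiv_snd c3 s3 a b (0, 1)
  have e4 := integral_add ((i eτ c1 s1).add (i es c2 s2)) (i et c3 s3)
  have e5 := integral_add (i eτ c1 s1) (i es c2 s2)
  rw [← e1]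
  refine Eq.trans ?_ (e4.trans (by simp only [Pi.add_apply]; rw [e5, e2, e3, add_zero, add_zero]))
  refine integral_congr_ae (Eventually.of_forall fun p => ?_)
  simp only [Pi.add_apply]
  -- Once the mixed second derivatives are put in one order, they cancel in the cyclic sum and only
  -- the three terms with `dh` survive.
  rw [d1, d2, d3, sym p es eτ hf, sym p et eτ hf, sym p et es hf, sym p es eτ hk, sym p et eτ hk,
    sym p et es hk, det3_eq]
  ring

/-- Stokes' theorem for `h df ∧ dk` on `[a, b] × ℝ²`, for functions of class `C¹`. -/
theorem stokes_C1 {h f k : ℝ × ℝ × ℝ → ℝ} (hh : ContDiff ℝ 1 h) (hs : HasCompactSupport h)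
    (hf : ContDiff ℝ 1 f) (hk : ContDiff ℝ 1 k) {a b : ℝ} (hab : a ≤ b) :
    ∫ p in Icc a b ×ˢ (univ : Set (ℝ × ℝ)),
        det3 (fderiv ℝ h p) (fderiv ℝ f p) (fderiv ℝ k p) eτ es et =
      (∫ z, h (b, z) * jac (fderiv ℝ f (b, z)) (fderiv ℝ k (b, z)) es et) -
        ∫ z, h (a, z) * jac (fderiv ℝ f (a, z)) (fderiv ℝ k (a, z)) es et := by
  have hK : IsCompact (tsupport h) := hs
  have hε : ∀ n : ℕ, (0 : ℝ) < 1 / (n + 1) := fun n => by positivity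
  -- Only `f` and `k` have to be smoothed: second derivatives of `h` never occur. All integrands
  -- live on `tsupport h`, where the approximating gradients converge with a uniform bound, so
  -- dominated convergence applies.
  have approx : ∀ {f : ℝ × ℝ × ℝ → ℝ}, ContDiff ℝ 1 f → ∃ (F : ℕ → ℝ × ℝ × ℝ → ℝ) (C : ℝ), 0 ≤ C ∧
      (∀ n, ContDiff ℝ ∞ (F n)) ∧ (∀ p ∈ tsupport h, Tendsto (fun n => fderiv ℝ (F n) p) atTop
        (𝓝 (fderiv ℝ f p))) ∧ ∀ n, ∀ p ∈ tsupport h, ‖fderiv ℝ (F n) p‖ ≤ C := fun {f} hf => by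
    choose F hF1 hF2 using fun n => exists_smooth_approx hf hK (hε n)
    obtain ⟨C, hC⟩ := hK.exists_bound_of_continuousOn (hf.continuous_fderiv (by simp)).continuousOn
    refine ⟨F, |C| + 1, by positivity, hF1, fun p hp => ?_, fun n p hp => ?_⟩
    · rw [tendsto_iff_norm_sub_tendsto_zero]
      exact squeeze_zero (fun _ => norm_nonneg _) (fun n => hF2 n p hp)
        tendsto_one_div_add_atTop_nhds_zero_nat
    · have h1 : (1 : ℝ) / (n + 1) ≤ 1 := by
        rw [div_le_one (by positivity)]
        linarith [n.cast_nonneg (α := ℝ)]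
      calc ‖fderiv ℝ (F n) p‖ = ‖fderiv ℝ f p + (fderiv ℝ (F n) p - fderiv ℝ f p)‖ := by
            rw [add_sub_cancel]
        _ ≤ ‖fderiv ℝ f p‖ + ‖fderiv ℝ (F n) p - fderiv ℝ f p‖ := norm_add_le _ _
        _ ≤ |C| + 1 := add_le_add ((hC p hp).trans (le_abs_self _)) ((hF2 n p hp).trans h1)
  obtain ⟨F, Cf, hCf, hF, hFt, hFb⟩ := approx hf
  obtain ⟨G, Ck, hCk, hG, hGt, hGb⟩ := approx hk
  obtain ⟨A, hA⟩ := hK.exists_bound_of_continuousOn hh.continuous.continuousOn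
  obtain ⟨B, hB⟩ := hK.exists_bound_of_continuousOn (hh.continuous_fderiv (by simp)).continuousOn
  have z : ∀ p, p ∉ tsupport h → h p = 0 ∧ fderiv ℝ h p = 0 := fun p hp =>
    ⟨image_eq_zero_of_notMem_tsupport hp, by
      by_contra h0
      exact hp (support_fderiv_subset ℝ h0)⟩
  have c : ∀ {f : ℝ × ℝ × ℝ → ℝ}, ContDiff ℝ ∞ f → Continuous (fderiv ℝ f) := fun hf =>
    hf.continuous_fderiv (by simp)
  have cont1 : ∀ n, Continuous fun p => det3 (fderiv ℝ h p) (fderiv ℝ (F n) p) (fderiv ℝ (G n) p)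
      eτ es et := fun n => continuousOn_univ.1 <|
    (hh.continuous_fderiv (by simp)).continuousOn.det3 (c (hF n)).continuousOn
      (c (hG n)).continuousOn _ _ _
  have cont2 : ∀ n, Continuous fun p => h p * jac (fderiv ℝ (F n) p) (fderiv ℝ (G n) p) es et :=
    fun n => hh.continuous.mul (continuousOn_univ.1 <|
      (c (hF n)).continuousOn.jac (c (hG n)).continuousOn _ _)
  have lim1 : Tendsto (fun n => ∫ p in Icc a b ×ˢ (univ : Set (ℝ × ℝ)),
      det3 (fderiv ℝ h p) (fderiv ℝ (F n) p) (fderiv ℝ (G n) p) eτ es et) atTop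
      (𝓝 (∫ p in Icc a b ×ˢ (univ : Set (ℝ × ℝ)),
        det3 (fderiv ℝ h p) (fderiv ℝ f p) (fderiv ℝ k p) eτ es et)) := by
    refine tendsto_integral_of_dominated_convergence
      ((tsupport h).indicator fun _ => 6 * (|B| * (Cf * Ck)))
      (fun n => (cont1 n).aestronglyMeasurable) ?_ (fun n => Eventually.of_forall fun p => ?_)
      (Eventually.of_forall fun p => ?_)
    · exact ((integrable_indicator_iff (isClosed_tsupport h).measurableSet).2
        (integrableOn_const hK.measure_lt_top.ne)).integrableOn
    · by_cases hp : p ∈ tsupport h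
      · rw [indicator_of_mem hp, Real.norm_eq_abs]
        refine (abs_det3_le _ _ _ norm_eτ_le norm_es_le norm_et_le).trans ?_
        refine mul_le_mul_of_nonneg_left ?_ (by norm_num)
        exact mul_le_mul ((hB p hp).trans (le_abs_self _)) (mul_le_mul (hFb n p hp) (hGb n p hp)
          (norm_nonneg _) hCf) (by positivity) (abs_nonneg _)
      · rw [indicator_of_notMem hp, (z p hp).2]; simp [det3]
    · by_cases hp : p ∈ tsupport h
      · simp only [det3_eq]
        exact (((tendsto_jac (hFt p hp) (hGt p hp) _ _).const_mul _).add
          ((tendsto_jac (hFt p hp) (hGt p hp) _ _).const_mul _)).add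
          ((tendsto_jac (hFt p hp) (hGt p hp) _ _).const_mul _)
      · simp [det3, (z p hp).2]
  have lim2 : ∀ τ : ℝ, Tendsto (fun n => ∫ z, h (τ, z) *
      jac (fderiv ℝ (F n) (τ, z)) (fderiv ℝ (G n) (τ, z)) es et) atTop
      (𝓝 (∫ z, h (τ, z) * jac (fderiv ℝ f (τ, z)) (fderiv ℝ k (τ, z)) es et)) := fun τ => by
    have hKτ : IsCompact ((fun z : ℝ × ℝ => (τ, z)) ⁻¹' tsupport h) :=
      (isClosedEmbedding_slice τ).isCompact_preimage hK
    refine tendsto_integral_of_dominated_convergence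
      (((fun z : ℝ × ℝ => (τ, z)) ⁻¹' tsupport h).indicator fun _ => |A| * (2 * (Cf * Ck)))
      (fun n => ((cont2 n).comp (by fun_prop : Continuous fun z : ℝ × ℝ => (τ, z))
        ).aestronglyMeasurable) ?_ (fun n => Eventually.of_forall fun w => ?_)
      (Eventually.of_forall fun w => ?_)
    · exact (integrable_indicator_iff hKτ.measurableSet).2
        (integrableOn_const hKτ.measure_lt_top.ne)
    · by_cases hp : (τ, w) ∈ tsupport h
      · rw [indicator_of_mem (by exact hp), Real.norm_eq_abs, abs_mul]
        refine mul_le_mul ((hA _ hp).trans (le_abs_self _)) ((abs_jac_le _ _ norm_es_le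
          norm_et_le).trans ?_) (abs_nonneg _) (abs_nonneg _)
        exact mul_le_mul_of_nonneg_left (mul_le_mul (hFb n _ hp) (hGb n _ hp)
          (norm_nonneg _) hCf) (by norm_num)
      · rw [indicator_of_notMem (by exact hp), (z _ hp).1]; simp
    · by_cases hp : (τ, w) ∈ tsupport h
      · exact (tendsto_jac (hFt _ hp) (hGt _ hp) _ _).const_mul _
      · simp [(z _ hp).1]
  refine tendsto_nhds_unique lim1 ?_
  simp only [stokes_smooth hh hs (hF _) (hG _) hab]
  exact (lim2 b).sub (lim2 a)

end Stokes

end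

section

/-! ### Stokes' theorem for functions defined only on the slab -/

section StokesSlab

/-- The derivative within the slab. -/
abbrev slabDeriv (f : ℝ × ℝ × ℝ → ℝ) (p : ℝ × ℝ × ℝ) : ℝ × ℝ × ℝ →L[ℝ] ℝ :=
  fderivWithin ℝ f slab p

theorem uniqueDiffOn_slab : UniqueDiffOn ℝ slab :=
  (uniqueDiffOn_Icc (by norm_num)).prod uniqueDiffOn_univ

theorem mem_slab {p : ℝ × ℝ × ℝ} : p ∈ slab ↔ p.1 ∈ Icc (0 : ℝ) 1 := by simp [slab]

theorem continuousOn_slabDeriv {f : ℝ × ℝ × ℝ → ℝ} (hf : ContDiffOn ℝ 1 f slab) :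
    ContinuousOn (slabDeriv f) slab :=
  hf.continuousOn_fderivWithin uniqueDiffOn_slab le_rfl

theorem integrableOn_of_continuousOn_slab {G : ℝ × ℝ × ℝ → ℝ} (hG : ContinuousOn G slab)
    {K : Set (ℝ × ℝ)} (hK : IsCompact K) (hz : ∀ p, p.2 ∉ K → G p = 0) {a b : ℝ} (ha : 0 ≤ a)
    (hb : b ≤ 1) : IntegrableOn G (Icc a b ×ˢ (univ : Set (ℝ × ℝ))) := by
  have h : IntegrableOn G (Icc a b ×ˢ K) :=
    (hG.mono fun p hp => mem_slab.2 ⟨ha.trans hp.1.1, hp.1.2.trans hb⟩).integrableOn_compact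
      (isCompact_Icc.prod hK)
  exact h.of_forall_sdiff_eq_zero (measurableSet_Icc.prod MeasurableSet.univ) fun p hp =>
    hz p fun hpK => hp.2 ⟨hp.1.1, hpK⟩

theorem setIntegral_prod_univ_symm {G : ℝ × ℝ × ℝ → ℝ} {a b : ℝ} (hab : a ≤ b)
    (hG : IntegrableOn G (Icc a b ×ˢ (univ : Set (ℝ × ℝ)))) :
    ∫ p in Icc a b ×ˢ (univ : Set (ℝ × ℝ)), G p = ∫ z, ∫ τ in a..b, G (τ, z) := by
  rw [IntegrableOn, Measure.volume_eq_prod, ← Measure.prod_restrict, Measure.restrict_univ] at hG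
  rw [Measure.volume_eq_prod, ← Measure.prod_restrict, Measure.restrict_univ,
    integral_prod_symm _ hG]
  refine integral_congr_ae (Eventually.of_forall fun z => ?_)
  simp only
  rw [integral_Icc_eq_integral_Ioc, ← intervalIntegral.integral_of_le hab]

/-- A smooth reparametrization of the slab, extended to all of `ℝ³`. -/
def toSlab (p : ℝ × ℝ × ℝ) : ℝ × ℝ × ℝ := (Real.smoothTransition p.1, p.2)

theorem toSlab_mem (p : ℝ × ℝ × ℝ) : toSlab p ∈ slab :=
  mem_slab.2 ⟨Real.smoothTransition.nonneg _, Real.smoothTransition.le_one _⟩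

theorem contDiff_toSlab : ContDiff ℝ 1 toSlab :=
  ((Real.smoothTransition.contDiff (n := 1)).comp contDiff_fst).prodMk contDiff_snd

/-- As `toSlab` takes values in the slab everywhere, derivatives within the slab are enough to give
a derivative on all of `ℝ³`. This avoids extending functions across the boundary `τ = 0, 1`. -/
theorem fderiv_comp_toSlab {f : ℝ × ℝ × ℝ → ℝ} (hf : ContDiffOn ℝ 1 f slab) (p v : ℝ × ℝ × ℝ) :
    fderiv ℝ (f ∘ toSlab) p v =
      slabDeriv f (toSlab p) (deriv Real.smoothTransition p.1 * v.1, v.2) := by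
  have h1 : HasDerivAt Real.smoothTransition (deriv Real.smoothTransition p.1) p.1 :=
    ((Real.smoothTransition.contDiff (n := 1)).differentiable (by simp) _).hasDerivAt
  have h2 := (h1.hasFDerivAt.comp p hasFDerivAt_fst).prodMk
    (hasFDerivAt_snd (𝕜 := ℝ) (p := p) (E := ℝ) (F := ℝ × ℝ))
  have h3 := ((hf.differentiableOn (by simp)) _ (toSlab_mem p)).hasFDerivWithinAt.comp_hasFDerivAt
    (f := toSlab) p h2 (Eventually.of_forall toSlab_mem)
  rw [h3.fderiv]
  simp [mul_comm]

/-- Stokes' theorem for `χ h df ∧ dk` on `[a, b] × ℝ²`, where `χ(s, t)` is compactly supported. -/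
theorem stokes_slab {h f k : ℝ × ℝ × ℝ → ℝ} (hh : ContDiffOn ℝ 1 h slab)
    (hf : ContDiffOn ℝ 1 f slab) (hk : ContDiffOn ℝ 1 k slab) {χ : ℝ × ℝ → ℝ}
    (hχ : ContDiff ℝ 1 χ) (hχs : HasCompactSupport χ) {a b : ℝ} (ha : 0 ≤ a) (hab : a ≤ b)
    (hb : b ≤ 1) :
    IntegrableOn (fun p => χ p.2 * det3 (slabDeriv h p) (slabDeriv f p) (slabDeriv k p) eτ es et +
        (fderiv ℝ χ p.2 (1, 0) * (h p * jac (slabDeriv f p) (slabDeriv k p) et eτ) +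
          fderiv ℝ χ p.2 (0, 1) * (h p * jac (slabDeriv f p) (slabDeriv k p) eτ es)))
        (Icc a b ×ˢ (univ : Set (ℝ × ℝ))) ∧
    ∫ p in Icc a b ×ˢ (univ : Set (ℝ × ℝ)),
        (χ p.2 * det3 (slabDeriv h p) (slabDeriv f p) (slabDeriv k p) eτ es et +
        (fderiv ℝ χ p.2 (1, 0) * (h p * jac (slabDeriv f p) (slabDeriv k p) et eτ) +
          fderiv ℝ χ p.2 (0, 1) * (h p * jac (slabDeriv f p) (slabDeriv k p) eτ es))) =
      (∫ z, χ z * (h (b, z) * jac (slabDeriv f (b, z)) (slabDeriv k (b, z)) es et)) -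
        ∫ z, χ z * (h (a, z) * jac (slabDeriv f (a, z)) (slabDeriv k (a, z)) es et) := by
  set G : ℝ × ℝ × ℝ → ℝ := fun p =>
    χ p.2 * det3 (slabDeriv h p) (slabDeriv f p) (slabDeriv k p) eτ es et +
        (fderiv ℝ χ p.2 (1, 0) * (h p * jac (slabDeriv f p) (slabDeriv k p) et eτ) +
          fderiv ℝ χ p.2 (0, 1) * (h p * jac (slabDeriv f p) (slabDeriv k p) eτ es)) with hGdef
  have cχ' : Continuous (fderiv ℝ χ) := hχ.continuous_fderiv (by simp)
  have cd : ∀ v : ℝ × ℝ, ContinuousOn (fun p : ℝ × ℝ × ℝ => fderiv ℝ χ p.2 v) slab := fun v =>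
    ((cχ'.clm_apply continuous_const).comp continuous_snd).continuousOn
  have hGc : ContinuousOn G slab :=
    ((hχ.continuous.comp continuous_snd).continuousOn.mul ((continuousOn_slabDeriv hh).det3
      (continuousOn_slabDeriv hf) (continuousOn_slabDeriv hk) _ _ _)).add
    (((cd _).mul (hh.continuousOn.mul ((continuousOn_slabDeriv hf).jac (continuousOn_slabDeriv hk)
      _ _))).add ((cd _).mul (hh.continuousOn.mul ((continuousOn_slabDeriv hf).jac
        (continuousOn_slabDeriv hk) _ _))))
  have hGz : ∀ p : ℝ × ℝ × ℝ, p.2 ∉ tsupport χ → G p = 0 := fun p hp => by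
    have h0 : χ p.2 = 0 := image_eq_zero_of_notMem_tsupport hp
    have h1 : fderiv ℝ χ p.2 = 0 := by
      by_contra h0
      exact hp (support_fderiv_subset ℝ h0)
    simp [hGdef, h0, h1]
  have hGi := integrableOn_of_continuousOn_slab hGc hχs hGz ha hb
  refine ⟨hGi, ?_⟩
  have hS1 : ContinuousOn Real.smoothTransition (Icc 0 1) :=
    Real.smoothTransition.continuous.continuousOn
  -- The interval `[a, b]` is the image of some `[a', b']` under the reparametrization, so Stokes'
  -- theorem is applied over `[a', b']` and substituted back.
  obtain ⟨a', ha', rfl⟩ : ∃ a' ∈ Icc (0 : ℝ) 1, Real.smoothTransition a' = a :=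
    intermediate_value_Icc zero_le_one hS1 ⟨by simpa using ha, by simpa using hab.trans hb⟩
  obtain ⟨b', hb', rfl⟩ : ∃ b' ∈ Icc a' (1 : ℝ), Real.smoothTransition b' = b :=
    intermediate_value_Icc ha'.2 (hS1.mono (Icc_subset_Icc_left ha'.1)) ⟨hab, by simpa using hb⟩
  -- The factor `ψ(τ)` provides compact support in `τ`; it is one near `[0, 1]` and so does not
  -- change the integrands there.
  let ψ : ContDiffBump (0 : ℝ) := ⟨2, 3, by norm_num, by norm_num⟩
  let H : ℝ × ℝ × ℝ → ℝ := fun p => ψ p.1 * (χ p.2 * (h ∘ toSlab) p)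
  have gl : ∀ {f : ℝ × ℝ × ℝ → ℝ}, ContDiffOn ℝ 1 f slab → ContDiff ℝ 1 (f ∘ toSlab) := fun hf =>
    hf.comp_contDiff contDiff_toSlab toSlab_mem
  have hH : ContDiff ℝ 1 H :=
    (ψ.contDiff.comp contDiff_fst).mul ((hχ.comp contDiff_snd).mul (gl hh))
  have hHs : HasCompactSupport H := by
    refine HasCompactSupport.intro (ψ.hasCompactSupport.prod hχs) fun p hp => ?_
    by_cases h1 : p.1 ∈ tsupport ψ
    · have h2 : p.2 ∉ tsupport χ := fun h2 => hp ⟨h1, h2⟩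
      simp [H, image_eq_zero_of_notMem_tsupport h2]
    · simp [H, image_eq_zero_of_notMem_tsupport h1]
  have hψ1 : ∀ τ ∈ Icc (0 : ℝ) 1, ψ =ᶠ[𝓝 τ] 1 := fun τ hτ =>
    ψ.eventuallyEq_one_of_mem_ball (by
      rw [Metric.mem_ball, Real.dist_eq, sub_zero, abs_of_nonneg hτ.1]
      exact hτ.2.trans_lt (by norm_num))
  have hHd : ∀ p : ℝ × ℝ × ℝ, p.1 ∈ Icc (0 : ℝ) 1 → ∀ v, fderiv ℝ H p v =
      χ p.2 * slabDeriv h (toSlab p) (deriv Real.smoothTransition p.1 * v.1, v.2) +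
        h (toSlab p) * fderiv ℝ χ p.2 v.2 := fun p hp v => by
    have e1 : H =ᶠ[𝓝 p] fun p => χ p.2 * (h ∘ toSlab) p := by
      filter_upwards [(continuous_fst.tendsto p).eventually (hψ1 p.1 hp)] with q hq
      simp [H, hq]
    have h2 : HasFDerivAt (fun p : ℝ × ℝ × ℝ => χ p.2)
        ((fderiv ℝ χ p.2).comp (ContinuousLinearMap.snd ℝ ℝ (ℝ × ℝ))) p :=
      (hχ.differentiable (by simp) p.2).hasFDerivAt.comp p hasFDerivAt_snd
    have h3 := h2.mul ((gl hh).differentiable (by simp) p).hasFDerivAt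
    rw [e1.fderiv_eq]
    refine (congrArg (fun A => A v) h3.fderiv).trans ?_
    simp [fderiv_comp_toSlab hh]
  -- Pulling back a three-form by `toSlab` only multiplies it by the derivative of the
  -- reparametrization, which is the Jacobian of the substitution in `τ`.
  have hdet : ∀ p : ℝ × ℝ × ℝ, p.1 ∈ Icc (0 : ℝ) 1 →
      det3 (fderiv ℝ H p) (fderiv ℝ (f ∘ toSlab) p) (fderiv ℝ (k ∘ toSlab) p) eτ es et =
        G (toSlab p) * deriv Real.smoothTransition p.1 := fun p hp => by
    have z2 : eτ = (1, 0) := rfl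
    have sm : ∀ A : ℝ × ℝ × ℝ →L[ℝ] ℝ, A (deriv Real.smoothTransition p.1, 0) =
        deriv Real.smoothTransition p.1 * A (1, 0) := fun A => by
      rw [← smul_eq_mul, ← map_smul]; simp
    simp only [det3_eq, jac, hHd p hp, fderiv_comp_toSlab hf, fderiv_comp_toSlab hk, mul_one,
      mul_zero, hGdef, z2, sm, map_zero, add_zero]
    simp only [toSlab]
    ring
  have hm : ∀ p ∈ Icc a' b' ×ˢ (univ : Set (ℝ × ℝ)), p.1 ∈ Icc (0 : ℝ) 1 := fun p hp =>
    ⟨ha'.1.trans hp.1.1, hp.1.2.trans hb'.2⟩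
  have st := stokes_C1 hH hHs (gl hf) (gl hk) hb'.1
  have cH : Continuous fun p => det3 (fderiv ℝ H p) (fderiv ℝ (f ∘ toSlab) p)
      (fderiv ℝ (k ∘ toSlab) p) eτ es et := continuousOn_univ.1 <|
    (hH.continuous_fderiv (by simp)).continuousOn.det3
      ((gl hf).continuous_fderiv (by simp)).continuousOn
      ((gl hk).continuous_fderiv (by simp)).continuousOn _ _ _
  have iH : IntegrableOn (fun p => det3 (fderiv ℝ H p) (fderiv ℝ (f ∘ toSlab) p)
      (fderiv ℝ (k ∘ toSlab) p) eτ es et) (Icc a' b' ×ˢ (univ : Set (ℝ × ℝ))) := by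
    refine integrableOn_of_continuous_compact cH ?_ _
    refine HasCompactSupport.intro hHs fun p hp => ?_
    have : fderiv ℝ H p = 0 := by
      by_contra h0
      exact hp (support_fderiv_subset ℝ h0)
    simp [det3, this]
  rw [setIntegral_prod_univ_symm hb'.1 iH] at st
  rw [setIntegral_prod_univ_symm hab hGi]
  have lhs : ∀ z : ℝ × ℝ, ∫ τ in a'..b', det3 (fderiv ℝ H (τ, z)) (fderiv ℝ (f ∘ toSlab) (τ, z))
      (fderiv ℝ (k ∘ toSlab) (τ, z)) eτ es et =
      ∫ τ in (Real.smoothTransition a')..(Real.smoothTransition b'), G (τ, z) := fun z => by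
    have hsub : uIcc a' b' ⊆ Icc (0 : ℝ) 1 := by
      rw [uIcc_of_le hb'.1]; exact Icc_subset_Icc ha'.1 hb'.2
    rw [← intervalIntegral.integral_comp_mul_deriv' (f := Real.smoothTransition)
      (f' := deriv Real.smoothTransition) (g := fun τ => G (τ, z))]
    · exact intervalIntegral.integral_congr fun τ hτ => hdet (τ, z) (hsub hτ)
    · exact fun τ _ => ((Real.smoothTransition.contDiff (n := 1)).differentiable
        (by simp) _).hasDerivAt
    · exact ((Real.smoothTransition.contDiff (n := 1)).continuous_deriv (by simp)).continuousOn
    · refine hGc.comp (by fun_prop) ?_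
      rintro _ ⟨τ, -, rfl⟩
      exact toSlab_mem (τ, z)
  have rhs : ∀ τ ∈ Icc (0 : ℝ) 1, ∀ z : ℝ × ℝ, H (τ, z) *
      jac (fderiv ℝ (f ∘ toSlab) (τ, z)) (fderiv ℝ (k ∘ toSlab) (τ, z)) es et =
      χ z * (h (Real.smoothTransition τ, z) * jac (slabDeriv f (Real.smoothTransition τ, z))
        (slabDeriv k (Real.smoothTransition τ, z)) es et) := fun τ hτ z => by
    have : ψ τ = 1 := (hψ1 τ hτ).eq_of_nhds
    simp only [jac, fderiv_comp_toSlab hf, fderiv_comp_toSlab hk, H, this, mul_zero, toSlab,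
      Function.comp]
    ring
  simp only [lhs, rhs _ ha', rhs _ ⟨ha'.1.trans hb'.1, hb'.2⟩] at st
  exact st

variable {ι : Type*} [Fintype ι]

/-- The two-form `∑ hᵢ dfᵢ ∧ dkᵢ` on the slab. -/
def slabForm (h f k : ι → ℝ × ℝ × ℝ → ℝ) (p u v : ℝ × ℝ × ℝ) : ℝ :=
  ∑ i, h i p * jac (slabDeriv (f i) p) (slabDeriv (k i) p) u v

theorem continuousOn_slabForm {h f k : ι → ℝ × ℝ × ℝ → ℝ} (hh : ∀ i, ContDiffOn ℝ 1 (h i) slab)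
    (hf : ∀ i, ContDiffOn ℝ 1 (f i) slab) (hk : ∀ i, ContDiffOn ℝ 1 (k i) slab)
    (u v : ℝ × ℝ × ℝ) : ContinuousOn (fun p => slabForm h f k p u v) slab :=
  continuousOn_finsetSum _ fun i _ => (hh i).continuousOn.mul
    ((continuousOn_slabDeriv (hf i)).jac (continuousOn_slabDeriv (hk i)) _ _)

/-- Stokes' theorem on `[a, b] × ℝ²` for a closed two-form `∑ hᵢ dfᵢ ∧ dkᵢ`. -/
theorem stokes_slabForm {h f k : ι → ℝ × ℝ × ℝ → ℝ} (hh : ∀ i, ContDiffOn ℝ 1 (h i) slab)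
    (hf : ∀ i, ContDiffOn ℝ 1 (f i) slab) (hk : ∀ i, ContDiffOn ℝ 1 (k i) slab)
    (hd : ∀ p ∈ slab, ∑ i, det3 (slabDeriv (h i) p) (slabDeriv (f i) p) (slabDeriv (k i) p)
      eτ es et = 0) {χ : ℝ × ℝ → ℝ}
    (hχ : ContDiff ℝ 1 χ) (hχs : HasCompactSupport χ) {a b : ℝ} (ha : 0 ≤ a) (hab : a ≤ b)
    (hb : b ≤ 1) :
    ∫ p in Icc a b ×ˢ (univ : Set (ℝ × ℝ)),
        (fderiv ℝ χ p.2 (1, 0) * slabForm h f k p et eτ +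
          fderiv ℝ χ p.2 (0, 1) * slabForm h f k p eτ es) =
      (∫ z, χ z * slabForm h f k (b, z) es et) - ∫ z, χ z * slabForm h f k (a, z) es et := by
  have hi : ∀ τ ∈ Icc (0 : ℝ) 1, ∀ i, Integrable fun z => χ z * (h i (τ, z) *
      jac (slabDeriv (f i) (τ, z)) (slabDeriv (k i) (τ, z)) es et) := fun τ hτ i => by
    have hm : MapsTo (fun z : ℝ × ℝ => (τ, z)) univ slab := fun z _ => mem_slab.2 hτ
    have c : ContinuousOn (fun z => h i (τ, z) *
      jac (slabDeriv (f i) (τ, z)) (slabDeriv (k i) (τ, z)) es et) univ :=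
      ((hh i).continuousOn.mul ((continuousOn_slabDeriv (hf i)).jac
        (continuousOn_slabDeriv (hk i)) es et)).comp (by fun_prop) hm
    exact (hχ.continuous.mul (continuousOn_univ.1 c)).integrable_of_hasCompactSupport hχs.mul_right
  simp only [slabForm, Finset.mul_sum]
  rw [integral_finsetSum _ fun i _ => hi b ⟨ha.trans hab, hb⟩ i,
    integral_finsetSum _ fun i _ => hi a ⟨ha, hab.trans hb⟩ i, ← Finset.sum_sub_distrib]
  have st := fun i => stokes_slab (hh i) (hf i) (hk i) hχ hχs ha hab hb
  rw [Finset.sum_congr rfl fun i _ => (st i).2.symm]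
  rw [← integral_finsetSum _ fun i _ => (st i).1]
  refine setIntegral_congr_fun (measurableSet_Icc.prod MeasurableSet.univ) fun p hp => ?_
  simp only [Finset.sum_add_distrib, ← Finset.mul_sum,
    hd p (mem_slab.2 ⟨ha.trans hp.1.1, hp.1.2.trans hb⟩), mul_zero, zero_add]

/-- Stokes' theorem on the plane for `χ ∑ hᵢ dfᵢ`. -/
theorem stokes_plane {h f : ι → ℝ × ℝ → ℝ} (hh : ∀ i, ContDiff ℝ 1 (h i))
    (hf : ∀ i, ContDiff ℝ 2 (f i)) {χ : ℝ × ℝ → ℝ} (hχ : ContDiff ℝ 1 χ)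
    (hχs : HasCompactSupport χ) :
    ∫ z, χ z * ∑ i, jac (fderiv ℝ (h i) z) (fderiv ℝ (f i) z) (1, 0) (0, 1) =
      ∫ z, (fderiv ℝ χ z (0, 1) * (∑ i, h i z * fderiv ℝ (f i) z (1, 0)) -
        fderiv ℝ χ z (1, 0) * ∑ i, h i z * fderiv ℝ (f i) z (0, 1)) := by
  let k : ℝ × ℝ → ℝ × ℝ → ℝ := fun v z => χ z * ∑ i, h i z * fderiv ℝ (f i) z v
  have c : ∀ i (v : ℝ × ℝ), ContDiff ℝ 1 fun z => fderiv ℝ (f i) z v := fun i v =>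
    ((hf i).fderiv_right (m := 1) (by norm_num)).clm_apply contDiff_const
  have d : ∀ i (v z : ℝ × ℝ), HasFDerivAt (fun z => fderiv ℝ (f i) z v)
      ((fderiv ℝ (fderiv ℝ (f i)) z).flip v) z := fun i v z => by
    have h1 : HasFDerivAt (fderiv ℝ (f i)) (fderiv ℝ (fderiv ℝ (f i)) z) z :=
      (((hf i).fderiv_right (m := 1) (by norm_num)).differentiable (by simp) z).hasFDerivAt
    simpa using h1.clm_apply (hasFDerivAt_const v z)
  have kc : ∀ v, ContDiff ℝ 1 (k v) := fun v =>
    hχ.mul (ContDiff.sum fun i _ => (hh i).mul (c i v))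
  have ks : ∀ v, HasCompactSupport (k v) := fun v => hχs.mul_right
  have kd : ∀ v z u, fderiv ℝ (k v) z u = fderiv ℝ χ z u * (∑ i, h i z * fderiv ℝ (f i) z v) +
      χ z * ∑ i, (fderiv ℝ (h i) z u * fderiv ℝ (f i) z v +
        h i z * fderiv ℝ (fderiv ℝ (f i)) z u v) := fun v z u => by
    have h1 := (hχ.differentiable (by simp) z).hasFDerivAt.mul
      (HasFDerivAt.fun_sum (u := Finset.univ) fun i _ =>
        ((hh i).differentiable (by simp) z).hasFDerivAt.mul (d i v z))
    refine (congrArg (fun A => A u) h1.fderiv).trans ?_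
    simp only [Pi.mul_apply, add_apply, smul_apply,
      sum_apply, ContinuousLinearMap.flip_apply, smul_eq_mul]
    rw [add_comm, mul_comm (fderiv ℝ χ z u)]
    congr 2
    exact Finset.sum_congr rfl fun i _ => by ring
  have ki : ∀ v u, Integrable fun z => fderiv ℝ (k v) z u := fun v u =>
    (((kc v).continuous_fderiv (by simp)).clm_apply
      continuous_const).integrable_of_hasCompactSupport ((ks v).fderiv_apply ℝ _)
  have k0 := fun v u => integral_fderiv_eq_zero volume (kc v) (ks v) u
  have sym : ∀ i z (v w : ℝ × ℝ), fderiv ℝ (fderiv ℝ (f i)) z v w =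
      fderiv ℝ (fderiv ℝ (f i)) z w v := fun i z v w =>
    (hf i).contDiffAt.isSymmSndFDerivAt (by simp) v w
  have hsum := integral_sub (ki (0, 1) (1, 0)) (ki (1, 0) (0, 1))
  rw [k0, k0, sub_zero] at hsum
  have i1 : Integrable fun z => χ z * ∑ i, jac (fderiv ℝ (h i) z) (fderiv ℝ (f i) z) (1, 0) (0, 1) :=
    (hχ.continuous.mul (continuous_finsetSum _ fun i _ => continuousOn_univ.1 <|
      ((hh i).continuous_fderiv (by simp)).continuousOn.jac
      ((hf i).continuous_fderiv (by simp)).continuousOn _ _)).integrable_of_hasCompactSupport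
      hχs.mul_right
  -- The two sides differ by the exterior derivative of the compactly supported form `χ ∑ h df`,
  -- whose integral is zero; its second derivatives cancel by symmetry.
  have key : ∀ z, fderiv ℝ χ z (0, 1) * (∑ i, h i z * fderiv ℝ (f i) z (1, 0)) -
        fderiv ℝ χ z (1, 0) * (∑ i, h i z * fderiv ℝ (f i) z (0, 1)) =
      χ z * (∑ i, jac (fderiv ℝ (h i) z) (fderiv ℝ (f i) z) (1, 0) (0, 1)) -
        (fderiv ℝ (k (0, 1)) z (1, 0) - fderiv ℝ (k (1, 0)) z (0, 1)) := fun z => by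
    rw [kd, kd]
    have : ∑ i, jac (fderiv ℝ (h i) z) (fderiv ℝ (f i) z) (1, 0) (0, 1) =
        (∑ i, (fderiv ℝ (h i) z (1, 0) * fderiv ℝ (f i) z (0, 1) +
          h i z * fderiv ℝ (fderiv ℝ (f i)) z (1, 0) (0, 1))) -
        ∑ i, (fderiv ℝ (h i) z (0, 1) * fderiv ℝ (f i) z (1, 0) +
          h i z * fderiv ℝ (fderiv ℝ (f i)) z (0, 1) (1, 0)) := by
      rw [← Finset.sum_sub_distrib]
      refine Finset.sum_congr rfl fun i _ => ?_
      rw [sym i z (0, 1) (1, 0), jac]; ring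
    rw [this]; ring
  simp only [key]
  refine Eq.trans ?_ (integral_sub i1 ((ki (0, 1) (1, 0)).sub (ki (1, 0) (0, 1)))).symm
  simp only [Pi.sub_apply]
  rw [hsum, sub_zero]

end StokesSlab

end

section

/-! ### Cut-off functions of one variable and their products -/

section Cutoffs

theorem contDiff_smoothTransition : ContDiff ℝ ∞ Real.smoothTransition :=
  Real.smoothTransition.contDiff (n := ⊤)

theorem hasDerivAt_smoothTransition (x : ℝ) :
    HasDerivAt Real.smoothTransition (deriv Real.smoothTransition x) x :=
  (contDiff_smoothTransition.differentiable (by simp) x).hasDerivAt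

theorem continuous_deriv_smoothTransition : Continuous (deriv Real.smoothTransition) :=
  contDiff_smoothTransition.continuous_deriv (by simp)

theorem deriv_smoothTransition_eq_zero {x : ℝ} (hx : x ∉ Icc (0 : ℝ) 1) :
    deriv Real.smoothTransition x = 0 := by
  rw [mem_Icc, not_and_or, not_le, not_le] at hx
  rcases hx with hx | hx
  · have : Real.smoothTransition =ᶠ[𝓝 x] fun _ => 0 := by
      filter_upwards [gt_mem_nhds hx] with y hy using Real.smoothTransition.zero_of_nonpos hy.le
    rw [this.deriv_eq, deriv_const]
  · have : Real.smoothTransition =ᶠ[𝓝 x] fun _ => 1 := by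
      filter_upwards [lt_mem_nhds hx] with y hy using Real.smoothTransition.one_of_one_le hy.le
    rw [this.deriv_eq, deriv_const]

theorem hasCompactSupport_deriv_smoothTransition :
    HasCompactSupport (deriv Real.smoothTransition) :=
  HasCompactSupport.intro isCompact_Icc fun _ => deriv_smoothTransition_eq_zero

theorem integral_deriv_smoothTransition : ∫ x, deriv Real.smoothTransition x = 1 := by
  rw [← setIntegral_eq_integral_of_forall_compl_eq_zero (s := Icc 0 1)
    fun x hx => deriv_smoothTransition_eq_zero hx, integral_Icc_eq_integral_Ioc,
    ← intervalIntegral.integral_of_le zero_le_one,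
    intervalIntegral.integral_eq_sub_of_hasDerivAt (fun x _ => hasDerivAt_smoothTransition x)
      (continuous_deriv_smoothTransition.intervalIntegrable _ _)]
  simp

theorem exists_deriv_smoothTransition_le : ∃ C : ℝ, 0 ≤ C ∧
    ∀ x, |deriv Real.smoothTransition x| ≤ C := by
  obtain ⟨C, hC⟩ := hasCompactSupport_deriv_smoothTransition.exists_bound_of_continuous
    continuous_deriv_smoothTransition
  exact ⟨C, (norm_nonneg _).trans (hC 0), hC⟩

/-- A smooth function that is one on `[a, b]` and zero outside `[a - 1, b + 1]`. -/
def plateau (a b t : ℝ) : ℝ :=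
  Real.smoothTransition (t - a + 1) + Real.smoothTransition (b + 1 - t) - 1

variable {a b : ℝ}

theorem contDiff_plateau (a b : ℝ) : ContDiff ℝ ∞ (plateau a b) :=
  ((contDiff_smoothTransition.comp (by fun_prop)).add
    (contDiff_smoothTransition.comp (by fun_prop))).sub contDiff_const

theorem contDiff_one_plateau (a b : ℝ) : ContDiff ℝ 1 (plateau a b) :=
  (contDiff_plateau a b).of_le (by norm_cast)

theorem hasDerivAt_plateau (a b t : ℝ) : HasDerivAt (plateau a b)
    (deriv Real.smoothTransition (t - a + 1) - deriv Real.smoothTransition (b + 1 - t)) t := by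
  have h1 : HasDerivAt (fun t : ℝ => t - a + 1) 1 t := ((hasDerivAt_id t).sub_const a).add_const 1
  have h2 : HasDerivAt (fun t : ℝ => b + 1 - t) (-1) t := (hasDerivAt_id t).const_sub (b + 1)
  have := (((hasDerivAt_smoothTransition _).comp t h1).add
    ((hasDerivAt_smoothTransition _).comp t h2)).sub_const 1
  convert! this using 1
  ring

theorem deriv_plateau (a b t : ℝ) : deriv (plateau a b) t =
    deriv Real.smoothTransition (t - a + 1) - deriv Real.smoothTransition (b + 1 - t) :=
  (hasDerivAt_plateau a b t).deriv

theorem plateau_eq_one {t : ℝ} (ht : t ∈ Icc a b) : plateau a b t = 1 := by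
  rw [plateau, Real.smoothTransition.one_of_one_le (by linarith [ht.1]),
    Real.smoothTransition.one_of_one_le (by linarith [ht.2])]
  norm_num

theorem plateau_eq_zero (hab : a ≤ b) {t : ℝ} (ht : t ∉ Icc (a - 1) (b + 1)) :
    plateau a b t = 0 := by
  rw [mem_Icc, not_and_or, not_le, not_le] at ht
  rcases ht with ht | ht
  · rw [plateau, Real.smoothTransition.zero_of_nonpos (by linarith),
      Real.smoothTransition.one_of_one_le (by linarith)]
    norm_num
  · rw [plateau, Real.smoothTransition.one_of_one_le (by linarith),
      Real.smoothTransition.zero_of_nonpos (by linarith)]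
    norm_num

theorem abs_plateau_le (a b t : ℝ) : |plateau a b t| ≤ 1 := by
  rw [abs_le, plateau]
  constructor <;>
  linarith [Real.smoothTransition.nonneg (t - a + 1), Real.smoothTransition.le_one (t - a + 1),
    Real.smoothTransition.nonneg (b + 1 - t), Real.smoothTransition.le_one (b + 1 - t)]

theorem hasCompactSupport_plateau (hab : a ≤ b) : HasCompactSupport (plateau a b) :=
  HasCompactSupport.intro isCompact_Icc fun _ => plateau_eq_zero hab

theorem tendsto_plateau {ι : Type*} {l : Filter ι} {a b : ι → ℝ} (ha : Tendsto a l atBot)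
    (hb : Tendsto b l atTop) (t : ℝ) : Tendsto (fun i => plateau (a i) (b i) t) l (𝓝 1) := by
  refine tendsto_const_nhds.congr' ?_
  filter_upwards [ha.eventually_le_atBot t, hb.eventually_ge_atTop t] with i h1 h2
  exact (plateau_eq_one ⟨h1, h2⟩).symm

theorem tendsto_deriv_plateau {ι : Type*} {l : Filter ι} {a b : ι → ℝ} (ha : Tendsto a l atBot)
    (hb : Tendsto b l atTop) (t : ℝ) : Tendsto (fun i => deriv (plateau (a i) (b i)) t) l (𝓝 0) := by
  refine tendsto_const_nhds.congr' ?_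
  filter_upwards [ha.eventually_lt_atBot t, hb.eventually_gt_atTop t] with i h1 h2
  rw [deriv_plateau, deriv_smoothTransition_eq_zero fun h => ?_,
    deriv_smoothTransition_eq_zero fun h => ?_, sub_zero]
  · linarith [h.2]
  · linarith [h.2]

/-- The transition regions have length one for every plateau, so one constant serves all of them;
this is the uniform bound behind dominated convergence. -/
theorem exists_deriv_plateau_le : ∃ C : ℝ, 0 ≤ C ∧ ∀ a b t, |deriv (plateau a b) t| ≤ C := by
  obtain ⟨C, h0, hC⟩ := exists_deriv_smoothTransition_le
  refine ⟨C + C, by positivity, fun a b t => ?_⟩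
  rw [deriv_plateau]
  exact (abs_sub _ _).trans (add_le_add (hC _) (hC _))

/-- The product of functions of one variable. -/
theorem fderiv_prod_mul {β c : ℝ → ℝ} (hβ : ContDiff ℝ 1 β) (hc : ContDiff ℝ 1 c) (z : ℝ × ℝ) :
    fderiv ℝ (fun z : ℝ × ℝ => β z.1 * c z.2) z (1, 0) = deriv β z.1 * c z.2 ∧
    fderiv ℝ (fun z : ℝ × ℝ => β z.1 * c z.2) z (0, 1) = β z.1 * deriv c z.2 := by
  have h1 : HasFDerivAt (fun z : ℝ × ℝ => β z.1) _ z :=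
    ((hβ.differentiable (by simp) z.1).hasDerivAt.hasFDerivAt).comp z hasFDerivAt_fst
  have h2 : HasFDerivAt (fun z : ℝ × ℝ => c z.2) _ z :=
    ((hc.differentiable (by simp) z.2).hasDerivAt.hasFDerivAt).comp z hasFDerivAt_snd
  have h3 := (h1.mul h2).fderiv
  constructor
  · refine (congrArg (fun A => A (1, 0)) h3).trans ?_
    simp [mul_comm]
  · refine (congrArg (fun A => A (0, 1)) h3).trans ?_
    simp

theorem contDiff_prod_mul {β c : ℝ → ℝ} (hβ : ContDiff ℝ 1 β) (hc : ContDiff ℝ 1 c) :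
    ContDiff ℝ 1 (fun z : ℝ × ℝ => β z.1 * c z.2) :=
  (hβ.comp contDiff_fst).mul (hc.comp contDiff_snd)

theorem hasCompactSupport_prod_mul {β c : ℝ → ℝ} (hβ : HasCompactSupport β)
    (hc : HasCompactSupport c) : HasCompactSupport (fun z : ℝ × ℝ => β z.1 * c z.2) := by
  refine HasCompactSupport.intro (hβ.prod hc) fun p hp => ?_
  by_cases h1 : p.1 ∈ tsupport β
  · have h2 : p.2 ∉ tsupport c := fun h2 => hp ⟨h1, h2⟩
    simp [image_eq_zero_of_notMem_tsupport h2]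
  · simp [image_eq_zero_of_notMem_tsupport h1]

end Cutoffs

/-! ### Integrals against bumps moving to infinity -/

section Limits

/-- A moving bump in the variable `s` picks out the limit as `s → ±∞`. -/
theorem tendsto_integral_moving_slab {θ c : ℝ → ℝ} (hθ : Continuous θ) (hθs : HasCompactSupport θ)
    (hc : Continuous c) (hcs : HasCompactSupport c) {w : ℝ × ℝ × ℝ → ℝ} (hw : ContinuousOn w slab)
    {C : ℝ} (hC : ∀ p ∈ slab, p.2.2 ∈ tsupport c → |w p| ≤ C) {r : ℕ → ℝ}
    (hr : ∀ τ ∈ Icc (0 : ℝ) 1, ∀ s t, Tendsto (fun n => w (τ, s + r n, t)) atTop (𝓝 0))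
    {a b : ℝ} (ha : 0 ≤ a) (hb : b ≤ 1) :
    Tendsto (fun n => ∫ p in Icc a b ×ˢ (univ : Set (ℝ × ℝ)), θ (p.2.1 - r n) * c p.2.2 * w p)
      atTop (𝓝 0) := by
  set S : Set (ℝ × ℝ × ℝ) := Icc a b ×ˢ (univ : Set (ℝ × ℝ)) with hS
  have hSm : MeasurableSet S := measurableSet_Icc.prod MeasurableSet.univ
  have hSs : S ⊆ slab := fun p hp => mem_slab.2 ⟨ha.trans hp.1.1, hp.1.2.trans hb⟩
  have : (volume : Measure (ℝ × ℝ × ℝ)).IsAddLeftInvariant :=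
    inferInstanceAs ((volume : Measure ℝ).prod (volume : Measure (ℝ × ℝ))).IsAddLeftInvariant
  -- Translation in `s` keeps the bump in a fixed compact set and moves `w` instead, so that
  -- pointwise limits and a bound for `t` in the support of `c` suffice.
  have shift : ∀ n, ∫ p in S, θ (p.2.1 - r n) * c p.2.2 * w p =
      ∫ p in S, θ p.2.1 * c p.2.2 * w (p.1, p.2.1 + r n, p.2.2) := fun n => by
    rw [← integral_indicator hSm, ← integral_indicator hSm,
      ← integral_add_left_eq_self _ ((0, r n, 0) : ℝ × ℝ × ℝ)]
    refine integral_congr_ae (Eventually.of_forall fun p => ?_)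
    have e : ((0, r n, 0) : ℝ × ℝ × ℝ) + p = (p.1, p.2.1 + r n, p.2.2) := by
      ext <;> simp [add_comm]
    simp only [e]
    by_cases hp : p ∈ S
    · have hp' : (p.1, p.2.1 + r n, p.2.2) ∈ S := ⟨hp.1, trivial⟩
      rw [indicator_of_mem hp, indicator_of_mem hp']
      simp
    · have hp' : (p.1, p.2.1 + r n, p.2.2) ∉ S := fun h => hp ⟨h.1, trivial⟩
      rw [indicator_of_notMem hp, indicator_of_notMem hp']
  simp only [shift]
  rw [← integral_zero (ℝ × ℝ × ℝ) ℝ (μ := volume.restrict S)]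
  have hχ := hasCompactSupport_prod_mul hθs hcs
  refine tendsto_integral_of_dominated_convergence (fun p => |θ p.2.1 * c p.2.2| * |C|) (fun n => ?_)
    ?_ (fun n => (ae_restrict_iff' hSm).2 (Eventually.of_forall fun p hp => ?_))
    ((ae_restrict_iff' hSm).2 (Eventually.of_forall fun p hp => ?_))
  · refine ContinuousOn.aestronglyMeasurable ?_ hSm
    refine ContinuousOn.mul (by fun_prop) (hw.comp (by fun_prop) fun p hp => ?_)
    exact mem_slab.2 (mem_slab.1 (hSs hp))
  · refine integrableOn_of_continuousOn_slab (Continuous.continuousOn (by fun_prop)) hχ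
      (fun p hp => ?_) ha hb
    have : θ p.2.1 * c p.2.2 = 0 := by
      by_contra h
      exact hp (subset_tsupport _ h)
    simp [this]
  · rw [Real.norm_eq_abs, abs_mul]
    by_cases h : p.2.2 ∈ tsupport c
    · refine mul_le_mul_of_nonneg_left ?_ (abs_nonneg _)
      exact (hC (p.1, p.2.1 + r n, p.2.2) (mem_slab.2 (mem_slab.1 (hSs hp))) h).trans
        (le_abs_self _)
    · simp [image_eq_zero_of_notMem_tsupport h]
  · simpa using (hr p.1 (mem_slab.1 (hSs hp)) p.2.1 p.2.2).const_mul (θ p.2.1 * c p.2.2)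

/-- The same translation with a nonzero limit: after the shift the integrand converges to a product
of functions of `s` and `t`. This produces the boundary terms given by the asymptotic strips. -/
theorem tendsto_integral_moving_plane {θ c : ℝ → ℝ} (hθ : Continuous θ) (hθs : HasCompactSupport θ)
    (hc : Continuous c) (hcs : HasCompactSupport c) {w : ℝ × ℝ → ℝ} (hw : Continuous w)
    {C : ℝ} (hC : ∀ z, z.2 ∈ tsupport c → |w z| ≤ C) {r : ℕ → ℝ} {q : ℝ → ℝ}
    (hr : ∀ s t, Tendsto (fun n => w (s + r n, t)) atTop (𝓝 (q t))) :
    Tendsto (fun n => ∫ z : ℝ × ℝ, θ (z.1 - r n) * c z.2 * w z)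
      atTop (𝓝 ((∫ x, θ x) * ∫ t, c t * q t)) := by
  have shift : ∀ n, ∫ z : ℝ × ℝ, θ (z.1 - r n) * c z.2 * w z =
      ∫ z : ℝ × ℝ, θ z.1 * c z.2 * w (z.1 + r n, z.2) := fun n => by
    rw [← integral_add_right_eq_self _ ((r n, 0) : ℝ × ℝ)]
    refine integral_congr_ae (Eventually.of_forall fun z => ?_)
    have e : z + ((r n, 0) : ℝ × ℝ) = (z.1 + r n, z.2) := by
      ext <;> simp
    simp [e]
  simp only [shift]
  rw [← integral_prod_mul, ← Measure.volume_eq_prod]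
  have hχ := hasCompactSupport_prod_mul hθs hcs
  refine tendsto_integral_of_dominated_convergence (fun z => |θ z.1 * c z.2| * |C|) (fun n => ?_)
    ?_ (fun n => (Eventually.of_forall fun z => ?_)) (Eventually.of_forall fun z => ?_)
  · exact Continuous.aestronglyMeasurable (by fun_prop)
  · exact Continuous.integrable_of_hasCompactSupport (by fun_prop)
      (hχ.norm.mul_right (f' := fun _ => |C|))
  · rw [Real.norm_eq_abs, abs_mul]
    by_cases h : z.2 ∈ tsupport c
    · exact mul_le_mul_of_nonneg_left ((hC (z.1 + r n, z.2) h).trans (le_abs_self _)) (abs_nonneg _)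
    · simp [image_eq_zero_of_notMem_tsupport h]
  · rw [← mul_assoc]
    exact (hr z.1 z.2).const_mul (θ z.1 * c z.2)

end Limits

end

section

/-! ### Removal of the cut-offs in `s` and in `t` -/

section LimitTheorems

theorem tendsto_neg_natCast_atBot : Tendsto (fun n : ℕ => -(n : ℝ)) atTop atBot :=
  tendsto_neg_atTop_atBot.comp tendsto_natCast_atTop_atTop

theorem tendsto_integral_mul_of_bounded {X : Type*} [MeasurableSpace X] {μ : Measure X}
    {ι : Type*} {l : Filter ι} [l.IsCountablyGenerated] {k : ι → X → ℝ} {k₀ w : X → ℝ}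
    (hk : ∀ i, AEStronglyMeasurable (k i) μ) {C : ℝ} (hC : ∀ᶠ i in l, ∀ x, |k i x| ≤ C)
    (hw : Integrable w μ) (hlim : ∀ x, Tendsto (fun i => k i x) l (𝓝 (k₀ x))) :
    Tendsto (fun i => ∫ x, k i x * w x ∂μ) l (𝓝 (∫ x, k₀ x * w x ∂μ)) := by
  refine tendsto_integral_filter_of_dominated_convergence (fun x => C * |w x|)
    (Eventually.of_forall fun i => (hk i).mul hw.aestronglyMeasurable) ?_ (hw.norm.const_mul C)
    (Eventually.of_forall fun x => (hlim x).mul_const _)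
  filter_upwards [hC] with i hi
  refine Eventually.of_forall fun x => ?_
  rw [Real.norm_eq_abs, abs_mul]
  exact mul_le_mul_of_nonneg_right (hi x) (abs_nonneg _)

theorem _root_.HasCompactSupport.exists_abs_le {c : ℝ → ℝ} (hcs : HasCompactSupport c)
    (hc : Continuous c) : ∃ C, 0 ≤ C ∧ ∀ t, |c t| ≤ C := by
  obtain ⟨C, hC⟩ := hcs.exists_bound_of_continuous hc
  exact ⟨C, (norm_nonneg _).trans (hC 0), hC⟩

theorem _root_.HasCompactSupport.exists_abs_le_of_mem {c : ℝ → ℝ} (hcs : HasCompactSupport c) :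
    ∃ T, ∀ t ∈ tsupport c, |t| ≤ T := by
  obtain ⟨T, hT⟩ := hcs.isBounded.exists_norm_le
  exact ⟨T, hT⟩

theorem abs_plateau_mul_le {a b s x C : ℝ} (hx : |x| ≤ C) : |plateau a b s * x| ≤ C := by
  rw [abs_mul]
  exact (mul_le_of_le_one_left (abs_nonneg _) (abs_plateau_le a b s)).trans hx

variable {wst wtτ wτs : ℝ × ℝ × ℝ → ℝ} {a b : ℝ}

/-- The test function is `β(s) c(t)` with a plateau `β` growing to one. The derivative of `β`
consists of two bumps moving to `s = ±∞`, where the `(t, τ)` component tends to zero. The cut-off in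
`t` is kept, because no bound on that component uniform in `t` is assumed. -/
theorem stokes_slab_limit (c1 : ContinuousOn wtτ slab) (c2 : ContinuousOn wτs slab)
    (ha : 0 ≤ a) (hb : b ≤ 1)
    (hst : ∀ χ : ℝ × ℝ → ℝ, ContDiff ℝ 1 χ → HasCompactSupport χ →
      ∫ p in Icc a b ×ˢ (univ : Set (ℝ × ℝ)),
        (fderiv ℝ χ p.2 (1, 0) * wtτ p + fderiv ℝ χ p.2 (0, 1) * wτs p) =
      (∫ z, χ z * wst (b, z)) - ∫ z, χ z * wst (a, z))
    (hbd : ∀ T : ℝ, ∃ C, ∀ p ∈ slab, |p.2.2| ≤ T → |wtτ p| ≤ C)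
    (hbot : ∀ τ ∈ Icc (0 : ℝ) 1, ∀ t, Tendsto (fun s => wtτ (τ, s, t)) atBot (𝓝 0))
    (htop : ∀ τ ∈ Icc (0 : ℝ) 1, ∀ t, Tendsto (fun s => wtτ (τ, s, t)) atTop (𝓝 0))
    (hib : Integrable fun z => wst (b, z)) (hia : Integrable fun z => wst (a, z))
    (hτs : IntegrableOn wτs (Icc a b ×ˢ (univ : Set (ℝ × ℝ))))
    {c : ℝ → ℝ} (hc : ContDiff ℝ 1 c) (hcs : HasCompactSupport c) :
    ∫ p in Icc a b ×ˢ (univ : Set (ℝ × ℝ)), deriv c p.2.2 * wτs p =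
      (∫ z : ℝ × ℝ, c z.2 * wst (b, z)) - ∫ z : ℝ × ℝ, c z.2 * wst (a, z) := by
  set S : Set (ℝ × ℝ × ℝ) := Icc a b ×ˢ (univ : Set (ℝ × ℝ)) with hS
  let β : ℕ → ℝ → ℝ := fun n => plateau (-n) n
  have hβ : ∀ n, ContDiff ℝ 1 (β n) := fun n => contDiff_one_plateau _ _
  have hβs : ∀ n, HasCompactSupport (β n) := fun n => hasCompactSupport_plateau (by
    linarith [n.cast_nonneg (α := ℝ)])
  have hβ1 : ∀ x, Tendsto (fun n => β n x) atTop (𝓝 1) :=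
    tendsto_plateau tendsto_neg_natCast_atBot tendsto_natCast_atTop_atTop
  have hcc := hc.continuous
  have hc'c : Continuous (deriv c) := hc.continuous_deriv le_rfl
  have hc's : HasCompactSupport (deriv c) := hcs.deriv
  obtain ⟨A, hA0, hA⟩ := hcs.exists_abs_le hcc
  obtain ⟨A', hA'0, hA'⟩ := hc's.exists_abs_le hc'c
  obtain ⟨T, hT⟩ := hcs.exists_abs_le_of_mem
  obtain ⟨C, hC⟩ := hbd T
  have rhs : ∀ {w : ℝ × ℝ → ℝ}, Integrable w → Tendsto (fun n => ∫ z, (β n z.1 * c z.2) * w z) atTop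
      (𝓝 (∫ z, c z.2 * w z)) := fun {w} hw => by
    refine tendsto_integral_mul_of_bounded (C := A) (fun n => ?_) (Eventually.of_forall fun n z => ?_) hw
      fun z => ?_
    · exact (((hβ n).continuous.comp continuous_fst).mul
        (hcc.comp continuous_snd)).aestronglyMeasurable
    · exact abs_plateau_mul_le (hA _)
    · simpa using (hβ1 z.1).mul_const (c z.2)
  have lhs2 : Tendsto (fun n => ∫ p in S, (β n p.2.1 * deriv c p.2.2) * wτs p) atTop
      (𝓝 (∫ p in S, deriv c p.2.2 * wτs p)) := by
    refine tendsto_integral_mul_of_bounded (C := A') (fun n => ?_) (Eventually.of_forall fun n z => ?_) hτs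
      fun z => ?_
    · have := (hβ n).continuous
      exact Continuous.aestronglyMeasurable (by fun_prop)
    · exact abs_plateau_mul_le (hA' _)
    · simpa using (hβ1 z.2.1).mul_const (deriv c z.2.2)
  let θ := deriv Real.smoothTransition
  have hθ : Continuous θ := continuous_deriv_smoothTransition
  have hθs : HasCompactSupport θ := hasCompactSupport_deriv_smoothTransition
  have hθs' : HasCompactSupport fun x => θ (-x) :=
    hθs.comp_homeomorph (Homeomorph.neg ℝ)
  have bd : ∀ p ∈ slab, p.2.2 ∈ tsupport c → |wtτ p| ≤ C := fun p hp h => hC p hp (hT _ h)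
  have tB : ∀ s : ℝ, Tendsto (fun n : ℕ => s + -((n : ℝ) + 1)) atTop atBot := fun s =>
    tendsto_atBot_add_const_left _ _ (tendsto_neg_atTop_atBot.comp
      (tendsto_atTop_add_const_right _ _ tendsto_natCast_atTop_atTop))
  have tT : ∀ s : ℝ, Tendsto (fun n : ℕ => s + ((n : ℝ) + 1)) atTop atTop := fun s =>
    tendsto_atTop_add_const_left _ _
      (tendsto_atTop_add_const_right _ _ tendsto_natCast_atTop_atTop)
  have m1 := tendsto_integral_moving_slab hθ hθs hcc hcs c1 bd (r := fun n => -((n : ℝ) + 1))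
    (fun τ hτ s t => (hbot τ hτ t).comp (tB s)) ha hb
  have m2 := tendsto_integral_moving_slab (hθ.comp continuous_neg) hθs' hcc hcs c1 bd
    (r := fun n => (n : ℝ) + 1) (fun τ hτ s t => (htop τ hτ t).comp (tT s)) ha hb
  have ic : ∀ {k : ℝ → ℝ}, Continuous k → HasCompactSupport k →
      IntegrableOn (fun p => k p.2.1 * c p.2.2 * wtτ p) S := fun {k} hk hks => by
    refine integrableOn_of_continuousOn_slab (ContinuousOn.mul (by fun_prop) c1)
      (hasCompactSupport_prod_mul hks hcs) (fun p hp => ?_) ha hb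
    have : k p.2.1 * c p.2.2 = 0 := by
      by_contra h
      exact hp (subset_tsupport _ h)
    simp [this]
  have ic2 : ∀ n, IntegrableOn (fun p => β n p.2.1 * deriv c p.2.2 * wτs p) S := fun n => by
    have := (hβ n).continuous
    refine integrableOn_of_continuousOn_slab (ContinuousOn.mul (by fun_prop) c2)
      (hasCompactSupport_prod_mul (hβs n) hc's) (fun p hp => ?_) ha hb
    have : β n p.2.1 * deriv c p.2.2 = 0 := by
      by_contra h
      exact hp (subset_tsupport _ h)
    simp [this]
  have eq : ∀ n : ℕ, (∫ p in S, θ (p.2.1 - -((n : ℝ) + 1)) * c p.2.2 * wtτ p) -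
      (∫ p in S, θ (-(p.2.1 - ((n : ℝ) + 1))) * c p.2.2 * wtτ p) +
      ∫ p in S, (β n p.2.1 * deriv c p.2.2) * wτs p =
      (∫ z : ℝ × ℝ, (β n z.1 * c z.2) * wst (b, z)) -
        ∫ z : ℝ × ℝ, (β n z.1 * c z.2) * wst (a, z) := fun n => by
    rw [← hst _ (contDiff_prod_mul (hβ n) hc) (hasCompactSupport_prod_mul (hβs n) hcs)]
    have i1 := ic (k := fun s => θ (s - -((n : ℝ) + 1))) (by fun_prop)
      (hθs.comp_homeomorph (Homeomorph.subRight (-((n : ℝ) + 1))))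
    have i2 := ic (k := fun s => θ (-(s - ((n : ℝ) + 1)))) (by fun_prop)
      (hθs'.comp_homeomorph (Homeomorph.subRight ((n : ℝ) + 1)))
    rw [← integral_sub i1 i2]
    refine (integral_add (i1.sub i2) (ic2 n)).symm.trans ?_
    refine integral_congr_ae (Eventually.of_forall fun p => ?_)
    obtain ⟨e1, e2⟩ := fderiv_prod_mul (hβ n) hc p.2
    simp only [Pi.sub_apply]
    rw [e1, e2, deriv_plateau]
    have e3 : p.2.1 - -((n : ℝ) + 1) = p.2.1 - -n + 1 := by ring
    have e4 : -(p.2.1 - ((n : ℝ) + 1)) = n + 1 - p.2.1 := by ring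
    rw [e3, e4]
    ring
  have l1 := ((m1.sub m2).add lhs2)
  rw [sub_zero, zero_add] at l1
  exact tendsto_nhds_unique (l1.congr eq) ((rhs hib).sub (rhs hia))

/-- The integrals of a closed two-form over two slices agree. -/
theorem integral_slice_eq (hτs : IntegrableOn wτs (Icc a b ×ˢ (univ : Set (ℝ × ℝ))))
    (hib : Integrable fun z => wst (b, z)) (hia : Integrable fun z => wst (a, z))
    (h : ∀ c : ℝ → ℝ, ContDiff ℝ 1 c → HasCompactSupport c →
      ∫ p in Icc a b ×ˢ (univ : Set (ℝ × ℝ)), deriv c p.2.2 * wτs p =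
      (∫ z : ℝ × ℝ, c z.2 * wst (b, z)) - ∫ z : ℝ × ℝ, c z.2 * wst (a, z)) :
    ∫ z, wst (b, z) = ∫ z, wst (a, z) := by
  let β : ℕ → ℝ → ℝ := fun n => plateau (-n) n
  have hβ : ∀ n, ContDiff ℝ 1 (β n) := fun n => contDiff_one_plateau _ _
  have hβs : ∀ n, HasCompactSupport (β n) := fun n => hasCompactSupport_plateau (by
    linarith [n.cast_nonneg (α := ℝ)])
  obtain ⟨C, -, hC⟩ := exists_deriv_plateau_le
  -- Integrability of the `(τ, s)` component removes the contribution of `t → ±∞`; no vanishing of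
  -- the form there is used.
  have l1 : Tendsto (fun n => ∫ p in Icc a b ×ˢ (univ : Set (ℝ × ℝ)), deriv (β n) p.2.2 * wτs p)
      atTop (𝓝 (∫ p in Icc a b ×ˢ (univ : Set (ℝ × ℝ)), 0 * wτs p)) :=
    tendsto_integral_mul_of_bounded (k₀ := fun _ => 0)
      (fun n => (((hβ n).continuous_deriv le_rfl).comp (by fun_prop :
        Continuous fun p : ℝ × ℝ × ℝ => p.2.2)).aestronglyMeasurable)
      (Eventually.of_forall fun n p => hC _ _ _) hτs
      fun p => tendsto_deriv_plateau tendsto_neg_natCast_atBot tendsto_natCast_atTop_atTop _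
  have l2 : ∀ {w : ℝ × ℝ → ℝ}, Integrable w → Tendsto (fun n => ∫ z : ℝ × ℝ, β n z.2 * w z) atTop
      (𝓝 (∫ z, 1 * w z)) := fun hw =>
    tendsto_integral_mul_of_bounded (k₀ := fun _ => 1)
      (fun n => ((hβ n).continuous.comp continuous_snd).aestronglyMeasurable)
      (Eventually.of_forall fun n p => abs_plateau_le _ _ _) hw
      fun p => tendsto_plateau tendsto_neg_natCast_atBot tendsto_natCast_atTop_atTop _
  have l3 := (l2 hib).sub (l2 hia)
  have l4 := tendsto_nhds_unique (l1.congr fun n => h _ (hβ n) (hβs n)) l3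
  simp only [zero_mul, integral_zero, one_mul] at l4
  linarith

/-- If a closed two-form vanishes on the slices, its third component has integral zero. -/
theorem integral_slab_eq_zero (hτs : IntegrableOn wτs (Icc a b ×ˢ (univ : Set (ℝ × ℝ))))
    (hb : ∀ z, wst (b, z) = 0) (ha : ∀ z, wst (a, z) = 0)
    (h : ∀ c : ℝ → ℝ, ContDiff ℝ 1 c → HasCompactSupport c →
      ∫ p in Icc a b ×ˢ (univ : Set (ℝ × ℝ)), deriv c p.2.2 * wτs p =
      (∫ z : ℝ × ℝ, c z.2 * wst (b, z)) - ∫ z : ℝ × ℝ, c z.2 * wst (a, z)) :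
    ∫ p in Icc a b ×ˢ (univ : Set (ℝ × ℝ)), wτs p = 0 := by
  -- The aim is `c(t) = t`, which lacks compact support. The rescaled functions `(n + 1) ψ(t / (n +
  -- 1))` agree with `t` for `|t| ≤ n + 1`, and rescaling leaves the bound on the derivative
  -- unchanged.
  let ψ : ℝ → ℝ := fun t => plateau (-1) 1 t * t
  have hψ : ContDiff ℝ 1 ψ := (contDiff_one_plateau _ _).mul contDiff_id
  have hψs : HasCompactSupport ψ := (hasCompactSupport_plateau (by norm_num)).mul_right
  have hψ' : Continuous (deriv ψ) := hψ.continuous_deriv le_rfl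
  have hψ0 : deriv ψ 0 = 1 := by
    have : ψ =ᶠ[𝓝 0] id := by
      filter_upwards [Icc_mem_nhds (by norm_num : (-1 : ℝ) < 0) (by norm_num : (0 : ℝ) < 1)]
        with t ht
      simp [ψ, plateau_eq_one ht]
    rw [this.deriv_eq, deriv_id]
  obtain ⟨C, -, hC⟩ := hψs.deriv.exists_abs_le hψ'
  let c : ℕ → ℝ → ℝ := fun n t => (n + 1) * ψ (t / (n + 1))
  have hc : ∀ n, ContDiff ℝ 1 (c n) := fun n =>
    contDiff_const.mul (hψ.comp (contDiff_id.div_const _))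
  have hn : ∀ n : ℕ, ((n : ℝ) + 1) ≠ 0 := fun n => by positivity
  have hcs : ∀ n, HasCompactSupport (c n) := fun n =>
    (hψs.comp_homeomorph ((Homeomorph.mulRight₀ ((n : ℝ) + 1)⁻¹ (inv_ne_zero (hn n))))).mul_left
  have hcd : ∀ n t, deriv (c n) t = deriv ψ (t / (n + 1)) := fun n t => by
    have h1 := (((hψ.differentiable (by simp) (t / (n + 1))).hasDerivAt).comp t
      ((hasDerivAt_id t).div_const ((n : ℝ) + 1))).const_mul ((n : ℝ) + 1)
    refine h1.deriv.trans ?_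
    field_simp [hn n]
  have l1 : Tendsto (fun n => ∫ p in Icc a b ×ˢ (univ : Set (ℝ × ℝ)), deriv (c n) p.2.2 * wτs p)
      atTop (𝓝 (∫ p in Icc a b ×ˢ (univ : Set (ℝ × ℝ)), 1 * wτs p)) := by
    refine tendsto_integral_mul_of_bounded (k₀ := fun _ => 1)
      (fun n => (((hc n).continuous_deriv le_rfl).comp (by fun_prop :
        Continuous fun p : ℝ × ℝ × ℝ => p.2.2)).aestronglyMeasurable)
      (Eventually.of_forall fun n p => by rw [hcd]; exact hC _) hτs fun p => ?_
    simp only [hcd]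
    have ht := hψ'.tendsto 0
    rw [hψ0] at ht
    refine ht.comp ?_
    have := (tendsto_one_div_add_atTop_nhds_zero_nat (𝕜 := ℝ)).const_mul p.2.2
    rw [mul_zero] at this
    refine this.congr fun n => ?_
    rw [mul_one_div]
  have l2 : ∀ n, ∫ p in Icc a b ×ˢ (univ : Set (ℝ × ℝ)), deriv (c n) p.2.2 * wτs p = 0 := fun n => by
    rw [h _ (hc n) (hcs n)]
    simp [ha, hb]
  simp only [l2, one_mul] at l1
  exact tendsto_nhds_unique l1 tendsto_const_nhds

variable {w ls lt : ℝ × ℝ → ℝ} {qm qp : ℝ → ℝ}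

/-- Stokes' theorem on the plane, as the cut-off in the variable `s` is removed. -/
theorem stokes_plane_limit (c1 : Continuous lt) (c2 : Continuous ls)
    (hst : ∀ χ : ℝ × ℝ → ℝ, ContDiff ℝ 1 χ → HasCompactSupport χ →
      ∫ z, χ z * w z = ∫ z, (fderiv ℝ χ z (0, 1) * ls z - fderiv ℝ χ z (1, 0) * lt z))
    (hbd : ∀ T : ℝ, ∃ C, ∀ z : ℝ × ℝ, |z.2| ≤ T → |lt z| ≤ C)
    (hbot : ∀ t, Tendsto (fun s => lt (s, t)) atBot (𝓝 (qm t)))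
    (htop : ∀ t, Tendsto (fun s => lt (s, t)) atTop (𝓝 (qp t)))
    (hw : Integrable w) (hls : Integrable ls)
    {c : ℝ → ℝ} (hc : ContDiff ℝ 1 c) (hcs : HasCompactSupport c) :
    ∫ z : ℝ × ℝ, c z.2 * w z =
      (∫ z : ℝ × ℝ, deriv c z.2 * ls z) - ((∫ t, c t * qm t) - ∫ t, c t * qp t) := by
  let β : ℕ → ℝ → ℝ := fun n => plateau (-n) n
  have hβ : ∀ n, ContDiff ℝ 1 (β n) := fun n => contDiff_one_plateau _ _
  have hβs : ∀ n, HasCompactSupport (β n) := fun n => hasCompactSupport_plateau (by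
    linarith [n.cast_nonneg (α := ℝ)])
  have hβ1 : ∀ x, Tendsto (fun n => β n x) atTop (𝓝 1) :=
    tendsto_plateau tendsto_neg_natCast_atBot tendsto_natCast_atTop_atTop
  have hcc := hc.continuous
  have hc'c : Continuous (deriv c) := hc.continuous_deriv le_rfl
  have hc's : HasCompactSupport (deriv c) := hcs.deriv
  obtain ⟨T, hT⟩ := hcs.exists_abs_le_of_mem
  obtain ⟨C, hC⟩ := hbd T
  have lim : ∀ {k : ℝ → ℝ} {w : ℝ × ℝ → ℝ}, Continuous k → HasCompactSupport k → Integrable w →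
      Tendsto (fun n => ∫ z, (β n z.1 * k z.2) * w z) atTop
      (𝓝 (∫ z, k z.2 * w z)) := fun {k w} hk hks hw => by
    obtain ⟨A, -, hA⟩ := hks.exists_abs_le hk
    refine tendsto_integral_mul_of_bounded (C := A) (fun n => ?_) (Eventually.of_forall fun n z => ?_) hw
      fun z => ?_
    · exact (((hβ n).continuous.comp continuous_fst).mul
        (hk.comp continuous_snd)).aestronglyMeasurable
    · exact abs_plateau_mul_le (hA _)
    · simpa using (hβ1 z.1).mul_const (k z.2)
  let θ := deriv Real.smoothTransition
  have hθ : Continuous θ := continuous_deriv_smoothTransition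
  have hθs : HasCompactSupport θ := hasCompactSupport_deriv_smoothTransition
  have hθs' : HasCompactSupport fun x => θ (-x) :=
    hθs.comp_homeomorph (Homeomorph.neg ℝ)
  have bd : ∀ z : ℝ × ℝ, z.2 ∈ tsupport c → |lt z| ≤ C := fun z h => hC z (hT _ h)
  have tB : ∀ s : ℝ, Tendsto (fun n : ℕ => s + -((n : ℝ) + 1)) atTop atBot := fun s =>
    tendsto_atBot_add_const_left _ _ (tendsto_neg_atTop_atBot.comp
      (tendsto_atTop_add_const_right _ _ tendsto_natCast_atTop_atTop))
  have tT : ∀ s : ℝ, Tendsto (fun n : ℕ => s + ((n : ℝ) + 1)) atTop atTop := fun s =>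
    tendsto_atTop_add_const_left _ _
      (tendsto_atTop_add_const_right _ _ tendsto_natCast_atTop_atTop)
  have m1 := tendsto_integral_moving_plane hθ hθs hcc hcs c1 bd (r := fun n => -((n : ℝ) + 1))
    (fun s t => (hbot t).comp (tB s))
  have m2 := tendsto_integral_moving_plane (hθ.comp continuous_neg) hθs' hcc hcs c1 bd
    (r := fun n => (n : ℝ) + 1) (fun s t => (htop t).comp (tT s))
  -- Each moving bump has total mass one, so the limits are exactly `∫ c qm` and `∫ c qp`.
  have e1 : ∫ x, θ x = 1 := integral_deriv_smoothTransition
  have e2 : ∫ x, (θ ∘ fun x => -x) x = 1 := (integral_neg_eq_self θ volume).trans e1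
  rw [e1, one_mul] at m1
  rw [e2, one_mul] at m2
  have ic : ∀ {k l : ℝ → ℝ} {w : ℝ × ℝ → ℝ}, Continuous k → HasCompactSupport k → Continuous l →
      HasCompactSupport l → Continuous w →
      Integrable (fun z : ℝ × ℝ => k z.1 * l z.2 * w z) := fun hk hks hl hls hw =>
    Continuous.integrable_of_hasCompactSupport (by fun_prop)
      (hasCompactSupport_prod_mul hks hls).mul_right
  have eq : ∀ n : ℕ, (∫ z : ℝ × ℝ, (β n z.1 * deriv c z.2) * ls z) -
      ((∫ z : ℝ × ℝ, θ (z.1 - -((n : ℝ) + 1)) * c z.2 * lt z) -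
      (∫ z : ℝ × ℝ, θ (-(z.1 - ((n : ℝ) + 1))) * c z.2 * lt z)) =
      ∫ z : ℝ × ℝ, (β n z.1 * c z.2) * w z := fun n => by
    rw [hst _ (contDiff_prod_mul (hβ n) hc) (hasCompactSupport_prod_mul (hβs n) hcs)]
    have i1 := ic (k := fun s => θ (s - -((n : ℝ) + 1))) (by fun_prop)
      (hθs.comp_homeomorph (Homeomorph.subRight (-((n : ℝ) + 1)))) hcc hcs c1
    have i2 := ic (k := fun s => θ (-(s - ((n : ℝ) + 1)))) (by fun_prop)
      (hθs'.comp_homeomorph (Homeomorph.subRight ((n : ℝ) + 1))) hcc hcs c1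
    rw [← integral_sub i1 i2]
    refine (integral_sub (ic (hβ n).continuous (hβs n) hc'c hc's c2) (i1.sub i2)).symm.trans ?_
    refine integral_congr_ae (Eventually.of_forall fun z => ?_)
    obtain ⟨e1, e2⟩ := fderiv_prod_mul (hβ n) hc z
    simp only [Pi.sub_apply]
    rw [e1, e2, deriv_plateau]
    have e3 : z.1 - -((n : ℝ) + 1) = z.1 - -n + 1 := by ring
    have e4 : -(z.1 - ((n : ℝ) + 1)) = n + 1 - z.1 := by ring
    rw [e3, e4]
    ring
  exact (tendsto_nhds_unique (((lim hc'c hc's hls).sub (m1.sub m2)).congr eq)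
    (lim hcc hcs hw)).symm

variable (hcut : ∀ c : ℝ → ℝ, ContDiff ℝ 1 c → HasCompactSupport c →
    ∫ z : ℝ × ℝ, c z.2 * w z =
      (∫ z : ℝ × ℝ, deriv c z.2 * ls z) - ((∫ t, c t * qm t) - ∫ t, c t * qp t))
include hcut

/-- The limit of the difference of actions. -/
theorem tendsto_intervalIntegral_sub (hw : Integrable w) (hls : Integrable ls)
    (hqm : Continuous qm) (hqp : Continuous qp)
    (hbot : Tendsto (fun t => qm t - qp t) atBot (𝓝 0))
    (htop : Tendsto (fun t => qm t - qp t) atTop (𝓝 0)) :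
    Tendsto (fun T : ℝ × ℝ => ∫ t in T.1..T.2, (qm t - qp t)) (atBot ×ˢ atTop)
      (𝓝 (-∫ z, w z)) := by
  let Q : ℝ → ℝ := fun t => qm t - qp t
  have hQ : Continuous Q := hqm.sub hqp
  have f1 : Tendsto (fun T : ℝ × ℝ => T.1) (atBot ×ˢ atTop) atBot := tendsto_fst
  have f2 : Tendsto (fun T : ℝ × ℝ => T.2) (atBot ×ˢ atTop) atTop := tendsto_snd
  obtain ⟨C, -, hC⟩ := exists_deriv_plateau_le
  have l1 : Tendsto (fun T : ℝ × ℝ => ∫ z : ℝ × ℝ, plateau T.1 T.2 z.2 * w z) (atBot ×ˢ atTop)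
      (𝓝 (∫ z, 1 * w z)) :=
    tendsto_integral_mul_of_bounded (k₀ := fun _ => 1)
      (fun T => ((contDiff_plateau T.1 T.2).continuous.comp continuous_snd).aestronglyMeasurable)
      (Eventually.of_forall fun T z => abs_plateau_le _ _ _) hw
      fun z => tendsto_plateau f1 f2 _
  have l2 : Tendsto (fun T : ℝ × ℝ => ∫ z : ℝ × ℝ, deriv (plateau T.1 T.2) z.2 * ls z)
      (atBot ×ˢ atTop) (𝓝 (∫ z, 0 * ls z)) :=
    tendsto_integral_mul_of_bounded (k₀ := fun _ => 0)
      (fun T => (((contDiff_one_plateau T.1 T.2).continuous_deriv le_rfl).comp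
        continuous_snd).aestronglyMeasurable)
      (Eventually.of_forall fun T z => hC _ _ _) hls
      fun z => tendsto_deriv_plateau f1 f2 _
  -- The plateau differs from the indicator of `[T.1, T.2]` only on two intervals of length one,
  -- where the integrals are at most the supremum of `|Q|` and hence tend to zero.
  have bound : ∀ {a b x ε : ℝ}, (∀ t ∈ uIoc x (x + 1), |Q t| ≤ ε) →
      |∫ t in x..(x + 1), plateau a b t * Q t| ≤ ε := fun {a b x ε} h => by
    have := intervalIntegral.norm_integral_le_of_norm_le_const (a := x) (b := x + 1)
      (f := fun t => plateau a b t * Q t) (C := ε) fun t ht => abs_plateau_mul_le (h t ht)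
    simpa using this
  have l3 : Tendsto (fun T : ℝ × ℝ => ∫ t in (T.1 - 1)..(T.1 - 1 + 1), plateau T.1 T.2 t * Q t)
      (atBot ×ˢ atTop) (𝓝 0) := by
    rw [Metric.tendsto_nhds]
    intro ε hε
    obtain ⟨A, hA⟩ := eventually_atBot.1 (Metric.tendsto_nhds.1 hbot (ε / 2) (by positivity))
    filter_upwards [f1.eventually_le_atBot A] with T hT
    rw [Real.dist_eq, sub_zero]
    refine (bound fun t ht => ?_).trans_lt (half_lt_self hε)
    rw [uIoc_of_le (by linarith)] at ht
    have := hA t (by linarith [ht.2])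
    rw [Real.dist_eq, sub_zero] at this
    exact this.le
  have l4 : Tendsto (fun T : ℝ × ℝ => ∫ t in T.2..(T.2 + 1), plateau T.1 T.2 t * Q t)
      (atBot ×ˢ atTop) (𝓝 0) := by
    rw [Metric.tendsto_nhds]
    intro ε hε
    obtain ⟨A, hA⟩ := eventually_atTop.1 (Metric.tendsto_nhds.1 htop (ε / 2) (by positivity))
    filter_upwards [f2.eventually_ge_atTop A] with T hT
    rw [Real.dist_eq, sub_zero]
    refine (bound fun t ht => ?_).trans_lt (half_lt_self hε)
    rw [uIoc_of_le (by linarith)] at ht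
    have := hA t (by linarith [ht.1])
    rw [Real.dist_eq, sub_zero] at this
    exact this.le
  have l5 := ((l2.sub l1).sub l3).sub l4
  simp only [zero_mul, integral_zero, one_mul, zero_sub, sub_zero] at l5
  refine l5.congr' ?_
  filter_upwards [f1.eventually_le_atBot 0, f2.eventually_ge_atTop 0] with T h1 h2
  have hT : T.1 ≤ T.2 := h1.trans h2
  have hs := hasCompactSupport_plateau hT
  have hp := (contDiff_plateau T.1 T.2).continuous
  have im : Integrable fun t => plateau T.1 T.2 t * qm t :=
    (hp.mul hqm).integrable_of_hasCompactSupport hs.mul_right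
  have ip : Integrable fun t => plateau T.1 T.2 t * qp t :=
    (hp.mul hqp).integrable_of_hasCompactSupport hs.mul_right
  rw [hcut _ (contDiff_one_plateau _ _) hs, ← integral_sub im ip]
  have e : ∫ t, (plateau T.1 T.2 t * qm t - plateau T.1 T.2 t * qp t) =
      ∫ t in (T.1 - 1)..(T.2 + 1), plateau T.1 T.2 t * Q t := by
    rw [intervalIntegral.integral_of_le (by linarith), ← integral_Icc_eq_integral_Ioc,
      setIntegral_eq_integral_of_forall_compl_eq_zero fun t ht => by
        rw [plateau_eq_zero hT ht, zero_mul]]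
    exact integral_congr_ae (Eventually.of_forall fun t => by simp only [Q]; ring)
  have ii : ∀ x y, IntervalIntegrable (fun t => plateau T.1 T.2 t * Q t) volume x y := fun x y =>
    (hp.mul hQ).intervalIntegrable x y
  rw [e, ← intervalIntegral.integral_add_adjacent_intervals (ii (T.1 - 1) T.2) (ii T.2 _),
    ← intervalIntegral.integral_add_adjacent_intervals (ii (T.1 - 1) T.1) (ii T.1 _)]
  have e' : ∫ t in T.1..T.2, plateau T.1 T.2 t * Q t = ∫ t in T.1..T.2, Q t :=
    intervalIntegral.integral_congr fun t ht => by
      rw [uIcc_of_le hT] at ht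
      simp only [plateau_eq_one ht, one_mul]
  rw [e', sub_add_cancel]
  ring

/-- When the two boundary functions agree they cancel for every cut-off, so neither continuity nor
decay of them is needed. -/
theorem integral_plane_eq_zero (hw : Integrable w) (hls : Integrable ls) (hq : ∀ t, qm t = qp t) :
    ∫ z, w z = 0 := by
  obtain ⟨C, -, hC⟩ := exists_deriv_plateau_le
  have l1 : Tendsto (fun n : ℕ => ∫ z : ℝ × ℝ, plateau (-n) n z.2 * w z) atTop
      (𝓝 (∫ z, 1 * w z)) :=
    tendsto_integral_mul_of_bounded (k₀ := fun _ => 1)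
      (fun T => ((contDiff_plateau _ _).continuous.comp continuous_snd).aestronglyMeasurable)
      (Eventually.of_forall fun T z => abs_plateau_le _ _ _) hw
      fun z => tendsto_plateau tendsto_neg_natCast_atBot tendsto_natCast_atTop_atTop _
  have l2 : Tendsto (fun n : ℕ => ∫ z : ℝ × ℝ, deriv (plateau (-n) n) z.2 * ls z)
      atTop (𝓝 (∫ z, 0 * ls z)) :=
    tendsto_integral_mul_of_bounded (k₀ := fun _ => 0)
      (fun T => (((contDiff_one_plateau _ _).continuous_deriv le_rfl).comp
        continuous_snd).aestronglyMeasurable)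
      (Eventually.of_forall fun T z => hC _ _ _) hls
      fun z => tendsto_deriv_plateau tendsto_neg_natCast_atBot tendsto_natCast_atTop_atTop _
  have l3 := l1.congr fun (n : ℕ) => (by
    rw [hcut _ (contDiff_one_plateau _ _) (hasCompactSupport_plateau (by
      linarith [n.cast_nonneg (α := ℝ)]))]
    simp only [hq, sub_self, sub_zero] :
    ∫ z : ℝ × ℝ, plateau (-n) n z.2 * w z = ∫ z : ℝ × ℝ, deriv (plateau (-n) n) z.2 * ls z)
  have := tendsto_nhds_unique l3 l2
  simpa using this

end LimitTheorems

end

section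

variable {E : Type u} [NormedAddCommGroup E] [NormedSpace ℝ E]
variable {M : Type v} [TopologicalSpace M] [ChartedSpace E M]

/-! ### Derivatives of maps from domains in vector spaces -/

section MapDeriv

variable {V : Type*} [NormedAddCommGroup V] [NormedSpace ℝ V]
variable {V' : Type*} [NormedAddCommGroup V'] [NormedSpace ℝ V']

variable (E) in
/-- The derivative within `D` of a map from a vector space to a manifold. -/
def mapDeriv (D : Set V) (F : V → M) (p : V) : V →L[ℝ] E :=
  mfderivWithin 𝓘(ℝ, V) 𝓘(ℝ, E) F D p

/-- The chain rule in this form turns expansions of forms on `M` into expressions in ordinary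
derivatives of real functions on `D`. -/
theorem fderivWithin_smooth_comp {D : Set V} (hD : UniqueDiffOn ℝ D) {F : V → M}
    (hF : ContMDiffOn 𝓘(ℝ, V) 𝓘(ℝ, E) 1 F D) {f : M → ℝ}
    (hf : ContMDiff 𝓘(ℝ, E) 𝓘(ℝ, ℝ) ∞ f) {p : V} (hp : p ∈ D) (e : V) :
    fderivWithin ℝ (f ∘ F) D p e = diff f (F p) (mapDeriv E D F p e) := by
  rw [← mfderivWithin_eq_fderivWithin]
  exact congrArg (fun A : V →L[ℝ] ℝ => A e) (mfderiv_comp_mfderivWithin p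
    (hf.mdifferentiable (by simp) _) (hF.mdifferentiableOn (by simp) p hp)
    (hD p hp).uniqueMDiffWithinAt)

theorem contDiffOn_smooth_comp {n : ℕ∞ω} (hn : n ≤ ∞) {D : Set V} {F : V → M}
    (hF : ContMDiffOn 𝓘(ℝ, V) 𝓘(ℝ, E) n F D) {f : M → ℝ}
    (hf : ContMDiff 𝓘(ℝ, E) 𝓘(ℝ, ℝ) ∞ f) : ContDiffOn ℝ n (f ∘ F) D :=
  contMDiffOn_iff_contDiffOn.1 ((hf.of_le hn).comp_contMDiffOn hF)

theorem one_le_infty : (1 : ℕ∞ω) ≤ ∞ := one_le_two.trans two_le_infty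

theorem fderivWithin_affine_comp {D : Set V} {D' : Set V'} (hD' : UniqueDiffOn ℝ D') {X : V → ℝ}
    (hX : ContDiffOn ℝ 1 X D) {A : V' → V} {A' : V' →L[ℝ] V} {z : V'} (hA : HasFDerivAt A A' z)
    (hm : MapsTo A D' D) (hz : z ∈ D') (e : V') :
    fderivWithin ℝ (fun z => X (A z)) D' z e = fderivWithin ℝ X D (A z) (A' e) := by
  have h := ((hX.differentiableOn (by simp) (A z) (hm hz)).hasFDerivWithinAt).comp z
    hA.hasFDerivWithinAt hm
  exact congrArg (fun B : V' →L[ℝ] ℝ => B e) (h.fderivWithin (hD' z hz))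

theorem mapDeriv_comp {D : Set V} {D' : Set V'} (hD' : UniqueDiffOn ℝ D') {F : V → M}
    (hF : ContMDiffOn 𝓘(ℝ, V) 𝓘(ℝ, E) 1 F D) {φ : V' → V} {z : V'}
    (hφ : DifferentiableWithinAt ℝ φ D' z) (hm : MapsTo φ D' D) (hz : z ∈ D') (e : V') :
    mapDeriv E D' (F ∘ φ) z e = mapDeriv E D F (φ z) (fderivWithin ℝ φ D' z e) := by
  have h := mfderivWithin_comp z (hF.mdifferentiableOn (by simp) (φ z) (hm hz))
    hφ.mdifferentiableWithinAt hm (hD' z hz).uniqueMDiffWithinAt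
  rw [mfderivWithin_eq_fderivWithin] at h
  exact congrArg (fun A : V' →L[ℝ] E => A e) h

end MapDeriv

/-! ### Strips and slices -/

section Slices

theorem uniqueDiffOn_strip : UniqueDiffOn ℝ strip :=
  uniqueDiffOn_univ.prod (uniqueDiffOn_Icc (by norm_num))

theorem uniqueDiffOn_strip' : UniqueDiffOn ℝ strip' :=
  (uniqueDiffOn_Icc (by norm_num)).prod uniqueDiffOn_univ

theorem mem_strip {z : ℝ × ℝ} : z ∈ strip ↔ z.2 ∈ Icc (0 : ℝ) 1 := by simp [strip]

theorem mem_strip' {z : ℝ × ℝ} : z ∈ strip' ↔ z.1 ∈ Icc (0 : ℝ) 1 := by simp [strip']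

/-- The linear part of `(t, τ) ↦ (τ, s, t)`. -/
def stripMap : ℝ × ℝ →L[ℝ] ℝ × ℝ × ℝ :=
  (ContinuousLinearMap.snd ℝ ℝ ℝ).prod ((0 : ℝ × ℝ →L[ℝ] ℝ).prod (ContinuousLinearMap.fst ℝ ℝ ℝ))

/-- The linear part of `(τ, s) ↦ (τ, s, t)`. -/
def stripMap' : ℝ × ℝ →L[ℝ] ℝ × ℝ × ℝ :=
  (ContinuousLinearMap.fst ℝ ℝ ℝ).prod ((ContinuousLinearMap.snd ℝ ℝ ℝ).prod (0 : ℝ × ℝ →L[ℝ] ℝ))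

theorem hasFDerivAt_stripMap (s : ℝ) (z : ℝ × ℝ) :
    HasFDerivAt (fun z : ℝ × ℝ => (z.2, s, z.1)) stripMap z :=
  hasFDerivAt_snd.prodMk ((hasFDerivAt_const s z).prodMk hasFDerivAt_fst)

theorem hasFDerivAt_stripMap' (t : ℝ) (z : ℝ × ℝ) :
    HasFDerivAt (fun z : ℝ × ℝ => (z.1, z.2, t)) stripMap' z :=
  hasFDerivAt_fst.prodMk (hasFDerivAt_snd.prodMk (hasFDerivAt_const t z))

variable {X : ℝ × ℝ × ℝ → ℝ}

theorem fderivWithin_strip (hX : ContDiffOn ℝ 1 X slab) (s : ℝ) {z : ℝ × ℝ} (hz : z ∈ strip)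
    (e : ℝ × ℝ) : fderivWithin ℝ (fun z => X (z.2, s, z.1)) strip z e =
      slabDeriv X (z.2, s, z.1) (stripMap e) :=
  fderivWithin_affine_comp uniqueDiffOn_strip hX (hasFDerivAt_stripMap s z)
    (fun _ hz => mem_slab.2 (mem_strip.1 hz)) hz e

theorem fderivWithin_strip' (hX : ContDiffOn ℝ 1 X slab) (t : ℝ) {z : ℝ × ℝ} (hz : z ∈ strip')
    (e : ℝ × ℝ) : fderivWithin ℝ (fun z => X (z.1, z.2, t)) strip' z e =
      slabDeriv X (z.1, z.2, t) (stripMap' e) :=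
  fderivWithin_affine_comp uniqueDiffOn_strip' hX (hasFDerivAt_stripMap' t z)
    (fun _ hz => mem_slab.2 (mem_strip'.1 hz)) hz e

/-- A function converging uniformly on compact sets as `t → ±∞` is bounded for bounded `s`. -/
theorem exists_bound_of_tendsto_t (hX : ContinuousOn X slab) {Bm Bp : ℝ × ℝ → ℝ}
    (hm : ∀ K : Set (ℝ × ℝ), IsCompact K → K ⊆ strip' →
      TendstoUniformlyOn (fun t z => X (z.1, z.2, t)) Bm atBot K)
    (hp : ∀ K : Set (ℝ × ℝ), IsCompact K → K ⊆ strip' →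
      TendstoUniformlyOn (fun t z => X (z.1, z.2, t)) Bp atTop K) (S : ℝ) :
    ∃ C, ∀ p ∈ slab, |p.2.1| ≤ S → |X p| ≤ C := by
  have hK : IsCompact (Icc (0 : ℝ) 1 ×ˢ Icc (-S) S) := isCompact_Icc.prod isCompact_Icc
  have hKs : Icc (0 : ℝ) 1 ×ˢ Icc (-S) S ⊆ strip' := fun z hz => mem_strip'.2 hz.1
  obtain ⟨a, ha⟩ := eventually_atBot.1 (Metric.tendstoUniformlyOn_iff.1 (hm _ hK hKs) 1 one_pos)
  obtain ⟨b, hb⟩ := eventually_atTop.1 (Metric.tendstoUniformlyOn_iff.1 (hp _ hK hKs) 1 one_pos)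
  have hc : IsCompact (Icc (0 : ℝ) 1 ×ˢ (Icc (-S) S ×ˢ Icc (min a b) (max a b))) :=
    isCompact_Icc.prod (isCompact_Icc.prod isCompact_Icc)
  obtain ⟨C, hC⟩ := hc.exists_bound_of_continuousOn (hX.mono fun p hp => mem_slab.2 hp.1)
  refine ⟨C + 2, fun p hp hs => ?_⟩
  obtain ⟨τ, s, t⟩ := p
  have hz : (τ, s) ∈ Icc (0 : ℝ) 1 ×ˢ Icc (-S) S := ⟨mem_slab.1 hp, abs_le.1 hs⟩
  -- Far out, the value is within `1` of the limit, and so is the value at the threshold `t₀`, which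
  -- lies in the compact region; hence the constant `C + 2`. The limit itself need not be bounded in
  -- advance.
  have key : ∀ {B : ℝ} {t₀ : ℝ}, t₀ ∈ Icc (min a b) (max a b) → dist B (X (τ, s, t)) < 1 →
      dist B (X (τ, s, t₀)) < 1 → |X (τ, s, t)| ≤ C + 2 := fun {B t₀} h₀ h1 h2 => by
    have h3 : |X (τ, s, t₀)| ≤ C := hC (τ, s, t₀) ⟨hz.1, hz.2, h₀⟩
    rw [Real.dist_eq] at h1 h2
    rw [abs_lt] at h1 h2
    rw [abs_le] at h3 ⊢
    constructor <;> linarith [h1.1, h1.2, h2.1, h2.2, h3.1, h3.2]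
  rcases le_total t a with h | h
  · exact key ⟨min_le_left _ _, le_max_left _ _⟩ (ha t h _ hz) (ha a le_rfl _ hz)
  rcases le_total b t with h' | h'
  · exact key ⟨min_le_right _ _, le_max_right _ _⟩ (hb t h' _ hz) (hb b le_rfl _ hz)
  · exact (hC (τ, s, t) ⟨hz.1, hz.2, (min_le_left _ _).trans h, h'.trans (le_max_right _ _)⟩).trans
      (by linarith)

/-- A function that is bounded for bounded `s` and converges uniformly as `s → ±∞` is bounded. -/
theorem exists_bound_of_tendsto_s {P : ℝ → Prop}
    (hX : ∀ S : ℝ, ∃ C, ∀ p ∈ slab, |p.2.1| ≤ S → P p.2.2 → |X p| ≤ C) {Am Ap : ℝ × ℝ → ℝ}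
    (hm : TendstoUniformlyOn (fun s z => X (z.2, s, z.1)) Am atBot strip)
    (hp : TendstoUniformlyOn (fun s z => X (z.2, s, z.1)) Ap atTop strip) :
    ∃ C, ∀ p ∈ slab, P p.2.2 → |X p| ≤ C := by
  obtain ⟨a, ha⟩ := eventually_atBot.1 (Metric.tendstoUniformlyOn_iff.1 hm 1 one_pos)
  obtain ⟨b, hb⟩ := eventually_atTop.1 (Metric.tendstoUniformlyOn_iff.1 hp 1 one_pos)
  obtain ⟨C, hC⟩ := hX (max |a| |b|)
  refine ⟨C + 2, fun p hp hP => ?_⟩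
  obtain ⟨τ, s, t⟩ := p
  have hz : (t, τ) ∈ strip := mem_strip.2 (mem_slab.1 hp)
  have key : ∀ {B : ℝ} {s₀ : ℝ}, |s₀| ≤ max |a| |b| → dist B (X (τ, s, t)) < 1 →
      dist B (X (τ, s₀, t)) < 1 → |X (τ, s, t)| ≤ C + 2 := fun {B s₀} h₀ h1 h2 => by
    have h3 : |X (τ, s₀, t)| ≤ C := hC (τ, s₀, t) (mem_slab.2 (mem_slab.1 hp)) h₀ hP
    rw [Real.dist_eq] at h1 h2
    rw [abs_lt] at h1 h2
    rw [abs_le] at h3 ⊢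
    constructor <;> linarith [h1.1, h1.2, h2.1, h2.2, h3.1, h3.2]
  rcases le_total s a with h | h
  · exact key (le_max_left _ _) (ha s h _ hz) (ha a le_rfl _ hz)
  rcases le_total b s with h' | h'
  · exact key (le_max_right _ _) (hb s h' _ hz) (hb b le_rfl _ hz)
  · exact (hC (τ, s, t) hp (abs_le_max_abs_abs h h') hP).trans (by linarith)

end Slices

/-! ### Bounds for maps with asymptotics -/

section Bounds

theorem _root_.TendstoUniformlyOn.clm_apply_const {ι X : Type*} {l : Filter ι} {s : Set X}
    {V : Type*} [NormedAddCommGroup V] [NormedSpace ℝ V] {A : ι → X → V →L[ℝ] ℝ}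
    {B : X → V →L[ℝ] ℝ} (h : TendstoUniformlyOn A B l s) (e : V) :
    TendstoUniformlyOn (fun i x => A i x e) (fun x => B x e) l s :=
  (ContinuousLinearMap.apply ℝ ℝ e).uniformContinuous.comp_tendstoUniformlyOn h

variable {F : ℝ × ℝ × ℝ → M} {Am Ap Bm Bp : ℝ × ℝ → M} {f : M → ℝ}

/-- Convergence as `s → ±∞` controls only the derivatives in `t` and `τ`, the directions in the
range of `stripMap`; its companion for `t → ±∞` controls those in `τ` and `s`. -/
theorem tendsto_slabDeriv_strip {l : Filter ℝ} {A : ℝ × ℝ → M}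
    (hf : ContMDiff 𝓘(ℝ, E) 𝓘(ℝ, ℝ) ∞ f) (hF : ContDiffOn ℝ 1 (f ∘ F) slab)
    (h : TendstoC1 E l (fun s z => F (z.2, s, z.1)) A strip strip) (e : ℝ × ℝ) :
    TendstoUniformlyOn (fun s z => slabDeriv (f ∘ F) (z.2, s, z.1) (stripMap e))
      (fun z => fderivWithin ℝ (f ∘ A) strip z e) l strip :=
  ((h f hf).2.clm_apply_const e).congr (Eventually.of_forall fun s _ hz =>
    fderivWithin_strip hF s hz e)

theorem tendsto_slabDeriv_strip' {l : Filter ℝ} {B : ℝ × ℝ → M} {K : Set (ℝ × ℝ)}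
    (hK : K ⊆ strip')
    (hf : ContMDiff 𝓘(ℝ, E) 𝓘(ℝ, ℝ) ∞ f) (hF : ContDiffOn ℝ 1 (f ∘ F) slab)
    (h : TendstoC1 E l (fun t z => F (z.1, z.2, t)) B strip' K) (e : ℝ × ℝ) :
    TendstoUniformlyOn (fun t z => slabDeriv (f ∘ F) (z.1, z.2, t) (stripMap' e))
      (fun z => fderivWithin ℝ (f ∘ B) strip' z e) l K :=
  ((h f hf).2.clm_apply_const e).congr (Eventually.of_forall fun t _ hz =>
    fderivWithin_strip' hF t (hK hz) e)

variable (hF : ContMDiffOn 𝓘(ℝ, ℝ × ℝ × ℝ) 𝓘(ℝ, E) 1 F slab)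
  (hA : HasAsymptotics E F Am Ap Bm Bp) (hf : ContMDiff 𝓘(ℝ, E) 𝓘(ℝ, ℝ) ∞ f)
include hF hA hf

theorem HasAsymptotics.exists_bound_comp : ∃ C, ∀ p ∈ slab, |f (F p)| ≤ C := by
  obtain ⟨C, hC⟩ := exists_bound_of_tendsto_s (X := f ∘ F) (P := fun _ => True) (fun S =>
    (exists_bound_of_tendsto_t (contDiffOn_smooth_comp one_le_infty hF hf).continuousOn
      (fun K hK hKs => (hA.t_bot K hK hKs f hf).1)
      (fun K hK hKs => (hA.t_top K hK hKs f hf).1) S).imp fun C hC p hp hs _ => hC p hp hs)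
    (hA.s_bot f hf).1 (hA.s_top f hf).1
  exact ⟨C, fun p hp => hC p hp trivial⟩

theorem HasAsymptotics.exists_bound_deriv_near {e : ℝ × ℝ} (S : ℝ) :
    ∃ C, ∀ p ∈ slab, |p.2.1| ≤ S → |slabDeriv (f ∘ F) p (stripMap' e)| ≤ C :=
  have hc := contDiffOn_smooth_comp one_le_infty hF hf
  exists_bound_of_tendsto_t (X := fun p => slabDeriv (f ∘ F) p (stripMap' e))
    ((continuousOn_slabDeriv hc).clm_apply continuousOn_const)
    (fun K hK hKs => tendsto_slabDeriv_strip' hKs hf hc (hA.t_bot K hK hKs) e)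
    (fun K hK hKs => tendsto_slabDeriv_strip' hKs hf hc (hA.t_top K hK hKs) e) S

/-- The direction `τ` is tangent to both families of limiting strips, so it is the one derivative
bounded on the whole slab by the asymptotics alone. -/
theorem HasAsymptotics.exists_bound_deriv_τ :
    ∃ C, ∀ p ∈ slab, |slabDeriv (f ∘ F) p eτ| ≤ C := by
  have hc := contDiffOn_smooth_comp one_le_infty hF hf
  obtain ⟨C, hC⟩ := exists_bound_of_tendsto_s (X := fun p => slabDeriv (f ∘ F) p eτ)
    (P := fun _ => True) (fun S =>
    (hA.exists_bound_deriv_near hF hf (e := (1, 0)) S).imp fun C hC p hp hs _ => hC p hp hs)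
    (tendsto_slabDeriv_strip hf hc hA.s_bot (0, 1)) (tendsto_slabDeriv_strip hf hc hA.s_top (0, 1))
  exact ⟨C, fun p hp => hC p hp trivial⟩

/-- Large `|s|` is handled by the asymptotics, so only bounded `s` remains. The condition `P` is
`|t| ≤ T` for general maps, and is vacuous for Fueter strips, whose equation supplies the missing
bound. -/
theorem HasAsymptotics.exists_bound_deriv_t_of {P : ℝ → Prop}
    (h : ∀ S : ℝ, ∃ C, ∀ p ∈ slab, |p.2.1| ≤ S → P p.2.2 → |slabDeriv (f ∘ F) p et| ≤ C) :
    ∃ C, ∀ p ∈ slab, P p.2.2 → |slabDeriv (f ∘ F) p et| ≤ C :=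
  have hc := contDiffOn_smooth_comp one_le_infty hF hf
  exists_bound_of_tendsto_s (X := fun p => slabDeriv (f ∘ F) p et) h
    (tendsto_slabDeriv_strip hf hc hA.s_bot (1, 0)) (tendsto_slabDeriv_strip hf hc hA.s_top (1, 0))

theorem HasAsymptotics.exists_bound_deriv_t (T : ℝ) :
    ∃ C, ∀ p ∈ slab, |p.2.2| ≤ T → |slabDeriv (f ∘ F) p et| ≤ C := by
  have hc := contDiffOn_smooth_comp one_le_infty hF hf
  refine hA.exists_bound_deriv_t_of hF hf (P := fun t => |t| ≤ T) fun S => ?_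
  have hK : IsCompact (Icc (0 : ℝ) 1 ×ˢ (Icc (-S) S ×ˢ Icc (-T) T)) :=
    isCompact_Icc.prod (isCompact_Icc.prod isCompact_Icc)
  obtain ⟨C, hC⟩ := hK.exists_bound_of_continuousOn (f := fun p => slabDeriv (f ∘ F) p et)
    (((continuousOn_slabDeriv hc).clm_apply continuousOn_const).mono fun p hp => mem_slab.2 hp.1)
  exact ⟨C, fun p hp hs ht => hC p ⟨mem_slab.1 hp, abs_le.1 hs, abs_le.1 ht⟩⟩

end Bounds

/-! ### Relative compactness of images -/

section CompactImage

variable {F : ℝ × ℝ × ℝ → M} {Am Ap Bm Bp : ℝ × ℝ → M}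

variable [FiniteDimensional ℝ E] [T2Space M] [SecondCountableTopology M]
  [IsManifold 𝓘(ℝ, E) ∞ M]

/-- A map with asymptotics and its limits have relatively compact image. -/
theorem HasAsymptotics.exists_compact (hF : ContMDiffOn 𝓘(ℝ, ℝ × ℝ × ℝ) 𝓘(ℝ, E) 1 F slab)
    (hA : HasAsymptotics E F Am Ap Bm Bp) :
    ∃ K : Set M, IsCompact K ∧ MapsTo F slab K ∧ MapsTo Am strip K ∧ MapsTo Ap strip K := by
  obtain ⟨f, hf, hK⟩ := exists_smooth_exhaustion E (M := M)
  obtain ⟨C, hC⟩ := hA.exists_bound_comp hF hf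
  obtain ⟨K, hK, hKf⟩ := hK C
  -- The bound on the exhaustion function passes to pointwise limits, so the asymptotic maps lie in
  -- the same sublevel set.
  have hlim : ∀ {l : Filter ℝ} [l.NeBot] {A : ℝ × ℝ → M},
      TendstoC1 E l (fun s z => F (z.2, s, z.1)) A strip strip → MapsTo A strip K :=
    fun {l _ A} h z hz => hKf _ (le_of_tendsto ((h f hf).1.tendsto_at hz)
      (Eventually.of_forall fun s =>
        (le_abs_self _).trans (hC (z.2, s, z.1) (mem_slab.2 (mem_strip.1 hz)))))
  exact ⟨K, hK, fun p hp => hKf _ ((le_abs_self _).trans (hC p hp)), hlim hA.s_bot, hlim hA.s_top⟩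

end CompactImage

end

section

variable {E : Type u} [NormedAddCommGroup E] [NormedSpace ℝ E]
variable {M : Type v} [TopologicalSpace M] [ChartedSpace E M]

/-! ### Forms along maps -/

section Evaluation

/-- The value of a one-form on a vector. -/
def DForm.ev₁ (α : DForm E M ℝ 1) (x : M) (v : E) : ℝ := α x ![v]

/-- The value of a two-form on two vectors. -/
def DForm.ev₂ (σ : DForm E M ℝ 2) (x : M) (v w : E) : ℝ := σ x ![v, w]

theorem DForm.ev₂_swap (σ : DForm E M ℝ 2) (x : M) (v w : E) : σ.ev₂ x w v = -σ.ev₂ x v w :=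
  twoForm_swap (E := E) (σ x) v w

theorem DForm.ev₂_self (σ : DForm E M ℝ 2) (x : M) (v : E) : σ.ev₂ x v v = 0 :=
  twoForm_self (E := E) (σ x) v

theorem DForm.ev₂_zero_left (σ : DForm E M ℝ 2) (x : M) (w : E) : σ.ev₂ x 0 w = 0 :=
  (σ x).map_coord_zero (m := ![(0 : E), w]) 0 rfl

theorem VanishesAlong.ev₁_eq_zero {α : DForm E M ℝ 1} {A : ℝ × ℝ → M} (h : VanishesAlong α A)
    {z : ℝ × ℝ} (hz : z ∈ strip) (u : ℝ × ℝ) : α.ev₁ (A z) (mapDeriv E strip A z u) = 0 := by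
  refine (congrArg (α (A z)) (funext fun i => ?_)).trans
    (congrArg (fun β : (ℝ × ℝ) [⋀^Fin 1]→L[ℝ] ℝ => β ![u]) (h z hz))
  fin_cases i
  rfl

theorem VanishesAlong.ev₂_eq_zero {σ : DForm E M ℝ 2} {A : ℝ × ℝ → M} (h : VanishesAlong σ A)
    {z : ℝ × ℝ} (hz : z ∈ strip) (u v : ℝ × ℝ) :
    σ.ev₂ (A z) (mapDeriv E strip A z u) (mapDeriv E strip A z v) = 0 := by
  refine (congrArg (σ (A z)) (funext fun i => ?_)).trans
    (congrArg (fun β : (ℝ × ℝ) [⋀^Fin 2]→L[ℝ] ℝ => β ![u, v]) (h z hz))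
  fin_cases i <;> rfl

variable {um up a : ℝ × ℝ → M} {pm pp : M}

theorem IsMapInto.contMDiffOn (hm : ContMDiffOn 𝓘(ℝ, ℝ × ℝ) 𝓘(ℝ, E) 1 um strip)
    (hp : ContMDiffOn 𝓘(ℝ, ℝ × ℝ) 𝓘(ℝ, E) 1 up strip)
    (h : IsMapInto um up pm pp strip a) : ContMDiffOn 𝓘(ℝ, ℝ × ℝ) 𝓘(ℝ, E) 1 a strip := by
  rcases h with ⟨φ, hφ, hφs, h | h⟩ | h | h
  · exact (hm.comp hφ.contMDiffOn hφs).congr h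
  · exact (hp.comp hφ.contMDiffOn hφs).congr h
  · exact contMDiffOn_const.congr h
  · exact contMDiffOn_const.congr h

theorem mapDeriv_congr {V : Type*} [NormedAddCommGroup V] [NormedSpace ℝ V] {D : Set V}
    {F F' : V → M} (h : EqOn F F' D) {p : V} (hp : p ∈ D) :
    mapDeriv E D F p = mapDeriv E D F' p :=
  mfderivWithin_congr_of_mem h hp

theorem mapDeriv_const {V : Type*} [NormedAddCommGroup V] [NormedSpace ℝ V] {D : Set V}
    (x : M) (p : V) : mapDeriv E D (fun _ => x) p = 0 :=
  mfderivWithin_const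

/-- A two-form that vanishes along `u₋` and `u₊` vanishes along maps into their union. -/
theorem IsMapInto.ev₂_eq_zero (hm : ContMDiffOn 𝓘(ℝ, ℝ × ℝ) 𝓘(ℝ, E) 1 um strip)
    (hp : ContMDiffOn 𝓘(ℝ, ℝ × ℝ) 𝓘(ℝ, E) 1 up strip)
    (h : IsMapInto um up pm pp strip a) {σ : DForm E M ℝ 2} (hσm : VanishesAlong σ um)
    (hσp : VanishesAlong σ up) {z : ℝ × ℝ} (hz : z ∈ strip) (u v : ℝ × ℝ) :
    σ.ev₂ (a z) (mapDeriv E strip a z u) (mapDeriv E strip a z v) = 0 := by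
  have comp : ∀ {w : ℝ × ℝ → M} {φ : ℝ × ℝ → ℝ × ℝ},
      ContMDiffOn 𝓘(ℝ, ℝ × ℝ) 𝓘(ℝ, E) 1 w strip → VanishesAlong σ w → ContDiffOn ℝ 1 φ strip →
      MapsTo φ strip strip → EqOn a (w ∘ φ) strip →
      σ.ev₂ (a z) (mapDeriv E strip a z u) (mapDeriv E strip a z v) = 0 :=
    fun {w φ} hw hσ hφ hφs h => by
      rw [mapDeriv_congr h hz, h hz,
        mapDeriv_comp uniqueDiffOn_strip hw (hφ.differentiableOn (by simp) z hz) hφs hz,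
        mapDeriv_comp uniqueDiffOn_strip hw (hφ.differentiableOn (by simp) z hz) hφs hz]
      exact hσ.ev₂_eq_zero (hφs hz) _ _
  rcases h with ⟨φ, hφ, hφs, h | h⟩ | h | h
  · exact comp hm hσm hφ hφs h
  · exact comp hp hσp hφ hφs h
  · rw [mapDeriv_congr h hz, mapDeriv_const]
    exact σ.ev₂_zero_left _ _
  · rw [mapDeriv_congr h hz, mapDeriv_const]
    exact σ.ev₂_zero_left _ _

end Evaluation

/-! ### Pull-backs of two-forms to the slab -/

section FormOn

/-- The pull-back of a two-form under a map from the slab. -/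
def formOn (σ : DForm E M ℝ 2) (F : ℝ × ℝ × ℝ → M) (p u v : ℝ × ℝ × ℝ) : ℝ :=
  σ.ev₂ (F p) (mapDeriv E slab F p u) (mapDeriv E slab F p v)

theorem formOn_swap (σ : DForm E M ℝ 2) (F : ℝ × ℝ × ℝ → M) (p u v : ℝ × ℝ × ℝ) :
    formOn σ F p v u = -formOn σ F p u v := σ.ev₂_swap _ _ _

/-- The slice is defined on the whole plane, so its full derivative exists even at `τ = 0, 1` and is
the tangential part of the derivative within the slab. -/
theorem pullback_slice {F : ℝ × ℝ × ℝ → M} (hF : ContMDiffOn 𝓘(ℝ, ℝ × ℝ × ℝ) 𝓘(ℝ, E) 1 F slab)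
    (σ : DForm E M ℝ 2) {τ : ℝ} (hτ : τ ∈ Icc (0 : ℝ) 1) (z : ℝ × ℝ) :
    pullback (slice F τ) σ z = formOn σ F (τ, z) es et := by
  have hd : HasFDerivAt (fun z : ℝ × ℝ => (τ, z)) (ContinuousLinearMap.inr ℝ ℝ (ℝ × ℝ)) z :=
    (hasFDerivAt_const τ z).prodMk (hasFDerivAt_id z)
  have h : ∀ e : ℝ × ℝ, mapDeriv E univ (slice F τ) z e = mapDeriv E slab F (τ, z) (0, e) :=
    fun e => by
      have := mapDeriv_comp (E := E) uniqueDiffOn_univ hF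
        hd.differentiableAt.differentiableWithinAt
        (fun z _ => mem_slab.2 hτ : MapsTo (fun z : ℝ × ℝ => (τ, z)) univ slab) (mem_univ z) e
      rw [fderivWithin_univ, hd.fderiv] at this
      exact this
  have h' : ∀ e : ℝ × ℝ, mfderiv 𝓘(ℝ, ℝ × ℝ) 𝓘(ℝ, E) (slice F τ) z e =
      mapDeriv E slab F (τ, z) (0, e) := fun e => by
    rw [← h, ← mfderivWithin_univ]; rfl
  unfold pullback
  rw [h', h']
  rfl

variable {F : ℝ × ℝ × ℝ → M} {σ : DForm E M ℝ 2} {ι : Type*} [Fintype ι] {h f k : ι → M → ℝ}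

theorem formOn_eq_slabForm (hF : ContMDiffOn 𝓘(ℝ, ℝ × ℝ × ℝ) 𝓘(ℝ, E) 1 F slab)
    (hf : ∀ i, ContMDiff 𝓘(ℝ, E) 𝓘(ℝ, ℝ) ∞ (f i)) (hk : ∀ i, ContMDiff 𝓘(ℝ, E) 𝓘(ℝ, ℝ) ∞ (k i))
    {p : ℝ × ℝ × ℝ} (hp : p ∈ slab)
    (hσ : ∀ v w : E, σ (F p) ![v, w] = ∑ i, h i (F p) *
      (diff (f i) (F p) v * diff (k i) (F p) w - diff (f i) (F p) w * diff (k i) (F p) v))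
    (u v : ℝ × ℝ × ℝ) :
    formOn σ F p u v =
      slabForm (fun i => h i ∘ F) (fun i => f i ∘ F) (fun i => k i ∘ F) p u v := by
  simp only [formOn, DForm.ev₂, hσ, slabForm, jac, slabDeriv,
    fderivWithin_smooth_comp uniqueDiffOn_slab hF (hf _) hp,
    fderivWithin_smooth_comp uniqueDiffOn_slab hF (hk _) hp, Function.comp_apply]

end FormOn

/-! ### Integrability and Stokes' theorem for forms along maps with asymptotics -/

section Stokes

variable [FiniteDimensional ℝ E] [T2Space M] [SecondCountableTopology M]
  [IsManifold 𝓘(ℝ, E) ∞ M]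
variable (g : Metric E M) {F : ℝ × ℝ × ℝ → M} {Am Ap Bm Bp : ℝ × ℝ → M} {σ : DForm E M ℝ 2}

theorem abs_mul_jac_le {a A B C : ℝ} {V : Type*} [NormedAddCommGroup V] [NormedSpace ℝ V]
    {b c : V →L[ℝ] ℝ} {v w : V} {l : ℝ} (ha : |a| ≤ A) (hbv : |b v| ≤ B) (hcv : |c v| ≤ B)
    (hbw : |b w| ≤ C * l) (hcw : |c w| ≤ C * l) : |a * jac b c v w| ≤ A * (2 * B * C) * l := by
  have hB := (abs_nonneg _).trans hbv
  have hA := (abs_nonneg _).trans ha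
  have h : |jac b c v w| ≤ 2 * B * C * l := by
    refine (abs_sub _ _).trans ?_
    rw [abs_mul, abs_mul]
    have h1 := mul_le_mul hbv hcw (abs_nonneg _) hB
    have h2 := mul_le_mul hbw hcv (abs_nonneg _) ((abs_nonneg _).trans hbw)
    linarith
  rw [abs_mul, mul_assoc]
  exact mul_le_mul ha h (abs_nonneg _) hA

variable (hF : ContMDiffOn 𝓘(ℝ, ℝ × ℝ × ℝ) 𝓘(ℝ, E) 1 F slab)
include hF

theorem exists_bound_ds {K : Set M} (hK : IsCompact K) (hFK : MapsTo F slab K) {f : M → ℝ}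
    (hf : ContMDiff 𝓘(ℝ, E) 𝓘(ℝ, ℝ) ∞ f) :
    ∃ C, 0 ≤ C ∧ ∀ p ∈ slab, |slabDeriv (f ∘ F) p es| ≤ C * g.len (F p) (ds E F p) := by
  obtain ⟨C, hC0, hC⟩ := g.exists_diff_le hK hf
  refine ⟨C, hC0, fun p hp => ?_⟩
  rw [slabDeriv, fderivWithin_smooth_comp uniqueDiffOn_slab hF hf hp]
  exact hC _ (hFK hp) _

variable (hA : HasAsymptotics E F Am Ap Bm Bp) (hσ : σ.IsSmooth)
include g hA hσ

theorem HasAsymptotics.continuousOn_formOn (u v : ℝ × ℝ × ℝ) :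
    ContinuousOn (fun p => formOn σ F p u v) slab := by
  obtain ⟨K, hK, hFK, -, -⟩ := hA.exists_compact hF
  obtain ⟨ι, _, h, f, k, hh, hf, hk, hexp⟩ := hσ.exists_expansion_two g hK
  have c := fun {f : M → ℝ} (hf : ContMDiff 𝓘(ℝ, E) 𝓘(ℝ, ℝ) ∞ f) =>
    contDiffOn_smooth_comp one_le_infty hF hf
  exact (continuousOn_slabForm (fun i => c (hh i)) (fun i => c (hf i)) (fun i => c (hk i))
    u v).congr fun p hp => formOn_eq_slabForm hF hf hk hp
      (hexp.self_of_nhdsSet _ (hFK hp)) u v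

/-- In each minor one column is bounded and the other is dominated by `|∂_s F|`. It is used with `e
= eτ` for all maps with asymptotics and with `e = et` for Fueter strips. -/
theorem HasAsymptotics.exists_bound_formOn {e : ℝ × ℝ × ℝ}
    (he : ∀ f : M → ℝ, ContMDiff 𝓘(ℝ, E) 𝓘(ℝ, ℝ) ∞ f →
      ∃ C, ∀ p ∈ slab, |slabDeriv (f ∘ F) p e| ≤ C) :
    ∃ C, ∀ p ∈ slab, |formOn σ F p e es| ≤ C * g.len (F p) (ds E F p) := by
  obtain ⟨K, hK, hFK, -, -⟩ := hA.exists_compact hF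
  obtain ⟨ι, _, h, f, k, hh, hf, hk, hexp⟩ := hσ.exists_expansion_two g hK
  choose A hA' using fun i => hA.exists_bound_comp hF (hh i)
  choose B hB using fun i => he _ (hf i)
  choose B' hB' using fun i => he _ (hk i)
  choose C hC0 hC using fun i => exists_bound_ds g hF hK hFK (hf i)
  choose C' hC0' hC' using fun i => exists_bound_ds g hF hK hFK (hk i)
  refine ⟨∑ i, A i * (2 * max (B i) (B' i) * max (C i) (C' i)), fun p hp => ?_⟩
  rw [formOn_eq_slabForm hF hf hk hp (hexp.self_of_nhdsSet _ (hFK hp)), Finset.sum_mul]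
  refine (Finset.abs_sum_le_sum_abs _ _).trans (Finset.sum_le_sum fun i _ => ?_)
  have hl := g.len_nonneg (F p) (ds E F p)
  exact abs_mul_jac_le (hA' i p hp) ((hB i p hp).trans (le_max_left _ _))
    ((hB' i p hp).trans (le_max_right _ _))
    ((hC i p hp).trans (mul_le_mul_of_nonneg_right (le_max_left _ _) hl))
    ((hC' i p hp).trans (mul_le_mul_of_nonneg_right (le_max_right _ _) hl))

theorem HasAsymptotics.integrableOn_formOn {e : ℝ × ℝ × ℝ}
    (he : ∀ f : M → ℝ, ContMDiff 𝓘(ℝ, E) 𝓘(ℝ, ℝ) ∞ f →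
      ∃ C, ∀ p ∈ slab, |slabDeriv (f ∘ F) p e| ≤ C)
    (hL1 : IntegrableOn (fun p => g.len (F p) (ds E F p)) slab) :
    IntegrableOn (fun p => formOn σ F p e es) slab := by
  have hs : MeasurableSet slab := measurableSet_Icc.prod MeasurableSet.univ
  obtain ⟨C, hC⟩ := hA.exists_bound_formOn g hF hσ he
  exact (hL1.const_mul C).mono'
    ((hA.continuousOn_formOn g hF hσ e es).aestronglyMeasurable hs)
    (ae_restrict_of_forall_mem hs hC)

/-- Stokes' theorem for a closed form that vanishes along the asymptotic maps `A₋`, `A₊`. -/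
theorem HasAsymptotics.stokes (hσc : σ.IsClosed)
    (hAm : ContMDiffOn 𝓘(ℝ, ℝ × ℝ) 𝓘(ℝ, E) 1 Am strip)
    (hAp : ContMDiffOn 𝓘(ℝ, ℝ × ℝ) 𝓘(ℝ, E) 1 Ap strip)
    (hvm : ∀ z ∈ strip, ∀ u v,
      σ.ev₂ (Am z) (mapDeriv E strip Am z u) (mapDeriv E strip Am z v) = 0)
    (hvp : ∀ z ∈ strip, ∀ u v,
      σ.ev₂ (Ap z) (mapDeriv E strip Ap z u) (mapDeriv E strip Ap z v) = 0)
    (hL1 : IntegrableOn (fun p => g.len (F p) (ds E F p)) slab) {a b : ℝ} (ha : 0 ≤ a)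
    (hab : a ≤ b) (hb : b ≤ 1) (hib : Integrable fun z => formOn σ F (b, z) es et)
    (hia : Integrable fun z => formOn σ F (a, z) es et) {c : ℝ → ℝ} (hc : ContDiff ℝ 1 c)
    (hcs : HasCompactSupport c) :
    ∫ p in Icc a b ×ˢ (univ : Set (ℝ × ℝ)), deriv c p.2.2 * formOn σ F p eτ es =
      (∫ z : ℝ × ℝ, c z.2 * formOn σ F (b, z) es et) -
        ∫ z : ℝ × ℝ, c z.2 * formOn σ F (a, z) es et := by
  have hsub : Icc a b ×ˢ (univ : Set (ℝ × ℝ)) ⊆ slab :=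
    fun p hp => mem_slab.2 ⟨ha.trans hp.1.1, hp.1.2.trans hb⟩
  obtain ⟨K, hK, hFK, hmK, hpK⟩ := hA.exists_compact hF
  obtain ⟨ι, _, h, f, k, hh, hf, hk, hexp⟩ := hσ.exists_expansion_two g hK
  have ct := fun {f : M → ℝ} (hf : ContMDiff 𝓘(ℝ, E) 𝓘(ℝ, ℝ) ∞ f) =>
    contDiffOn_smooth_comp one_le_infty hF hf
  have eq : ∀ p ∈ slab, ∀ u v, formOn σ F p u v =
      slabForm (fun i => h i ∘ F) (fun i => f i ∘ F) (fun i => k i ∘ F) p u v :=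
    fun p hp => formOn_eq_slabForm hF hf hk hp (hexp.self_of_nhdsSet _ (hFK hp))
  -- Closedness is used on `M`, where the expansion holds in a neighbourhood, and then pulled back;
  -- this is why first derivatives of `F` are enough.
  have hd : ∀ p ∈ slab, ∑ i, det3 (slabDeriv (h i ∘ F) p) (slabDeriv (f i ∘ F) p)
      (slabDeriv (k i ∘ F) p) eτ es et = 0 := fun p hp => by
    have := hσc.expansion_two hσ hh hf hk (eventually_nhdsSet_iff_forall.1 hexp (F p) (hFK hp))
      (mapDeriv E slab F p eτ) (mapDeriv E slab F p es) (mapDeriv E slab F p et)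
    rw [← this]
    simp only [det3, slabDeriv, fderivWithin_smooth_comp uniqueDiffOn_slab hF (hh _) hp,
      fderivWithin_smooth_comp uniqueDiffOn_slab hF (hf _) hp,
      fderivWithin_smooth_comp uniqueDiffOn_slab hF (hk _) hp]
  have lim : ∀ {l : Filter ℝ} {A : ℝ × ℝ → M},
      TendstoC1 E l (fun s z => F (z.2, s, z.1)) A strip strip →
      ContMDiffOn 𝓘(ℝ, ℝ × ℝ) 𝓘(ℝ, E) 1 A strip → MapsTo A strip K →
      (∀ z ∈ strip, ∀ u v, σ.ev₂ (A z) (mapDeriv E strip A z u) (mapDeriv E strip A z v) = 0) →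
      ∀ τ ∈ Icc (0 : ℝ) 1, ∀ t, Tendsto (fun s => formOn σ F (τ, s, t) et eτ) l (𝓝 0) :=
    fun {l A} hl hAc hAK hv τ hτ t => by
      have hz : (t, τ) ∈ strip := mem_strip.2 hτ
      have e := hv (t, τ) hz (1, 0) (0, 1)
      rw [DForm.ev₂, hexp.self_of_nhdsSet _ (hAK hz)] at e
      simp only [eq _ (mem_slab.2 hτ : (τ, _, t) ∈ slab)]
      rw [← e]
      refine tendsto_finsetSum _ fun i _ => ((hl _ (hh i)).1.tendsto_at hz).mul ?_
      have d : ∀ {f : M → ℝ}, ContMDiff 𝓘(ℝ, E) 𝓘(ℝ, ℝ) ∞ f → ∀ e,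
          Tendsto (fun s => slabDeriv (f ∘ F) (τ, s, t) (stripMap e)) l
            (𝓝 (diff f (A (t, τ)) (mapDeriv E strip A (t, τ) e))) := fun hf e => by
        rw [← fderivWithin_smooth_comp uniqueDiffOn_strip hAc hf hz]
        exact (tendsto_slabDeriv_strip hf (ct hf) hl e).tendsto_at hz
      exact ((d (hf i) (1, 0)).mul (d (hk i) (0, 1))).sub ((d (hf i) (0, 1)).mul (d (hk i) (1, 0)))
  refine stokes_slab_limit (hA.continuousOn_formOn g hF hσ et eτ)
    (hA.continuousOn_formOn g hF hσ eτ es) (wst := fun p => formOn σ F p es et) ha hb ?_ ?_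
    (lim hA.s_bot hAm hmK hvm) (lim hA.s_top hAp hpK hvp) hib hia
    ((hA.integrableOn_formOn g hF hσ (fun f hf => hA.exists_bound_deriv_τ hF hf) hL1).mono_set hsub)
    hc hcs
  · intro χ hχ hχs
    have st := stokes_slabForm (fun i => ct (hh i)) (fun i => ct (hf i)) (fun i => ct (hk i)) hd
      hχ hχs ha hab hb
    have hb' : ∀ z : ℝ × ℝ, (b, z) ∈ slab := fun z => mem_slab.2 ⟨ha.trans hab, hb⟩
    have ha' : ∀ z : ℝ × ℝ, (a, z) ∈ slab := fun z => mem_slab.2 ⟨ha, hab.trans hb⟩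
    simp only [eq _ (hb' _), eq _ (ha' _)]
    rw [← st]
    exact setIntegral_congr_fun (measurableSet_Icc.prod MeasurableSet.univ) fun p hp => by
      simp only [eq _ (hsub hp)]
  · intro T
    choose A hA' using fun i => hA.exists_bound_comp hF (hh i)
    choose B hB using fun i => hA.exists_bound_deriv_τ hF (hf i)
    choose B' hB' using fun i => hA.exists_bound_deriv_τ hF (hk i)
    choose C hC using fun i => hA.exists_bound_deriv_t hF (hf i) T
    choose C' hC' using fun i => hA.exists_bound_deriv_t hF (hk i) T
    -- The final factor is the `l` of `abs_mul_jac_le`: the second direction is `t`, whose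
    -- derivative is here bounded by a constant.
    refine ⟨∑ i, A i * (2 * max (B i) (B' i) * max (C i) (C' i)) * 1, fun p hp ht => ?_⟩
    rw [formOn_swap, abs_neg, eq p hp]
    refine (Finset.abs_sum_le_sum_abs _ _).trans (Finset.sum_le_sum fun i _ => ?_)
    refine abs_mul_jac_le (hA' i p hp) ((hB i p hp).trans (le_max_left _ _))
      ((hB' i p hp).trans (le_max_right _ _)) ?_ ?_
    · rw [mul_one]; exact (hC i p hp ht).trans (le_max_left _ _)
    · rw [mul_one]; exact (hC' i p hp ht).trans (le_max_right _ _)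

end Stokes

end

section

variable {E : Type u} [NormedAddCommGroup E] [NormedSpace ℝ E]
variable {M : Type v} [TopologicalSpace M] [ChartedSpace E M]

/-! ### Real and imaginary parts of complex forms -/

section ComplexForms

variable {η : DForm E M ℂ 2}

/-- The composition of a complex form with a real-linear functional. -/
def DForm.compLinear (L : ℂ →L[ℝ] ℝ) (η : DForm E M ℂ 2) : DForm E M ℝ 2 :=
  fun x => L.compContinuousAlternatingMap (η x)

theorem DForm.inChart_compLinear (L : ℂ →L[ℝ] ℝ) (x₀ : M) :
    (η.compLinear L).inChart x₀ =
      L.compContinuousAlternatingMapCLM ℝ E ℂ ℝ (Fin 2) ∘ η.inChart x₀ := rfl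

theorem DForm.IsSmooth.compLinear (h : η.IsSmooth) (L : ℂ →L[ℝ] ℝ) :
    (η.compLinear L).IsSmooth := fun x₀ => by
  rw [DForm.inChart_compLinear]
  exact (ContinuousLinearMap.contDiff _).comp_contDiffOn (h x₀)

theorem DForm.IsClosed.compLinear (hc : η.IsClosed) (h : η.IsSmooth) (L : ℂ →L[ℝ] ℝ) :
    (η.compLinear L).IsClosed := fun x₀ y hy => by
  have hd : DifferentiableAt ℝ (η.inChart x₀) y := h.differentiableAt hy
  have hf : fderiv ℝ ((η.compLinear L).inChart x₀) y =
      (L.compContinuousAlternatingMapCLM ℝ E ℂ ℝ (Fin 2)).comp (fderiv ℝ (η.inChart x₀) y) := by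
    rw [DForm.inChart_compLinear]
    exact ((ContinuousLinearMap.hasFDerivAt _).comp y hd.hasFDerivAt).fderiv
  ext v
  have h0 := congrArg (fun β : E [⋀^Fin 3]→L[ℝ] ℂ => L (β v)) (hc x₀ y hy)
  simp only [extDeriv, ContinuousAlternatingMap.alternatizeUncurryFin_apply, map_sum,
    map_zsmul] at h0
  rw [extDeriv, hf, ContinuousAlternatingMap.alternatizeUncurryFin_apply]
  exact h0.trans (map_zero L)

end ComplexForms

/-! ### The algebra of the Fueter equation -/

section Algebra

variable [IsManifold 𝓘(ℝ, E) ∞ M] {Q : AlmostQuaternionic E M} {g : Metric E M}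

/-- Applying `JI` to the equation gives `-Ja + Ib + c = 0`, by `K = IJ` and `JIJ = I`; the latter
follows from `(IJ)² = -1`. -/
theorem AlmostQuaternionic.fueter_eq {x : M} {a b c : TangentSpace 𝓘(ℝ, E) x}
    (h : Q.I x a + Q.J x b + Q.K x c = 0) : c = Q.J x a - Q.I x b := by
  have hJIJ : ∀ v : TangentSpace 𝓘(ℝ, E) x, Q.J x (Q.I x (Q.J x v)) = Q.I x v := fun v => by
    have h1 := Q.K_sq x v
    rw [← Q.I_J, ← Q.I_J] at h1
    have h2 := congrArg (Q.I x) h1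
    rw [Q.I_sq, map_neg] at h2
    exact neg_injective h2
  have h1 := congrArg (fun v => Q.J x (Q.I x v)) h
  simp only [map_add, map_zero, Q.I_sq, map_neg, ← Q.I_J, Q.J_sq, hJIJ, neg_neg] at h1
  rw [eq_sub_iff_add_eq, ← sub_eq_zero, ← h1]
  abel

theorem AlmostQuaternionic.IsOrthogonal.len_I (h : Q.IsOrthogonal g) (x : M) (v : E) :
    g.len x (Q.I x v) = g.len x v := congrArg Real.sqrt (h x v v).1

theorem AlmostQuaternionic.IsOrthogonal.len_J (h : Q.IsOrthogonal g) (x : M) (v : E) :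
    g.len x (Q.J x v) = g.len x v := congrArg Real.sqrt (h x v v).2.1

theorem Metric.len_neg (g : Metric E M) {x : M} (v : TangentSpace 𝓘(ℝ, E) x) :
    g.len x (-v) = g.len x v := by
  simp [Metric.len]

variable {η : DForm E M ℂ 2}

theorem IsKITaming.compLinear_J_self (h : IsKITaming Q g η) (L : ℂ →L[ℝ] ℝ) (x : M) (v : E) :
    (η.compLinear L).ev₂ x (Q.J x v) v = 0 := by
  have h1 : η x ![Q.J x v, v] = Complex.I * η x ![v, v] := h.linear_left x v v
  have h2 : η x ![v, v] = 0 :=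
    (η x).map_eq_zero_of_eq (i := 0) (j := 1) ![v, v] rfl (by simp)
  rw [h2, mul_zero] at h1
  exact (congrArg L h1).trans (map_zero L)

theorem IsKITaming.im_J_right (h : IsKITaming Q g η) (x : M) (v w : E) :
    η.im.ev₂ x v (Q.J x w) = η.re.ev₂ x v w := by
  have h1 : η x ![v, Q.J x w] = Complex.I * η x ![v, w] := h.linear_right x v w
  refine (congrArg Complex.im h1).trans ?_
  rw [Complex.I_mul_im]
  rfl

theorem update_vec2_zero {X : Type*} (a b c : X) : Function.update ![a, b] 0 c = ![c, b] := by
  ext i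
  fin_cases i <;> rfl

theorem twoForm_add_left (σ : E [⋀^Fin 2]→L[ℝ] ℝ) (v v' w : E) :
    σ ![v + v', w] = σ ![v, w] + σ ![v', w] := by
  simpa only [update_vec2_zero] using σ.map_update_add ![(0 : E), w] 0 v v'

theorem twoForm_smul_left (σ : E [⋀^Fin 2]→L[ℝ] ℝ) (c : ℝ) (v w : E) :
    σ ![c • v, w] = c * σ ![v, w] := by
  simpa only [update_vec2_zero, smul_eq_mul] using σ.map_update_smul ![(0 : E), w] 0 c v

theorem DForm.ev₂_add_left (σ : DForm E M ℝ 2) (x : M) (v v' w : E) :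
    σ.ev₂ x (v + v') w = σ.ev₂ x v w + σ.ev₂ x v' w :=
  twoForm_add_left (E := E) (σ x) v v' w

theorem DForm.ev₂_smul_left (σ : DForm E M ℝ 2) (x : M) (c : ℝ) (v w : E) :
    σ.ev₂ x (c • v) w = c * σ.ev₂ x v w :=
  twoForm_smul_left (E := E) (σ x) c v w

theorem DForm.ev₂_sub_right (σ : DForm E M ℝ 2) (x : M) (v w w' : E) :
    σ.ev₂ x v (w - w') = σ.ev₂ x v w - σ.ev₂ x v w' := by
  rw [σ.ev₂_swap x (w - w') v, sub_eq_add_neg, σ.ev₂_add_left, ← neg_one_smul ℝ w',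
    σ.ev₂_smul_left, σ.ev₂_swap x v w, σ.ev₂_swap x v w']
  ring

/-- A two-form vanishes along a map if it vanishes on the two partial derivatives. -/
theorem vanishesAlong_of_ev₂ {σ : DForm E M ℝ 2} {u : ℝ × ℝ → M}
    (h : ∀ z ∈ strip,
      σ.ev₂ (u z) (mapDeriv E strip u z (1, 0)) (mapDeriv E strip u z (0, 1)) = 0) :
    VanishesAlong σ u := fun z hz => by
  have e : ∀ v : ℝ × ℝ, mapDeriv E strip u z v =
      v.1 • mapDeriv E strip u z (1, 0) + v.2 • mapDeriv E strip u z (0, 1) := fun v => by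
    rw [← map_smul, ← map_smul, ← map_add]
    congr 1
    ext <;> simp
  have h1 : ∀ v : ℝ × ℝ, σ.ev₂ (u z) (mapDeriv E strip u z v) (mapDeriv E strip u z (1, 0)) = 0 :=
    fun v => by
      rw [e, σ.ev₂_add_left, σ.ev₂_smul_left, σ.ev₂_smul_left, σ.ev₂_self, σ.ev₂_swap, h z hz]
      simp
  have h2 : ∀ v : ℝ × ℝ, σ.ev₂ (u z) (mapDeriv E strip u z v) (mapDeriv E strip u z (0, 1)) = 0 :=
    fun v => by
      rw [e, σ.ev₂_add_left, σ.ev₂_smul_left, σ.ev₂_smul_left, σ.ev₂_self, h z hz]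
      simp
  have key : ∀ v w : ℝ × ℝ, σ.ev₂ (u z) (mapDeriv E strip u z v) (mapDeriv E strip u z w) = 0 :=
    fun v w => by
      rw [e w, σ.ev₂_swap, σ.ev₂_add_left, σ.ev₂_smul_left, σ.ev₂_smul_left,
        σ.ev₂_swap _ (mapDeriv E strip u z v), σ.ev₂_swap _ (mapDeriv E strip u z v), h1, h2]
      simp
  ext v
  refine Eq.trans (congrArg (σ (u z)) (funext fun i => ?_)) (key (v 0) (v 1))
  fin_cases i <;> rfl

/-- On the strip `∂_t u = J ∂_τ u`, so the only component of the pull-back is `η(Jv, v) = i η(v, v)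
= 0`. A general real functional `L` covers the real and imaginary parts at once. -/
theorem IsAntiholomorphicStrip.vanishesAlong {L₀ L₁ : Set M} {u : ℝ × ℝ → M} {pm pp : M}
    (hu : IsAntiholomorphicStrip Q L₀ L₁ u pm pp) (h : IsKITaming Q g η) (L : ℂ →L[ℝ] ℝ) :
    VanishesAlong (η.compLinear L) u :=
  vanishesAlong_of_ev₂ fun z hz => by
    have e : mapDeriv E strip u z (1, 0) = Q.J (u z) (mapDeriv E strip u z (0, 1)) :=
      sub_eq_zero.1 (hu.equation z hz)
    rw [e]
    exact h.compLinear_J_self L _ _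

end Algebra

end

section

variable {E : Type u} [NormedAddCommGroup E] [NormedSpace ℝ E]
variable {M : Type v} [TopologicalSpace M] [ChartedSpace E M]

/-! ### Maps into submanifolds -/

section Submanifolds

variable [IsManifold 𝓘(ℝ, E) ∞ M] {F : ℝ × ℝ × ℝ → M} {L : Set M} {τ : ℝ}

/-- The derivative of a curve in a closed subspace lies in the subspace. -/
theorem mem_of_hasFDerivAt {W : Submodule ℝ E} (hW : IsClosed (W : Set E)) {γ : ℝ → E}
    {A : ℝ →L[ℝ] E} {x : ℝ} (h : HasFDerivAt γ A x) (hγ : ∀ᶠ r in 𝓝 x, γ r ∈ W) : A 1 ∈ W := by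
  have hx : γ x ∈ W := hγ.self_of_nhds
  refine hW.mem_of_tendsto (hasDerivAt_iff_tendsto_slope.1 h.hasDerivAt) ?_
  filter_upwards [nhdsWithin_le_nhds hγ] with r hr
  exact W.smul_mem _ (W.sub_mem hr hx)

theorem mapDeriv_mem_tangentTo [FiniteDimensional ℝ E]
    (hF : ContMDiffOn 𝓘(ℝ, ℝ × ℝ × ℝ) 𝓘(ℝ, E) 1 F slab)
    (hL : IsSubmanifold E L) (hτ : τ ∈ Icc (0 : ℝ) 1) (h : ∀ z, F (τ, z) ∈ L) (z e : ℝ × ℝ) :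
    mapDeriv E slab F (τ, z) (0, e) ∈ tangentTo (E := E) L (F (τ, z)) := by
  obtain ⟨φ, W, hφ⟩ := hL _ (h z)
  refine ⟨φ, W, hφ, ?_⟩
  obtain ⟨hat, hsrc, hW⟩ := hφ
  -- A line inside the slice is mapped into `L`; in a slice chart its image runs in the closed
  -- subspace `W`, and so does its velocity.
  let l : ℝ → ℝ × ℝ × ℝ := fun r => (τ, z + r • e)
  have l0 : l 0 = (τ, z) := by simp [l]
  have hl : HasFDerivAt l ((ContinuousLinearMap.toSpanSingleton ℝ ((0 : ℝ), e))) 0 := by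
    have h1 : HasDerivAt l ((0 : ℝ), e) 0 :=
      (hasDerivAt_const (0 : ℝ) τ).prodMk (by simpa using ((hasDerivAt_id (0 : ℝ)).smul_const e).const_add z)
    exact h1.hasFDerivAt
  have hd : HasMFDerivWithinAt 𝓘(ℝ, ℝ × ℝ × ℝ) 𝓘(ℝ, E) F slab (l 0)
      (mfderivWithin 𝓘(ℝ, ℝ × ℝ × ℝ) 𝓘(ℝ, E) F slab (l 0)) :=
    (hF.mdifferentiableOn (by simp) _ (mem_slab.2 hτ)).hasMFDerivWithinAt
  have hγ := HasMFDerivWithinAt.comp (0 : ℝ) hd (hl.hasFDerivWithinAt (s := univ)).hasMFDerivWithinAt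
    (fun r _ => mem_slab.2 hτ)
  have hx : (F ∘ l) 0 ∈ φ.source := by rw [Function.comp_apply, l0]; exact hsrc
  have hφd : HasMFDerivAt 𝓘(ℝ, E) 𝓘(ℝ, E) φ ((F ∘ l) 0) (mfderiv 𝓘(ℝ, E) 𝓘(ℝ, E) φ ((F ∘ l) 0)) :=
    ((contMDiffAt_of_mem_maximalAtlas hat hx).mdifferentiableAt (by simp)).hasMFDerivAt
  have hc : HasFDerivAt (F := E) (φ ∘ (F ∘ l)) (((mfderiv 𝓘(ℝ, E) 𝓘(ℝ, E) φ ((F ∘ l) 0) : E →L[ℝ] E).comp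
      (mapDeriv E slab F (l 0))).comp (ContinuousLinearMap.toSpanSingleton ℝ ((0 : ℝ), e))) 0 :=
    hasMFDerivAt_iff_hasFDerivAt.1
      (hasMFDerivWithinAt_univ.1 (hφd.comp_hasMFDerivWithinAt (0 : ℝ) hγ))
  have hcont : ContinuousAt (F ∘ l) 0 := (hasMFDerivWithinAt_univ.1 hγ).continuousAt
  have := mem_of_hasFDerivAt W.closed_of_finiteDimensional hc (by
    filter_upwards [hcont.preimage_mem_nhds (φ.open_source.mem_nhds hx)] with r hr
    exact (hW _ hr).1 (h _))
  have e1 : (ContinuousLinearMap.toSpanSingleton ℝ ((0 : ℝ), e)) 1 = ((0 : ℝ), e) := by simp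
  have key : ∀ p, p = (τ, z) →
      (mfderiv 𝓘(ℝ, E) 𝓘(ℝ, E) φ (F p) (mapDeriv E slab F p (0, e)) : E) ∈ W →
      (mfderiv 𝓘(ℝ, E) 𝓘(ℝ, E) φ (F (τ, z)) (mapDeriv E slab F (τ, z) (0, e)) : E) ∈ W := by
    rintro p rfl h; exact h
  refine key _ l0 ?_
  rw [← e1]
  exact this

theorem VanishesOn.formOn_eq_zero [FiniteDimensional ℝ E] {σ : DForm E M ℝ 2}
    (hσ : VanishesOn σ L)
    (hF : ContMDiffOn 𝓘(ℝ, ℝ × ℝ × ℝ) 𝓘(ℝ, E) 1 F slab)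
    (hL : IsSubmanifold E L) (hτ : τ ∈ Icc (0 : ℝ) 1) (h : ∀ z, F (τ, z) ∈ L) (z : ℝ × ℝ) :
    formOn σ F (τ, z) es et = 0 :=
  hσ _ (h z) _ (mapDeriv_mem_tangentTo hF hL hτ h z (1, 0)) _
    (mapDeriv_mem_tangentTo hF hL hτ h z (0, 1))

end Submanifolds

/-! ### Estimates for Fueter strips -/

section FueterStrip

variable [FiniteDimensional ℝ E] [T2Space M] [SecondCountableTopology M]
  [IsManifold 𝓘(ℝ, E) ∞ M] {Q : AlmostQuaternionic E M} {g : Metric E M} {L₀ L₁ : Set M}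
  {U : ℝ × ℝ × ℝ → M} {um up : ℝ × ℝ → M} {pm pp : M} {f : M → ℝ} {σ : DForm E M ℝ 2}

theorem IsFueterStrip.contMDiffOn_one (hU : IsFueterStrip Q g L₀ L₁ U um up pm pp) :
    ContMDiffOn 𝓘(ℝ, ℝ × ℝ × ℝ) 𝓘(ℝ, E) 1 U slab :=
  hU.contMDiffOn.of_le one_le_two

theorem IsFueterStrip.dt_eq (hU : IsFueterStrip Q g L₀ L₁ U um up pm pp) {p : ℝ × ℝ × ℝ}
    (hp : p ∈ slab) : dt E U p = Q.J (U p) (dτ E U p) - Q.I (U p) (ds E U p) :=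
  Q.fueter_eq (hU.equation p hp)

/-- From `∂_t U = J ∂_τ U - I ∂_s U` and orthogonality, `|∂_t U| ≤ |∂_τ U| + |∂_s U|`. The lengths
on the right are measured by finitely many functions `k`, because the asymptotics are stated through
functions on `M`. -/
theorem IsFueterStrip.abs_deriv_t_le (hU : IsFueterStrip Q g L₀ L₁ U um up pm pp)
    (hg : Q.IsOrthogonal g) (hf : ContMDiff 𝓘(ℝ, E) 𝓘(ℝ, ℝ) ∞ f) :
    ∃ (ι : Type v) (_ : Fintype ι) (k : ι → M → ℝ) (C : ℝ), 0 ≤ C ∧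
      (∀ i, ContMDiff 𝓘(ℝ, E) 𝓘(ℝ, ℝ) ∞ (k i)) ∧ ∀ p ∈ slab, |slabDeriv (f ∘ U) p et| ≤
        C * ∑ i, (|slabDeriv (k i ∘ U) p eτ| + |slabDeriv (k i ∘ U) p es|) := by
  have hF := hU.contMDiffOn_one
  obtain ⟨K, hK, hUK, -, -⟩ := hU.asymptotics.exists_compact hF
  obtain ⟨C, hC0, hC⟩ := g.exists_diff_le hK hf
  obtain ⟨ι, _, k, C', hC0', hk, hC'⟩ := g.exists_len_le hK
  refine ⟨ι, inferInstance, k, C * C', mul_nonneg hC0 hC0', hk, fun p hp => ?_⟩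
  have hx := hUK hp
  simp only [slabDeriv, fderivWithin_smooth_comp uniqueDiffOn_slab hF hf hp,
    fderivWithin_smooth_comp uniqueDiffOn_slab hF (hk _) hp]
  let A : E := Q.J (U p) (mapDeriv E slab U p eτ)
  let B : E := Q.I (U p) (mapDeriv E slab U p es)
  have e : mapDeriv E slab U p et = A - B := hU.dt_eq hp
  rw [e, map_sub, Finset.sum_add_distrib]
  refine (abs_sub _ _).trans ?_
  have h1 := hC _ hx A
  have h2 := hC _ hx B
  rw [show g.len (U p) A = g.len (U p) (mapDeriv E slab U p eτ) from hg.len_J _ _] at h1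
  rw [show g.len (U p) B = g.len (U p) (mapDeriv E slab U p es) from hg.len_I _ _] at h2
  have h3 := mul_le_mul_of_nonneg_left (hC' _ hx (mapDeriv E slab U p eτ)) hC0
  have h4 := mul_le_mul_of_nonneg_left (hC' _ hx (mapDeriv E slab U p es)) hC0
  calc _ ≤ C * (C' * ∑ i, |diff (k i) (U p) (mapDeriv E slab U p eτ)|) +
      C * (C' * ∑ i, |diff (k i) (U p) (mapDeriv E slab U p es)|) :=
        add_le_add (h1.trans h3) (h2.trans h4)
    _ = _ := by ring

theorem IsFueterStrip.exists_bound_deriv_t (hU : IsFueterStrip Q g L₀ L₁ U um up pm pp)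
    (hg : Q.IsOrthogonal g) (hf : ContMDiff 𝓘(ℝ, E) 𝓘(ℝ, ℝ) ∞ f) :
    ∃ C, ∀ p ∈ slab, |slabDeriv (f ∘ U) p et| ≤ C := by
  have hF := hU.contMDiffOn_one
  obtain ⟨ι, _, k, C, hC0, hk, hC⟩ := hU.abs_deriv_t_le hg hf
  obtain ⟨C', hC'⟩ := hU.asymptotics.exists_bound_deriv_t_of hF hf (P := fun _ => True) fun S => by
    choose A hA using fun i => hU.asymptotics.exists_bound_deriv_near hF (hk i) (e := (1, 0)) S
    choose B hB using fun i => hU.asymptotics.exists_bound_deriv_near hF (hk i) (e := (0, 1)) S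
    exact ⟨C * ∑ i, (A i + B i), fun p hp hs _ => (hC p hp).trans (mul_le_mul_of_nonneg_left
      (Finset.sum_le_sum fun i _ => add_le_add (hA i p hp hs) (hB i p hp hs)) hC0)⟩
  exact ⟨C', fun p hp => hC' p hp trivial⟩

theorem IsFueterStrip.integrable_formOn (hU : IsFueterStrip Q g L₀ L₁ U um up pm pp)
    (hg : Q.IsOrthogonal g) (hσ : σ.IsSmooth) {τ : ℝ} (hτ : τ ∈ Icc (0 : ℝ) 1) :
    Integrable fun z => formOn σ U (τ, z) es et := by
  have hF := hU.contMDiffOn_one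
  have hm : MapsTo (fun z : ℝ × ℝ => (τ, z)) univ slab := fun z _ => mem_slab.2 hτ
  have hc : Continuous fun z => formOn σ U (τ, z) es et := continuousOn_univ.1
    ((hU.asymptotics.continuousOn_formOn g hF hσ es et).comp (by fun_prop) hm)
  obtain ⟨C, hC⟩ := hU.asymptotics.exists_bound_formOn g hF hσ
    (fun f hf => hU.exists_bound_deriv_t hg hf)
  refine ((hU.slice_L1 τ hτ).const_mul C).mono' hc.aestronglyMeasurable
    (Eventually.of_forall fun z => ?_)
  rw [Real.norm_eq_abs, formOn_swap, abs_neg]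
  exact hC _ (hm (mem_univ z))

theorem IsFueterStrip.integrableOn_formOn (hU : IsFueterStrip Q g L₀ L₁ U um up pm pp)
    (hg : Q.IsOrthogonal g) (hσ : σ.IsSmooth) :
    IntegrableOn (fun p => formOn σ U p es et) slab := by
  have h := hU.asymptotics.integrableOn_formOn g hU.contMDiffOn_one hσ
    (fun f hf => hU.exists_bound_deriv_t hg hf) hU.L1
  exact h.neg.congr (Eventually.of_forall fun p => by
    simp only [Pi.neg_apply]; rw [formOn_swap, neg_neg])

/-- Exchange of limits: a uniform limit of functions tending to zero tends to zero. -/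
theorem tendsto_zero_of_tendstoUniformlyOn {X : ℝ → ℝ → ℝ} {x : ℝ → ℝ} {l' l : Filter ℝ}
    [l'.NeBot] (h : TendstoUniformly X x l') (hX : ∀ s, Tendsto (X s) l (𝓝 0)) :
    Tendsto x l (𝓝 0) :=
  (h.tendsto_of_eventually_tendsto (Eventually.of_forall hX) tendsto_const_nhds)

/-- The derivatives of the asymptotic strips tend to zero at the ends. -/
theorem IsFueterStrip.tendsto_deriv_t (hU : IsFueterStrip Q g L₀ L₁ U um up pm pp)
    (hg : Q.IsOrthogonal g) (hf : ContMDiff 𝓘(ℝ, E) 𝓘(ℝ, ℝ) ∞ f) {u : ℝ × ℝ → M} {l l' : Filter ℝ}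
    [l'.NeBot] (hl' : TendstoC1 E l' (fun s z => U (z.2, s, z.1)) u strip strip) {p : M}
    (hl : ∀ K : Set (ℝ × ℝ), IsCompact K → K ⊆ strip' →
      TendstoC1 E l (fun t z => U (z.1, z.2, t)) (fun _ => p) strip' K)
    (hu : ContMDiffOn 𝓘(ℝ, ℝ × ℝ) 𝓘(ℝ, E) 1 u strip) {τ : ℝ} (hτ : τ ∈ Icc (0 : ℝ) 1) :
    Tendsto (fun t => diff f (u (t, τ)) (mapDeriv E strip u (t, τ) (1, 0))) l (𝓝 0) := by
  have hF := hU.contMDiffOn_one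
  have ct := fun {f : M → ℝ} (hf : ContMDiff 𝓘(ℝ, E) 𝓘(ℝ, ℝ) ∞ f) =>
    contDiffOn_smooth_comp one_le_infty hF hf
  obtain ⟨ι, _, k, C, hC0, hk, hC⟩ := hU.abs_deriv_t_le hg hf
  refine tendsto_zero_of_tendstoUniformlyOn (l' := l')
    -- As `s → ±∞` convergence is uniform in `t`. For fixed `s`, the `τ`- and `s`-derivatives tend
    -- to those of a constant map as `t → ±∞`, and the Fueter equation carries this over to `∂_t`.
    (X := fun s t => slabDeriv (f ∘ U) (τ, s, t) et) ?_ fun s => ?_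
  · have h1 := tendsto_slabDeriv_strip hf (ct hf) hl' (1, 0)
    have h2 := (h1.comp (fun t : ℝ => (t, τ))).mono (s' := univ) fun t _ => mem_strip.2 hτ
    rw [tendstoUniformlyOn_univ] at h2
    have e : (fun t => diff f (u (t, τ)) (mapDeriv E strip u (t, τ) (1, 0))) =
        (fun z => fderivWithin ℝ (f ∘ u) strip z (1, 0)) ∘ fun t => (t, τ) := funext fun t =>
      (fderivWithin_smooth_comp uniqueDiffOn_strip hu hf (mem_strip.2 hτ) _).symm
    rw [e]
    exact h2
  · have hz : ((τ, s) : ℝ × ℝ) ∈ ({(τ, s)} : Set (ℝ × ℝ)) := rfl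
    have hs : ({(τ, s)} : Set (ℝ × ℝ)) ⊆ strip' := by
      rintro _ rfl; exact mem_strip'.2 hτ
    have d : ∀ i (e : ℝ × ℝ),
        Tendsto (fun t => |slabDeriv (k i ∘ U) (τ, s, t) (stripMap' e)|) l (𝓝 0) := fun i e => by
      have := (tendsto_slabDeriv_strip' hs (hk i) (ct (hk i))
        (hl _ isCompact_singleton hs) e).tendsto_at hz
      have e0 : (k i ∘ fun _ : ℝ × ℝ => p) = fun _ => k i p := rfl
      rw [e0, fderivWithin_const_apply] at this
      simpa using this.abs
    have h := (tendsto_finsetSum Finset.univ fun i _ => (d i (1, 0)).add (d i (0, 1))).const_mul C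
    simp only [add_zero, Finset.sum_const_zero, mul_zero] at h
    exact squeeze_zero_norm (fun t => hC _ (mem_slab.2 hτ)) h

end FueterStrip

end

section

variable {E : Type u} [NormedAddCommGroup E] [NormedSpace ℝ E]
variable {M : Type v} [TopologicalSpace M] [ChartedSpace E M]
variable [FiniteDimensional ℝ E] [T2Space M] [SecondCountableTopology M]
  [IsManifold 𝓘(ℝ, E) ∞ M]

/-! ### Invariance of the integrals over slices -/

section Invariance

variable (g : Metric E M) {F : ℝ × ℝ × ℝ → M} {Am Ap Bm Bp : ℝ × ℝ → M} {σ : DForm E M ℝ 2}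

theorem HasAsymptotics.integral_formOn_eq
    (hF : ContMDiffOn 𝓘(ℝ, ℝ × ℝ × ℝ) 𝓘(ℝ, E) 1 F slab)
    (hA : HasAsymptotics E F Am Ap Bm Bp) (hσ : σ.IsSmooth) (hσc : σ.IsClosed)
    (hAm : ContMDiffOn 𝓘(ℝ, ℝ × ℝ) 𝓘(ℝ, E) 1 Am strip)
    (hAp : ContMDiffOn 𝓘(ℝ, ℝ × ℝ) 𝓘(ℝ, E) 1 Ap strip)
    (hvm : ∀ z ∈ strip, ∀ u v,
      σ.ev₂ (Am z) (mapDeriv E strip Am z u) (mapDeriv E strip Am z v) = 0)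
    (hvp : ∀ z ∈ strip, ∀ u v,
      σ.ev₂ (Ap z) (mapDeriv E strip Ap z u) (mapDeriv E strip Ap z v) = 0)
    (hL1 : IntegrableOn (fun p => g.len (F p) (ds E F p)) slab)
    (hi : ∀ τ ∈ Icc (0 : ℝ) 1, Integrable fun z => formOn σ F (τ, z) es et) {τ : ℝ}
    (hτ : τ ∈ Icc (0 : ℝ) 1) :
    ∫ z, formOn σ F (τ, z) es et = ∫ z, formOn σ F (0, z) es et :=
  integral_slice_eq (wst := fun p => formOn σ F p es et)
    ((hA.integrableOn_formOn g hF hσ (fun _ hf => hA.exists_bound_deriv_τ hF hf) hL1).mono_set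
      fun _ hp => mem_slab.2 ⟨hp.1.1, hp.1.2.trans hτ.2⟩) (hi τ hτ)
    (hi 0 (left_mem_Icc.2 zero_le_one))
    fun _ hc hcs => hA.stokes g hF hσ hσc hAm hAp hvm hvp hL1 le_rfl hτ.1 hτ.2 (hi τ hτ)
      (hi 0 (left_mem_Icc.2 zero_le_one)) hc hcs

end Invariance

/-! ### Slice integrals, exact forms and energy of Fueter strips -/

section FueterStrip

variable {Q : AlmostQuaternionic E M} {g : Metric E M} {L₀ L₁ : Set M}
  {U : ℝ × ℝ × ℝ → M} {um up : ℝ × ℝ → M} {pm pp : M} {σ : DForm E M ℝ 2}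

theorem IsFueterStrip.integral_formOn_eq (hU : IsFueterStrip Q g L₀ L₁ U um up pm pp)
    (hg : Q.IsOrthogonal g) (hσ : σ ∈ relClosed E um up) {τ : ℝ} (hτ : τ ∈ Icc (0 : ℝ) 1) :
    ∫ z, formOn σ U (τ, z) es et = ∫ z, formOn σ U (0, z) es et :=
  hU.asymptotics.integral_formOn_eq g hU.contMDiffOn_one hσ.1 hσ.2.1 hU.strip_um.contMDiffOn
    hU.strip_up.contMDiffOn (fun _ hz => hσ.2.2.1.ev₂_eq_zero hz)
    (fun _ hz => hσ.2.2.2.ev₂_eq_zero hz) hU.L1 (fun _ hτ => hU.integrable_formOn hg hσ.1 hτ) hτ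

/-- The integrals over homotopic maps agree. -/
theorem IsFueterStrip.integral_pullback_eq_of_homotopic
    (hU : IsFueterStrip Q g L₀ L₁ U um up pm pp) (hσ : σ ∈ relClosed E um up)
    {f₀ f₁ : ℝ × ℝ → M} (h : RelHomotopic g um up pm pp f₀ f₁) :
    ∫ z, pullback f₁ σ z = ∫ z, pullback f₀ σ z := by
  obtain ⟨F, hF, rfl, rfl, hi, hL1, Am, Ap, Bm, Bp, hAm, hAp, -, -, hA⟩ := h
  have hum := hU.strip_um.contMDiffOn
  have hup := hU.strip_up.contMDiffOn
  have e : ∀ τ ∈ Icc (0 : ℝ) 1, pullback (slice F τ) σ = fun z => formOn σ F (τ, z) es et :=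
    fun τ hτ => funext fun z => pullback_slice hF σ hτ z
  rw [e 0 (left_mem_Icc.2 zero_le_one), e 1 (right_mem_Icc.2 zero_le_one)]
  exact hA.integral_formOn_eq g hF hσ.1 hσ.2.1 (hAm.contMDiffOn hum hup)
    (hAp.contMDiffOn hum hup) (fun _ hz => hAm.ev₂_eq_zero hum hup hσ.2.2.1 hσ.2.2.2 hz)
    (fun _ hz => hAp.ev₂_eq_zero hum hup hσ.2.2.1 hσ.2.2.2 hz) hL1
    (fun τ hτ => by rw [← e τ hτ]; exact hi τ hτ σ hσ.1) (right_mem_Icc.2 zero_le_one)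

/-! ### Exact forms -/

variable {α : DForm E M ℝ 1} {β : DForm E M ℝ 2} {τ : ℝ}

theorem ev₁_eq_sum {ι : Type*} [Fintype ι] {h f : ι → M → ℝ}
    {V : Type*} [NormedAddCommGroup V] [NormedSpace ℝ V] {D : Set V} (hD : UniqueDiffOn ℝ D)
    {F : V → M} (hF : ContMDiffOn 𝓘(ℝ, V) 𝓘(ℝ, E) 1 F D)
    (hf : ∀ i, ContMDiff 𝓘(ℝ, E) 𝓘(ℝ, ℝ) ∞ (f i)) {p : V} (hp : p ∈ D)
    (hα : ∀ w : E, α (F p) ![w] = ∑ i, h i (F p) * diff (f i) (F p) w) (e : V) :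
    α.ev₁ (F p) (mapDeriv E D F p e) = ∑ i, h i (F p) * fderivWithin ℝ (f i ∘ F) D p e := by
  rw [DForm.ev₁, hα]
  exact Finset.sum_congr rfl fun i _ => by rw [fderivWithin_smooth_comp hD hF (hf i) hp]

theorem continuousOn_ev₁ (g : Metric E M) (hα : α.IsSmooth) {V : Type*} [NormedAddCommGroup V]
    [NormedSpace ℝ V] {D : Set V} (hD : UniqueDiffOn ℝ D) {F : V → M}
    (hF : ContMDiffOn 𝓘(ℝ, V) 𝓘(ℝ, E) 1 F D) {K : Set M} (hK : IsCompact K) (hFK : MapsTo F D K)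
    (e : V) : ContinuousOn (fun p => α.ev₁ (F p) (mapDeriv E D F p e)) D := by
  obtain ⟨ι, _, h, f, hh, hf, hexp⟩ := hα.exists_expansion_one g hK
  have : ContinuousOn (fun p => ∑ i, h i (F p) * fderivWithin ℝ (f i ∘ F) D p e) D :=
    continuousOn_finsetSum _ fun i _ =>
      (contDiffOn_smooth_comp one_le_infty hF (hh i)).continuousOn.mul
        (((contDiffOn_smooth_comp one_le_infty hF (hf i)).continuousOn_fderivWithin hD
          le_rfl).clm_apply continuousOn_const)
  exact this.congr fun p hp => ev₁_eq_sum hD hF hf hp (hexp.self_of_nhdsSet _ (hFK hp)) e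

theorem IsFueterStrip.integrable_ev₁ (hU : IsFueterStrip Q g L₀ L₁ U um up pm pp)
    (hα : α.IsSmooth) (hτ : τ ∈ Icc (0 : ℝ) 1) :
    Integrable fun z => α.ev₁ (U (τ, z)) (mapDeriv E slab U (τ, z) es) := by
  have hF := hU.contMDiffOn_one
  have hm : MapsTo (fun z : ℝ × ℝ => (τ, z)) univ slab := fun z _ => mem_slab.2 hτ
  obtain ⟨K, hK, hUK, -, -⟩ := hU.asymptotics.exists_compact hF
  have hc : Continuous fun z => α.ev₁ (U (τ, z)) (mapDeriv E slab U (τ, z) es) :=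
    continuousOn_univ.1 ((continuousOn_ev₁ g hα uniqueDiffOn_slab hF hK hUK es).comp
      (by fun_prop) hm)
  obtain ⟨ι, _, h, f, hh, hf, hexp⟩ := hα.exists_expansion_one g hK
  choose A hA using fun i => hU.asymptotics.exists_bound_comp hF (hh i)
  choose C hC0 hC using fun i => exists_bound_ds g hF hK hUK (hf i)
  refine ((hU.slice_L1 τ hτ).const_mul (∑ i, A i * C i)).mono' hc.aestronglyMeasurable
    (Eventually.of_forall fun z => ?_)
  have hp := hm (mem_univ z)
  rw [ev₁_eq_sum uniqueDiffOn_slab hF hf hp (hexp.self_of_nhdsSet _ (hUK hp)), Finset.sum_mul]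
  refine (Finset.abs_sum_le_sum_abs _ _).trans (Finset.sum_le_sum fun i _ => ?_)
  rw [abs_mul, mul_assoc]
  exact mul_le_mul (hA i _ hp) (hC i _ hp) (abs_nonneg _) ((abs_nonneg _).trans (hA i _ hp))

theorem fderiv_comp_slice {X : ℝ × ℝ × ℝ → ℝ} (hX : ContDiffOn ℝ 1 X slab) (hτ : τ ∈ Icc (0 : ℝ) 1)
    (z e : ℝ × ℝ) : fderiv ℝ (fun z => X (τ, z)) z e = slabDeriv X (τ, z) (0, e) := by
  rw [← fderivWithin_univ]
  exact fderivWithin_affine_comp uniqueDiffOn_univ hX (A' := ContinuousLinearMap.inr ℝ ℝ (ℝ × ℝ))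
    ((hasFDerivAt_const τ z).prodMk (hasFDerivAt_id z)) (fun _ _ => mem_slab.2 hτ) (mem_univ z) e

/-- Near the image `α = ∑ h df`, which reduces the formula to `stokes_plane_limit`. Here `f ∘ U` has
to be twice differentiable, so that `α` pulls back to a form of class `C¹`. -/
theorem IsFueterStrip.stokes_exact (hU : IsFueterStrip Q g L₀ L₁ U um up pm pp)
    (hg : Q.IsOrthogonal g) (hα : α.IsSmooth) (hβ : β.IsSmooth) (hαβ : α.HasExtDeriv β)
    (hτ : τ ∈ Icc (0 : ℝ) 1) {c : ℝ → ℝ} (hc : ContDiff ℝ 1 c) (hcs : HasCompactSupport c) :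
    ∫ z : ℝ × ℝ, c z.2 * formOn β U (τ, z) es et =
      (∫ z : ℝ × ℝ, deriv c z.2 * α.ev₁ (U (τ, z)) (mapDeriv E slab U (τ, z) es)) -
        ((∫ t, c t * α.ev₁ (um (t, τ)) (mapDeriv E strip um (t, τ) (1, 0))) -
          ∫ t, c t * α.ev₁ (up (t, τ)) (mapDeriv E strip up (t, τ) (1, 0))) := by
  have hF := hU.contMDiffOn_one
  have hm : MapsTo (fun z : ℝ × ℝ => (τ, z)) univ slab := fun z _ => mem_slab.2 hτ
  have hm' : ∀ z : ℝ × ℝ, (τ, z) ∈ slab := fun z => hm (mem_univ z)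
  obtain ⟨K, hK, hUK, hmK, hpK⟩ := hU.asymptotics.exists_compact hF
  obtain ⟨ι, _, h, f, hh, hf, hexp⟩ := hα.exists_expansion_one g hK
  have ct := fun {f : M → ℝ} (hf : ContMDiff 𝓘(ℝ, E) 𝓘(ℝ, ℝ) ∞ f) =>
    contDiffOn_smooth_comp one_le_infty hF hf
  have cont : ∀ e, Continuous fun z => α.ev₁ (U (τ, z)) (mapDeriv E slab U (τ, z) e) := fun e =>
    continuousOn_univ.1 ((continuousOn_ev₁ g hα uniqueDiffOn_slab hF hK hUK e).comp
      (by fun_prop) hm)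
  have eq : ∀ z e, α.ev₁ (U (τ, z)) (mapDeriv E slab U (τ, z) e) =
      ∑ i, h i (U (τ, z)) * slabDeriv (f i ∘ U) (τ, z) e := fun z e =>
    ev₁_eq_sum uniqueDiffOn_slab hF hf (hm' z) (hexp.self_of_nhdsSet _ (hUK (hm' z))) e
  have smooth : ∀ {k : M → ℝ}, ContMDiff 𝓘(ℝ, E) 𝓘(ℝ, ℝ) ∞ k →
      ContDiff ℝ 2 fun z => k (U (τ, z)) := fun hk => contDiffOn_univ.1
    ((contDiffOn_smooth_comp two_le_infty hU.contMDiffOn hk).comp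
      (contDiff_const.prodMk contDiff_id).contDiffOn hm)
  have lim : ∀ {l : Filter ℝ} {A : ℝ × ℝ → M},
      TendstoC1 E l (fun s z => U (z.2, s, z.1)) A strip strip →
      ContMDiffOn 𝓘(ℝ, ℝ × ℝ) 𝓘(ℝ, E) 1 A strip → MapsTo A strip K → ∀ t,
      Tendsto (fun s => α.ev₁ (U (τ, s, t)) (mapDeriv E slab U (τ, s, t) et)) l
        (𝓝 (α.ev₁ (A (t, τ)) (mapDeriv E strip A (t, τ) (1, 0)))) := fun {l A} hl hA hAK t => by
    have hz : (t, τ) ∈ strip := mem_strip.2 hτ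
    simp only [eq]
    rw [ev₁_eq_sum uniqueDiffOn_strip hA hf hz (hexp.self_of_nhdsSet _ (hAK hz))]
    exact tendsto_finsetSum _ fun i _ => ((hl _ (hh i)).1.tendsto_at hz).mul
      ((tendsto_slabDeriv_strip (hf i) (ct (hf i)) hl (1, 0)).tendsto_at hz)
  refine stokes_plane_limit (cont et) (cont es) (fun χ hχ hχs => ?_) (fun T => ?_)
    (lim hU.asymptotics.s_bot hU.strip_um.contMDiffOn hmK)
    (lim hU.asymptotics.s_top hU.strip_up.contMDiffOn hpK)
    (hU.integrable_formOn hg hβ hτ) (hU.integrable_ev₁ hα hτ) hc hcs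
  · have st := stokes_plane (fun i => (smooth (hh i)).of_le one_le_two) (fun i => smooth (hf i))
      hχ hχs
    have d : ∀ {k : M → ℝ}, ContMDiff 𝓘(ℝ, E) 𝓘(ℝ, ℝ) ∞ k → ∀ z e,
        fderiv ℝ (fun z => k (U (τ, z))) z e = slabDeriv (k ∘ U) (τ, z) (0, e) :=
      fun hk z e => fderiv_comp_slice (ct hk) hτ z e
    simp only [eq]
    refine Eq.trans (integral_congr_ae (Eventually.of_forall fun z => ?_)) (st.trans
      (integral_congr_ae (Eventually.of_forall fun z => ?_)))
    · have hx := eventually_nhdsSet_iff_forall.1 hexp _ (hUK (hm' z))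
      simp only [formOn, DForm.ev₂, hαβ.expansion_one hα hh hf hx, jac, d (hh _), d (hf _), slabDeriv,
        fderivWithin_smooth_comp uniqueDiffOn_slab hF (hh _) (hm' z),
        fderivWithin_smooth_comp uniqueDiffOn_slab hF (hf _) (hm' z)]
    · simp only [d (hf _)]
  · choose A hA using fun i => hU.asymptotics.exists_bound_comp hF (hh i)
    choose B hB using fun i => hU.exists_bound_deriv_t hg (hf i)
    refine ⟨∑ i, A i * B i, fun z _ => ?_⟩
    rw [eq]
    refine (Finset.abs_sum_le_sum_abs _ _).trans (Finset.sum_le_sum fun i _ => ?_)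
    rw [abs_mul]
    exact mul_le_mul (hA i _ (hm' z)) (hB i _ (hm' z)) (abs_nonneg _)
      ((abs_nonneg _).trans (hA i _ (hm' z)))

theorem IsFueterStrip.tendsto_ev₁ (hU : IsFueterStrip Q g L₀ L₁ U um up pm pp)
    (hg : Q.IsOrthogonal g) (hα : α.IsSmooth) {u : ℝ × ℝ → M} {l l' : Filter ℝ}
    [l'.NeBot] (hl' : TendstoC1 E l' (fun s z => U (z.2, s, z.1)) u strip strip) {p : M}
    (hl : ∀ K : Set (ℝ × ℝ), IsCompact K → K ⊆ strip' →
      TendstoC1 E l (fun t z => U (z.1, z.2, t)) (fun _ => p) strip' K)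
    (hu : ContMDiffOn 𝓘(ℝ, ℝ × ℝ) 𝓘(ℝ, E) 1 u strip) {K : Set M} (hK : IsCompact K)
    (huK : MapsTo u strip K) (hτ : τ ∈ Icc (0 : ℝ) 1) :
    Tendsto (fun t => α.ev₁ (u (t, τ)) (mapDeriv E strip u (t, τ) (1, 0))) l (𝓝 0) := by
  obtain ⟨ι, _, h, f, hh, hf, hexp⟩ := hα.exists_expansion_one g hK
  have hz : ∀ t, (t, τ) ∈ strip := fun t => mem_strip.2 hτ
  choose A hA using fun i => hK.exists_bound_of_continuousOn (hh i).continuous.continuousOn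
  have h0 := tendsto_finsetSum Finset.univ fun i _ =>
    ((hU.tendsto_deriv_t hg (hf i) hl' hl hu hτ).abs).const_mul (A i)
  simp only [abs_zero, mul_zero, Finset.sum_const_zero] at h0
  refine squeeze_zero_norm (fun t => ?_) h0
  rw [DForm.ev₁, hexp.self_of_nhdsSet _ (huK (hz t))]
  refine (Finset.abs_sum_le_sum_abs _ _).trans (Finset.sum_le_sum fun i _ => ?_)
  rw [abs_mul]
  exact mul_le_mul_of_nonneg_right (hA i _ (huK (hz t))) (abs_nonneg _)

/-- The difference of actions of the asymptotic strips. -/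
theorem IsFueterStrip.tendsto_action (hU : IsFueterStrip Q g L₀ L₁ U um up pm pp)
    (hg : Q.IsOrthogonal g) (hα : α.IsSmooth) (hβ : β.IsSmooth) (hαβ : α.HasExtDeriv β)
    (hτ : τ ∈ Icc (0 : ℝ) 1) :
    Tendsto (fun T : ℝ × ℝ => ∫ t in T.1..T.2,
        (α.ev₁ (um (t, τ)) (mapDeriv E strip um (t, τ) (1, 0)) -
          α.ev₁ (up (t, τ)) (mapDeriv E strip up (t, τ) (1, 0))))
      (atBot ×ˢ atTop) (𝓝 (-∫ z, formOn β U (τ, z) es et)) := by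
  have hA := hU.asymptotics
  obtain ⟨K, hK, -, hmK, hpK⟩ := hA.exists_compact hU.contMDiffOn_one
  have hum := hU.strip_um.contMDiffOn
  have hup := hU.strip_up.contMDiffOn
  have cont : ∀ {u : ℝ × ℝ → M}, ContMDiffOn 𝓘(ℝ, ℝ × ℝ) 𝓘(ℝ, E) 1 u strip → MapsTo u strip K →
      Continuous fun t => α.ev₁ (u (t, τ)) (mapDeriv E strip u (t, τ) (1, 0)) := fun hu huK =>
    continuousOn_univ.1 ((continuousOn_ev₁ g hα uniqueDiffOn_strip hu hK huK (1, 0)).comp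
      (f := fun t : ℝ => (t, τ)) (by fun_prop) fun t _ => mem_strip.2 hτ)
  have bot := (hU.tendsto_ev₁ hg hα hA.s_bot hA.t_bot hum hK hmK hτ).sub
    (hU.tendsto_ev₁ hg hα hA.s_top hA.t_bot hup hK hpK hτ)
  have top := (hU.tendsto_ev₁ hg hα hA.s_bot hA.t_top hum hK hmK hτ).sub
    (hU.tendsto_ev₁ hg hα hA.s_top hA.t_top hup hK hpK hτ)
  rw [sub_zero] at bot top
  exact tendsto_intervalIntegral_sub
    (fun _ hc hcs => hU.stokes_exact hg hα hβ hαβ hτ hc hcs) (hU.integrable_formOn hg hβ hτ)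
    (hU.integrable_ev₁ hα hτ) (cont hum hmK) (cont hup hpK) bot top

theorem IsFueterStrip.integral_eq_zero_of_relExact
    (hU : IsFueterStrip Q g L₀ L₁ U um up pm pp) (hg : Q.IsOrthogonal g)
    (hβ : β.IsSmooth) (h : β ∈ relExact E um up) (hτ : τ ∈ Icc (0 : ℝ) 1) :
    ∫ z, formOn β U (τ, z) es et = 0 := by
  obtain ⟨α, hα, hαβ, hm, hp⟩ := h
  refine integral_plane_eq_zero
    (fun _ hc hcs => hU.stokes_exact hg hα hβ hαβ hτ hc hcs) (hU.integrable_formOn hg hβ hτ)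
    (hU.integrable_ev₁ hα hτ) fun t => ?_
  rw [hm.ev₁_eq_zero (mem_strip.2 hτ), hp.ev₁_eq_zero (mem_strip.2 hτ)]

/-- The relative homology class of the slices. -/
theorem IsFueterStrip.exists_class (hU : IsFueterStrip Q g L₀ L₁ U um up pm pp)
    (hg : Q.IsOrthogonal g) : ∃ κ : RelHomology2 E um up, ∀ σ : relClosed E um up,
      κ (relClass σ) = ∫ z, formOn σ.1 U (0, z) es et := by
  have h0 : (0 : ℝ) ∈ Icc (0 : ℝ) 1 := left_mem_Icc.2 zero_le_one
  let φ : relClosed E um up →ₗ[ℝ] ℝ :=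
    { toFun := fun σ => ∫ z, formOn σ.1 U (0, z) es et
      map_add' := fun σ σ' => integral_add (hU.integrable_formOn hg σ.2.1 h0)
        (hU.integrable_formOn hg σ'.2.1 h0)
      map_smul' := fun c σ => integral_const_mul c _ }
  -- Integration over the slice `τ = 0` descends to the quotient exactly because relatively exact
  -- forms integrate to zero.
  refine ⟨Submodule.liftQ _ φ fun σ hσ => ?_, fun σ => rfl⟩
  exact hU.integral_eq_zero_of_relExact hg σ.2.1 hσ h0

/-! ### The energy -/

variable {η : DForm E M ℂ 2}

theorem IsFueterStrip.energyDensity_eq (hU : IsFueterStrip Q g L₀ L₁ U um up pm pp)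
    (hg : Q.IsOrthogonal g) {p : ℝ × ℝ × ℝ} (hp : p ∈ slab) :
    energyDensity Q g U p = g.len (U p) (ds E U p) ^ 2 := by
  have e : dt E U p - Q.J (U p) (dτ E U p) = -Q.I (U p) (ds E U p) := by
    rw [hU.dt_eq hp]; abel
  have h : g.len (U p) (dt E U p - Q.J (U p) (dτ E U p)) = g.len (U p) (ds E U p) := by
    rw [e, g.len_neg]
    exact hg.len_I _ _
  rw [energyDensity, h]
  ring

/-- Taming is applied to `v = ∂_s U`, with `I ∂_s U = J ∂_τ U - ∂_t U`; the factor `J` turns `Im η`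
into `Re η`. -/
theorem IsFueterStrip.energyDensity_le (hU : IsFueterStrip Q g L₀ L₁ U um up pm pp)
    (hg : Q.IsOrthogonal g) (hη : IsKITaming Q g η) {c : ℝ}
    (hc : ∀ (x : M) (v : TangentSpace 𝓘(ℝ, E) x), c * g.len x v ^ 2 ≤ η.im x ![v, Q.I x v])
    {p : ℝ × ℝ × ℝ} (hp : p ∈ slab) :
    c * energyDensity Q g U p ≤ -formOn η.re U p eτ es - formOn η.im U p es et := by
  rw [hU.energyDensity_eq hg hp]
  refine (hc _ _).trans (le_of_eq ?_)
  have e : (Q.I (U p) (ds E U p)) = Q.J (U p) (dτ E U p) - dt E U p := by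
    rw [hU.dt_eq hp]; abel
  rw [e]
  refine (η.im.ev₂_sub_right (U p) (ds E U p) (Q.J (U p) (dτ E U p)) (dt E U p)).trans ?_
  have h1 : η.im.ev₂ (U p) (ds E U p) (Q.J (U p) (dτ E U p)) = -formOn η.re U p eτ es :=
    (hη.im_J_right (U p) (ds E U p) (dτ E U p)).trans (η.re.ev₂_swap _ _ _)
  rw [h1]
  rfl

/-- The energy bound. -/
theorem IsFueterStrip.energy_le (hU : IsFueterStrip Q g L₀ L₁ U um up pm pp)
    (hg : Q.IsOrthogonal g) (hη : IsKITaming Q g η) (hs : η.IsSmooth) (hcl : η.IsClosed)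
    (hL₀ : IsSubmanifold E L₀) (hL₁ : IsSubmanifold E L₁)
    (hηL₀ : VanishesOn η.re L₀) (hηL₁ : VanishesOn η.re L₁) {c : ℝ} (hc0 : 0 < c)
    (hc : ∀ (x : M) (v : TangentSpace 𝓘(ℝ, E) x), c * g.len x v ^ 2 ≤ η.im x ![v, Q.I x v]) :
    IntegrableOn (energyDensity Q g U) slab ∧
      energy Q g U ≤ -c⁻¹ * ∫ z, formOn η.im U (0, z) es et := by
  have hF := hU.contMDiffOn_one
  have hA := hU.asymptotics
  have hms : MeasurableSet slab := measurableSet_Icc.prod MeasurableSet.univ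
  have hre : η.re.IsSmooth := hs.compLinear Complex.reCLM
  have him : η.im ∈ relClosed E um up := ⟨hs.compLinear Complex.imCLM,
    hcl.compLinear hs Complex.imCLM, hU.strip_um.vanishesAlong hη Complex.imCLM,
    hU.strip_up.vanishesAlong hη Complex.imCLM⟩
  have hvm : VanishesAlong η.re um := hU.strip_um.vanishesAlong hη Complex.reCLM
  have hvp : VanishesAlong η.re up := hU.strip_up.vanishesAlong hη Complex.reCLM
  have ire : IntegrableOn (fun p => formOn η.re U p eτ es) slab :=
    hA.integrableOn_formOn g hF hre (fun _ hf => hA.exists_bound_deriv_τ hF hf) hU.L1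
  have iim : IntegrableOn (fun p => formOn η.im U p es et) slab := hU.integrableOn_formOn hg him.1
  have inre : IntegrableOn (fun p => -formOn η.re U p eτ es) slab := ire.neg
  have irhs : IntegrableOn (fun p => -formOn η.re U p eτ es - formOn η.im U p es et) slab :=
    inre.sub iim
  have hden : EqOn (energyDensity Q g U) (fun p => g.len (U p) (ds E U p) ^ 2) slab :=
    fun p hp => hU.energyDensity_eq hg hp
  have ile : IntegrableOn (energyDensity Q g U) slab := by
    refine IntegrableOn.congr_fun ?_ hden.symm hms
    -- Finite energy comes from the pointwise inequality: both forms on its right side have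
    -- integrable components.
    refine (irhs.const_mul c⁻¹).mono' (hU.L1.aestronglyMeasurable.pow 2)
      (ae_restrict_of_forall_mem hms fun p hp => ?_)
    rw [Real.norm_eq_abs, abs_of_nonneg (sq_nonneg _), le_inv_mul_iff₀ hc0, ← hU.energyDensity_eq hg hp]
    exact hU.energyDensity_le hg hη hc hp
  refine ⟨ile, ?_⟩
  -- The boundary conditions make `Re η` vanish on the slices `τ = 1` and `τ = 0`.
  have h0 : ∫ p in slab, formOn η.re U p eτ es = 0 :=
    integral_slab_eq_zero (wst := fun p => formOn η.re U p es et) ire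
      (hηL₁.formOn_eq_zero hF hL₁ (right_mem_Icc.2 zero_le_one) fun z => hU.boundary₁ z.1 z.2)
      (hηL₀.formOn_eq_zero hF hL₀ (left_mem_Icc.2 zero_le_one) fun z => hU.boundary₀ z.1 z.2)
      fun k hk hks => hA.stokes g hF hre (hcl.compLinear hs Complex.reCLM)
        hU.strip_um.contMDiffOn hU.strip_up.contMDiffOn (fun _ hz => hvm.ev₂_eq_zero hz)
        (fun _ hz => hvp.ev₂_eq_zero hz) hU.L1 le_rfl zero_le_one le_rfl
        (hU.integrable_formOn hg hre (right_mem_Icc.2 zero_le_one))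
        (hU.integrable_formOn hg hre (left_mem_Icc.2 zero_le_one)) hk hks
  -- By Fubini this is the average over `τ ∈ [0, 1]` of slice integrals that are all equal.
  have h1 : ∫ p in slab, formOn η.im U p es et = ∫ z, formOn η.im U (0, z) es et := by
    rw [slab, Measure.volume_eq_prod, setIntegral_prod _ iim,
      setIntegral_congr_fun (g := fun _ => ∫ z, formOn η.im U (0, z) es et) measurableSet_Icc
        fun τ hτ => by simpa using hU.integral_formOn_eq hg him hτ]
    simp
  have h2 : ∫ p in slab, c * energyDensity Q g U p ≤
      ∫ p in slab, (-formOn η.re U p eτ es - formOn η.im U p es et) :=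
    setIntegral_mono_on (ile.const_mul c) irhs hms fun p hp => hU.energyDensity_le hg hη hc hp
  rw [integral_const_mul, integral_sub inre iim, integral_neg, h0, h1, neg_zero, zero_sub] at h2
  rw [neg_mul, ← mul_neg, le_inv_mul_iff₀ hc0]
  exact h2

end FueterStrip

end

end Fueter

end

/-! ### The theorem -/

theorem mainTheorem3
    {E : Type*} [NormedAddCommGroup E] [NormedSpace ℝ E] [FiniteDimensional ℝ E]
    {M : Type*} [TopologicalSpace M] [T2Space M] [SecondCountableTopology M]
    [ChartedSpace E M] [IsManifold 𝓘(ℝ, E) ∞ M]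
    (Q : Fueter.AlmostQuaternionic E M) (g : Fueter.Metric E M) (_hg : Q.IsOrthogonal g)
    (η : Fueter.DForm E M ℂ 2) (_hη_smooth : η.IsSmooth) (_hη_closed : η.IsClosed)
    (_hη_taming : Fueter.IsKITaming Q g η)
    (L₀ L₁ : Set M) (_hL₀ : Fueter.IsSubmanifold E L₀) (_hL₁ : Fueter.IsSubmanifold E L₁)
    (_hηL₀ : Fueter.VanishesOn η.re L₀) (_hηL₁ : Fueter.VanishesOn η.re L₁) :
    ∃ C : ℝ, 0 < C ∧
      ∀ (U : ℝ × ℝ × ℝ → M) (um up : ℝ × ℝ → M) (pm pp : M),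
        Fueter.IsFueterStrip Q g L₀ L₁ U um up pm pp →
        -- finite energy and the energy bound
        IntegrableOn (Fueter.energyDensity Q g U) Fueter.slab ∧
        (∀ τ ∈ Icc (0 : ℝ) 1,
          Integrable (Fueter.pullback (Fueter.slice U τ) η.im) ∧
          Fueter.energy Q g U ≤ -C * ∫ z, Fueter.pullback (Fueter.slice U τ) η.im z) ∧
        -- the right-hand side is the pairing of two relative classes
        (∃ (hη : η.im ∈ Fueter.relClosed E um up) (κ : Fueter.RelHomology2 E um up),
          (∀ τ ∈ Icc (0 : ℝ) 1, ∀ σ : Fueter.relClosed E um up,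
            Integrable (Fueter.pullback (Fueter.slice U τ) σ.1) ∧
            ∫ z, Fueter.pullback (Fueter.slice U τ) σ.1 z = κ (Fueter.relClass σ)) ∧
          (∀ τ ∈ Icc (0 : ℝ) 1, ∀ f : ℝ × ℝ → M,
            Fueter.RelHomotopic g um up pm pp (Fueter.slice U τ) f →
            ∀ σ : Fueter.relClosed E um up,
              ∫ z, Fueter.pullback f σ.1 z = κ (Fueter.relClass σ)) ∧
          Fueter.energy Q g U ≤ -C * κ (Fueter.relClass ⟨η.im, hη⟩)) ∧
        -- the exact case: the right-hand side is an action difference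
        (∀ lam : Fueter.DForm E M ℝ 1, lam.IsSmooth → lam.HasExtDeriv η.im →
          ∀ τ ∈ Icc (0 : ℝ) 1, ∃ A : ℝ,
            Tendsto (fun T : ℝ × ℝ => ∫ t in T.1..T.2,
                (lam (um (t, τ)) ![Fueter.stripDt E um (t, τ)] -
                  lam (up (t, τ)) ![Fueter.stripDt E up (t, τ)]))
              (atBot ×ˢ atTop) (𝓝 A) ∧
            A = -∫ z, Fueter.pullback (Fueter.slice U τ) η.im z ∧
            Fueter.energy Q g U ≤ C * A) := by
  obtain ⟨c, hc0, hc⟩ := _hη_taming.tames_I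
  -- The constant is the inverse of the taming constant of `Im η` and `I`, hence independent of the
  -- strip.
  refine ⟨c⁻¹, inv_pos.2 hc0, fun U um up pm pp hU => ?_⟩
  have hF := hU.contMDiffOn_one
  have him : η.im ∈ Fueter.relClosed E um up := ⟨_hη_smooth.compLinear Complex.imCLM,
    _hη_closed.compLinear _hη_smooth Complex.imCLM,
    hU.strip_um.vanishesAlong _hη_taming Complex.imCLM,
    hU.strip_up.vanishesAlong _hη_taming Complex.imCLM⟩
  obtain ⟨hint, hen⟩ := hU.energy_le _hg _hη_taming _hη_smooth _hη_closed _hL₀ _hL₁ _hηL₀ _hηL₁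
    hc0 hc
  have e : ∀ τ ∈ Icc (0 : ℝ) 1, ∀ σ : Fueter.DForm E M ℝ 2,
      Fueter.pullback (Fueter.slice U τ) σ =
        fun z => Fueter.formOn σ U (τ, z) Fueter.es Fueter.et :=
    fun τ hτ σ => funext fun z => Fueter.pullback_slice hF σ hτ z
  have hi : ∀ τ ∈ Icc (0 : ℝ) 1, ∀ σ : Fueter.DForm E M ℝ 2, σ.IsSmooth →
      Integrable (Fueter.pullback (Fueter.slice U τ) σ) := fun τ hτ σ hσ => by
    rw [e τ hτ]
    exact hU.integrable_formOn _hg hσ hτ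
  -- All slices have the integral of the slice `τ = 0`, on which both the energy bound and `κ` are
  -- based.
  have heq : ∀ τ ∈ Icc (0 : ℝ) 1, ∀ σ ∈ Fueter.relClosed E um up,
      ∫ z, Fueter.pullback (Fueter.slice U τ) σ z =
        ∫ z, Fueter.formOn σ U (0, z) Fueter.es Fueter.et := fun τ hτ σ hσ => by
    rw [e τ hτ]
    exact hU.integral_formOn_eq _hg hσ hτ
  obtain ⟨κ, hκ⟩ := hU.exists_class _hg
  refine ⟨hint, fun τ hτ => ⟨hi τ hτ _ him.1, ?_⟩, ⟨him, κ, fun τ hτ σ => ⟨hi τ hτ _ σ.2.1, ?_⟩,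
    fun τ hτ f hf σ => ?_, ?_⟩, fun lam hl hd τ hτ => ⟨_, hU.tendsto_action _hg hl him.1 hd hτ, ?_, ?_⟩⟩
  · rw [heq τ hτ _ him]
    exact hen
  · rw [heq τ hτ _ σ.2, hκ]
  · rw [hU.integral_pullback_eq_of_homotopic σ.2 hf, heq τ hτ _ σ.2, hκ]
  · rw [hκ]
    exact hen
  · rw [e τ hτ]
  · rw [hU.integral_formOn_eq _hg him hτ, mul_neg, ← neg_mul]
    exact hen
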